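/- Let $G$ be a (finite-dimensional, real) Poisson Lie group with Poisson bivector $\pi_G$ and Lie algebra $\mathfrak g$, and let $G^*$ be its dual Poisson Lie group: the connected and simply connected Lie group with Lie algebra $\mathfrak g^\star$ (whose bracket is the linearization of $\pi_G$ at the identity), with the multiplicative Poisson structure $\pi_{G^*}$ whose linearization at the identity is the Lie bracket of $\mathfrak g$. Let $H\subset G$ be a connected closed Lie subgroup with Lie algebra $\mathfrak h$, put $\mathfrak h^\perp=\{\xi\in\mathfrak g^\star : \langle \xi,X\rangle=0\ \forall X\in\mathfrak h\}$, and let $H^\perp\subset G^*$ be a closed Lie subgroup with Lie algebra $\mathfrak h^\perp$. With the convention $\langle\beta,\pi^\sharp\alpha\rangle=\pi(\beta,\alpha)$, the dressing vector fields are $$\mathcal S_X(\gamma)=\pi_{G^*}^\sharp(r_{\gamma^{-1}}^*X)\quad(X\in\mathfrak g,\ \gamma\in G^*),\qquad \mathcal S_\xi(g)=-\pi_G^\sharp(l_{g^{-1}}^*\xi)\quad(\xi\in\mathfrak g^\star,\ g\in G).$$ Suppose that $H^\perp$ is (connected and) simply connected and that $H$ is a Poisson Lie subgroup of $G$, i.e.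 $H$ carries a multiplicative Poisson structure for which the inclusion $H\hookrightarrow G$ is a Poisson map. Then $(H,H^\perp)$ is relatively complete, that is: there are a smooth left action $(h,\gamma)\mapsto{}^h\gamma$ of $H$ on $H^\perp$ and a smooth right action $(h,\gamma)\mapsto h^\gamma$ of $H^\perp$ on $H$ whose fundamental vector fields are $\mathcal S_X|_{H^\perp}$, $X\in\mathfrak h$, and $\mathcal S_\xi|_{H}$, $\xi\in\mathfrak h^\perp$, respectively, and for which $H$ and $H^\perp$ form a matched pair of Lie groups: $$(h_1h_2)^\gamma=h_1^{\,{}^{h_2}\gamma}\,h_2^\gamma,\qquad {}^h(\gamma_1\gamma_2)={}^h\gamma_1\;{}^{h^{\gamma_1}}\gamma_2,$$ and there is a double Lie group $D$ containing $H$ and $H^\perp$ as closed Lie subgroups such that $H\times H^\perp\to D$, $(h,\gamma)\mapsto h\gamma$, is a diffeomorphism and $h\gamma={}^h\gamma\,h^\gamma$ in $D$. -/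

import Mathlib

open scoped Manifold ContDiff

noncomputable section

namespace PoissonLie

/-- The cotangent space at `p` of a manifold modelled on the vector space `E`. -/
abbrev Cotangent (E : Type*) [NormedAddCommGroup E] [NormedSpace ℝ E]
    {M : Type*} [TopologicalSpace M] [ChartedSpace E M] (p : M) : Type _ :=
  TangentSpace 𝓘(ℝ, E) p →L[ℝ] ℝ

/-- The differential of a real function, as a covector at `p`. -/
def diff (E : Type*) [NormedAddCommGroup E] [NormedSpace ℝ E]
    {M : Type*} [TopologicalSpace M] [ChartedSpace E M] (f : M → ℝ) (p : M) : Cotangent E p :=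
  (mfderiv 𝓘(ℝ, E) 𝓘(ℝ, ℝ) f p : TangentSpace 𝓘(ℝ, E) p →L[ℝ] ℝ)

/-- A smooth field of maps `π♯ : T*M → TM` that is skew, that is, a smooth bivector field `π`,
with the convention `π(β, α) = β (π♯ α)`. The bracket is `{f, g} = π(df, dg)`, and the last axiom
says that `π` is Poisson. -/
structure PoissonStructure (E : Type*) [NormedAddCommGroup E] [NormedSpace ℝ E]
    (M : Type*) [TopologicalSpace M] [ChartedSpace E M] where
  /-- The bundle map `π♯`. -/
  sharp : ∀ p : M, Cotangent E p →ₗ[ℝ] TangentSpace 𝓘(ℝ, E) p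
  skew : ∀ (p : M) (α : Cotangent E p), α (sharp p α) = 0
  smooth : ∀ f g : M → ℝ, ContMDiff 𝓘(ℝ, E) 𝓘(ℝ, ℝ) ∞ f → ContMDiff 𝓘(ℝ, E) 𝓘(ℝ, ℝ) ∞ g →
    ContMDiff 𝓘(ℝ, E) 𝓘(ℝ, ℝ) ∞ (fun p => diff E f p (sharp p (diff E g p)))
  jacobi : ∀ f g h : M → ℝ, ContMDiff 𝓘(ℝ, E) 𝓘(ℝ, ℝ) ∞ f →
    ContMDiff 𝓘(ℝ, E) 𝓘(ℝ, ℝ) ∞ g → ContMDiff 𝓘(ℝ, E) 𝓘(ℝ, ℝ) ∞ h → ∀ p : M,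
    diff E f p (sharp p (diff E (fun q => diff E g q (sharp q (diff E h q))) p)) +
    diff E g p (sharp p (diff E (fun q => diff E h q (sharp q (diff E f q))) p)) +
    diff E h p (sharp p (diff E (fun q => diff E f q (sharp q (diff E g q))) p)) = 0

namespace PoissonStructure

variable {E : Type*} [NormedAddCommGroup E] [NormedSpace ℝ E]
  {E' : Type*} [NormedAddCommGroup E'] [NormedSpace ℝ E']
  {M : Type*} [TopologicalSpace M] [ChartedSpace E M]
  {N : Type*} [TopologicalSpace N] [ChartedSpace E' N]
  {G : Type*} [TopologicalSpace G] [ChartedSpace E G] [Group G]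

/-- The Poisson bracket `{f, g} = π(df, dg)`. -/
def bracket (π : PoissonStructure E M) (f g : M → ℝ) (p : M) : ℝ :=
  diff E f p (π.sharp p (diff E g p))

/-- `f` is a Poisson map: it is smooth and `π_N (f p)` is the push-forward of `π_M p`. -/
def IsPoissonMap (πM : PoissonStructure E M) (πN : PoissonStructure E' N) (f : M → N) : Prop :=
  ContMDiff 𝓘(ℝ, E) 𝓘(ℝ, E') ∞ f ∧
  ∀ (p : M) (β : Cotangent E' (f p)),
    πN.sharp (f p) β = mfderiv 𝓘(ℝ, E) 𝓘(ℝ, E') f p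
      (πM.sharp p (β.comp (mfderiv 𝓘(ℝ, E) 𝓘(ℝ, E') f p)))

/-- Multiplicativity, `π(gh) = l_g π(h) + r_h π(g)`: the group `G` with `π` is a
Poisson Lie group. -/
def IsMultiplicative (π : PoissonStructure E G) : Prop :=
  ∀ (g h : G) (α : Cotangent E (g * h)),
    π.sharp (g * h) α =
      mfderiv 𝓘(ℝ, E) 𝓘(ℝ, E) (fun x : G => g * x) h
        (π.sharp h (α.comp (mfderiv 𝓘(ℝ, E) 𝓘(ℝ, E) (fun x : G => g * x) h))) +
      mfderiv 𝓘(ℝ, E) 𝓘(ℝ, E) (fun x : G => x * h) g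
        (π.sharp g (α.comp (mfderiv 𝓘(ℝ, E) 𝓘(ℝ, E) (fun x : G => x * h) g)))

end PoissonStructure

/-- A homomorphism that identifies `H` with a closed Lie subgroup of `G`. -/
structure IsClosedLieSubgroup {E E' : Type*} [NormedAddCommGroup E] [NormedSpace ℝ E]
    [NormedAddCommGroup E'] [NormedSpace ℝ E'] {B B' : Type*} [TopologicalSpace B]
    [TopologicalSpace B'] (I : ModelWithCorners ℝ E B) (I' : ModelWithCorners ℝ E' B')
    {H : Type*} [TopologicalSpace H] [ChartedSpace B H] [Group H]
    {G : Type*} [TopologicalSpace G] [ChartedSpace B' G] [Group G] (ι : H →* G) : Prop where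
  smooth : ContMDiff I I' ∞ ι
  immersion : ∀ h : H, Function.Injective (mfderiv I I' ι h)
  isClosedEmbedding : Topology.IsClosedEmbedding ι

/-- The homomorphism of Lie algebras induced by a homomorphism of Lie groups (its derivative
at `1`). -/
def lieMap (E E' : Type*) [NormedAddCommGroup E] [NormedSpace ℝ E]
    [NormedAddCommGroup E'] [NormedSpace ℝ E']
    {H : Type*} [TopologicalSpace H] [ChartedSpace E H] [Group H]
    {G : Type*} [TopologicalSpace G] [ChartedSpace E' G] [Group G] (ι : H →* G) :
    GroupLieAlgebra 𝓘(ℝ, E) H →L[ℝ] GroupLieAlgebra 𝓘(ℝ, E') G :=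
  (mfderiv 𝓘(ℝ, E) 𝓘(ℝ, E') ι 1 : E →L[ℝ] E')

/-- The left translation `T_g G → T_1 G`, `v ↦ g⁻¹ v`. -/
def leftTriv (E : Type*) [NormedAddCommGroup E] [NormedSpace ℝ E]
    {G : Type*} [TopologicalSpace G] [ChartedSpace E G] [Group G] (g : G) :
    TangentSpace 𝓘(ℝ, E) g →L[ℝ] GroupLieAlgebra 𝓘(ℝ, E) G :=
  (mfderiv 𝓘(ℝ, E) 𝓘(ℝ, E) (fun x : G => g⁻¹ * x) g : E →L[ℝ] E)

/-- The right translation `T_g G → T_1 G`, `v ↦ v g⁻¹`. -/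
def rightTriv (E : Type*) [NormedAddCommGroup E] [NormedSpace ℝ E]
    {G : Type*} [TopologicalSpace G] [ChartedSpace E G] [Group G] (g : G) :
    TangentSpace 𝓘(ℝ, E) g →L[ℝ] GroupLieAlgebra 𝓘(ℝ, E) G :=
  (mfderiv 𝓘(ℝ, E) 𝓘(ℝ, E) (fun x : G => x * g⁻¹) g : E →L[ℝ] E)

section Dual

variable {E F : Type*} [NormedAddCommGroup E] [NormedSpace ℝ E]
  [NormedAddCommGroup F] [NormedSpace ℝ F]
  {G : Type*} [TopologicalSpace G] [ChartedSpace E G] [Group G]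
  {Gs : Type*} [TopologicalSpace Gs] [ChartedSpace F Gs] [Group Gs]

/-- `ψ : Lie Gs ≃ (Lie G)*` makes the Poisson Lie groups `G` and `Gs` dual to each other: through
`ψ` the Lie bracket of `Lie Gs` is the linearization of `πG` at the identity, and the Lie bracket
of `Lie G` is the linearization of `πGs` at the identity. The linearization of a Poisson structure
that vanishes at `1` is the bracket `[d₁f₁, d₁f₂] = d₁{f₁, f₂}` on covectors at `1`. -/
structure IsDualPair (πG : PoissonStructure E G) (πGs : PoissonStructure F Gs)
    (ψ : GroupLieAlgebra 𝓘(ℝ, F) Gs ≃L[ℝ] (GroupLieAlgebra 𝓘(ℝ, E) G →L[ℝ] ℝ)) : Prop where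
  linearization : ∀ (ξ₁ ξ₂ : GroupLieAlgebra 𝓘(ℝ, F) Gs) (f₁ f₂ : G → ℝ),
    ContMDiff 𝓘(ℝ, E) 𝓘(ℝ, ℝ) ∞ f₁ → ContMDiff 𝓘(ℝ, E) 𝓘(ℝ, ℝ) ∞ f₂ →
    diff E f₁ 1 = ψ ξ₁ → diff E f₂ 1 = ψ ξ₂ →
    diff E (πG.bracket f₁ f₂) 1 = ψ ⁅ξ₁, ξ₂⁆
  linearization_dual : ∀ (X₁ X₂ : GroupLieAlgebra 𝓘(ℝ, E) G) (f₁ f₂ : Gs → ℝ),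
    ContMDiff 𝓘(ℝ, F) 𝓘(ℝ, ℝ) ∞ f₁ → ContMDiff 𝓘(ℝ, F) 𝓘(ℝ, ℝ) ∞ f₂ →
    (∀ ξ : GroupLieAlgebra 𝓘(ℝ, F) Gs, diff F f₁ 1 ξ = ψ ξ X₁) →
    (∀ ξ : GroupLieAlgebra 𝓘(ℝ, F) Gs, diff F f₂ 1 ξ = ψ ξ X₂) →
    ∀ ξ : GroupLieAlgebra 𝓘(ℝ, F) Gs, diff F (πGs.bracket f₁ f₂) 1 ξ = ψ ξ ⁅X₁, X₂⁆

/-- The left dressing vector field on `Gs` of `X : Lie G`,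
`S_X(γ) = π_{Gs}♯ (r_{γ⁻¹}^* X)`, where `X` is seen as a covector on `Lie Gs`. -/
def leftDressing (πGs : PoissonStructure F Gs)
    (ψ : GroupLieAlgebra 𝓘(ℝ, F) Gs ≃L[ℝ] (GroupLieAlgebra 𝓘(ℝ, E) G →L[ℝ] ℝ))
    (X : GroupLieAlgebra 𝓘(ℝ, E) G) (γ : Gs) : TangentSpace 𝓘(ℝ, F) γ :=
  πGs.sharp γ
    { toFun := fun v => ψ (rightTriv F γ v) X
      map_add' := fun v w => by simp only [map_add, add_apply]
      map_smul' := fun c v => by simp only [map_smul, smul_apply, RingHom.id_apply]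
      cont := ((ContinuousLinearMap.apply ℝ ℝ (show E from X)).continuous.comp
        ψ.continuous).comp (rightTriv F γ).continuous }

/-- The right dressing vector field on `G` of `ξ : Lie Gs`, `S_ξ(g) = - π_G♯ (l_{g⁻¹}^* ξ)`. -/
def rightDressing (πG : PoissonStructure E G)
    (ψ : GroupLieAlgebra 𝓘(ℝ, F) Gs ≃L[ℝ] (GroupLieAlgebra 𝓘(ℝ, E) G →L[ℝ] ℝ))
    (ξ : GroupLieAlgebra 𝓘(ℝ, F) Gs) (g : G) : TangentSpace 𝓘(ℝ, E) g :=
  - πG.sharp g ((ψ ξ).comp (leftTriv E g))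

end Dual

section MatchedPair

/-- A matched pair of Lie groups: a smooth left action `(h, γ) ↦ ʰγ` of `H` on `K` and a smooth
right action `(h, γ) ↦ h^γ` of `K` on `H` with the intertwining relations
`(h₁ h₂)^γ = h₁^(ʰ²γ) h₂^γ` and `ʰ(γ₁ γ₂) = ʰγ₁ ^(h^γ₁)γ₂`. -/
structure MatchedPair (EH EK : Type*) [NormedAddCommGroup EH] [NormedSpace ℝ EH]
    [NormedAddCommGroup EK] [NormedSpace ℝ EK]
    (H : Type*) [TopologicalSpace H] [ChartedSpace EH H] [Group H]
    (K : Type*) [TopologicalSpace K] [ChartedSpace EK K] [Group K] where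
  /-- `left h γ` is `ʰγ`. -/
  left : H → K → K
  /-- `right h γ` is `h^γ`. -/
  right : H → K → H
  smooth_left : ContMDiff (𝓘(ℝ, EH).prod 𝓘(ℝ, EK)) 𝓘(ℝ, EK) ∞ (fun p : H × K => left p.1 p.2)
  smooth_right : ContMDiff (𝓘(ℝ, EH).prod 𝓘(ℝ, EK)) 𝓘(ℝ, EH) ∞ (fun p : H × K => right p.1 p.2)
  left_one : ∀ γ, left 1 γ = γ
  left_mul : ∀ h₁ h₂ γ, left (h₁ * h₂) γ = left h₁ (left h₂ γ)
  right_one : ∀ h, right h 1 = h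
  right_mul : ∀ h γ₁ γ₂, right h (γ₁ * γ₂) = right (right h γ₁) γ₂
  mul_right : ∀ h₁ h₂ γ, right (h₁ * h₂) γ = right h₁ (left h₂ γ) * right h₂ γ
  mul_left : ∀ h γ₁ γ₂, left h (γ₁ * γ₂) = left h γ₁ * left (right h γ₁) γ₂

variable {EH EK : Type*} [NormedAddCommGroup EH] [NormedSpace ℝ EH]
    [NormedAddCommGroup EK] [NormedSpace ℝ EK]
    {H : Type*} [TopologicalSpace H] [ChartedSpace EH H] [Group H]
    {K : Type*} [TopologicalSpace K] [ChartedSpace EK K] [Group K]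

/-- The Lie group `D` with `i : H → D` and `k : K → D` is a double Lie group of the matched pair:
`H` and `K` are closed Lie subgroups, `(h, γ) ↦ hγ` is a diffeomorphism from `H × K` onto `D`, and
`hγ = ʰγ h^γ` in `D`. -/
structure IsDoubleLieGroup (P : MatchedPair EH EK H K)
    {D : Type*} [TopologicalSpace D] [ChartedSpace (ModelProd EH EK) D] [Group D]
    (i : H →* D) (k : K →* D) : Prop where
  left_subgroup : IsClosedLieSubgroup 𝓘(ℝ, EH) (𝓘(ℝ, EH).prod 𝓘(ℝ, EK)) i
  right_subgroup : IsClosedLieSubgroup 𝓘(ℝ, EK) (𝓘(ℝ, EH).prod 𝓘(ℝ, EK)) k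
  factorization : ∃ Φ : Diffeomorph (𝓘(ℝ, EH).prod 𝓘(ℝ, EK)) (𝓘(ℝ, EH).prod 𝓘(ℝ, EK))
    (H × K) D ∞, ∀ h γ, Φ (h, γ) = i h * k γ
  exchange : ∀ h γ, i h * k γ = k (P.left h γ) * i (P.right h γ)

end MatchedPair

section RelativelyComplete

universe uH uK

variable {E F EH EK : Type*} [NormedAddCommGroup E] [NormedSpace ℝ E]
  [NormedAddCommGroup F] [NormedSpace ℝ F]
  [NormedAddCommGroup EH] [NormedSpace ℝ EH] [NormedAddCommGroup EK] [NormedSpace ℝ EK]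
  {G : Type*} [TopologicalSpace G] [ChartedSpace E G] [Group G]
  {Gs : Type*} [TopologicalSpace Gs] [ChartedSpace F Gs] [Group Gs]
  {H : Type uH} [TopologicalSpace H] [ChartedSpace EH H] [Group H]
  {K : Type uK} [TopologicalSpace K] [ChartedSpace EK K] [Group K]

/-- The fundamental vector fields of the two actions of the matched pair are the dressing vector
fields, of `Lie H` on `K` and of `Lie K` on `H`, where `H ⊆ G` through `ι` and `K ⊆ Gs`
through `j`. -/
structure MatchedPair.IntegratesDressing (P : MatchedPair EH EK H K)
    (πG : PoissonStructure E G) (πGs : PoissonStructure F Gs)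
    (ψ : GroupLieAlgebra 𝓘(ℝ, F) Gs ≃L[ℝ] (GroupLieAlgebra 𝓘(ℝ, E) G →L[ℝ] ℝ))
    (ι : H →* G) (j : K →* Gs) : Prop where
  left : ∀ (X : GroupLieAlgebra 𝓘(ℝ, EH) H) (γ : K),
    (mfderiv 𝓘(ℝ, EH) 𝓘(ℝ, F) (fun h : H => j (P.left h γ)) 1 : EH →L[ℝ] F) X =
      leftDressing πGs ψ (lieMap EH E ι X) (j γ)
  right : ∀ (η : GroupLieAlgebra 𝓘(ℝ, EK) K) (h : H),
    (mfderiv 𝓘(ℝ, EK) 𝓘(ℝ, E) (fun γ : K => ι (P.right h γ)) 1 : EK →L[ℝ] E) η =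
      rightDressing πG ψ (lieMap EK F j η) (ι h)

/-- `(H, K)` is relatively complete: the dressing vector fields of `Lie H` on `K` and of `Lie K`
on `H` integrate to actions for which `H` and `K` form a matched pair of Lie groups, with a double
Lie group `D`. -/
def IsRelativelyComplete
    (πG : PoissonStructure E G) (πGs : PoissonStructure F Gs)
    (ψ : GroupLieAlgebra 𝓘(ℝ, F) Gs ≃L[ℝ] (GroupLieAlgebra 𝓘(ℝ, E) G →L[ℝ] ℝ))
    (ι : H →* G) (j : K →* Gs) : Prop :=
  ∃ P : MatchedPair EH EK H K, P.IntegratesDressing πG πGs ψ ι j ∧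
    ∃ (D : Type (max uH uK)) (_ : TopologicalSpace D) (_ : ChartedSpace (ModelProd EH EK) D)
      (_ : Group D) (_ : LieGroup (𝓘(ℝ, EH).prod 𝓘(ℝ, EK)) ∞ D) (i : H →* D) (k : K →* D),
      IsDoubleLieGroup P i k

end RelativelyComplete

/-- `H`, embedded by `ι` in the Poisson Lie group `G`, is a Poisson Lie subgroup: it has a
multiplicative Poisson structure for which `ι` is a Poisson map. -/
def IsPoissonLieSubgroup {E EH : Type*} [NormedAddCommGroup E] [NormedSpace ℝ E]
    [NormedAddCommGroup EH] [NormedSpace ℝ EH]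
    {G : Type*} [TopologicalSpace G] [ChartedSpace E G] [Group G]
    {H : Type*} [TopologicalSpace H] [ChartedSpace EH H] [Group H]
    (πG : PoissonStructure E G) (ι : H →* G) : Prop :=
  ∃ πH : PoissonStructure EH H, πH.IsMultiplicative ∧ πH.IsPoissonMap πG ι

end PoissonLie

end

/-!
The idea. Because `H` is a Poisson Lie subgroup, `π_G♯` maps every covector that annihilates the
tangent space of `H` to zero. The right dressing fields of `Lie K = (Lie H)^⊥` therefore vanish on
`H` (`sharp_comp_leftTriv_eq_zero`), and the right action of `K` on `H` has to be trivial. What is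
left to find is a smooth left action of `H` on `K` by automorphisms whose generators are the
dressing fields of `Lie H`. The double Lie group is then the semidirect product; it is obtained
here as a case of the double Lie group of an arbitrary matched pair
(`MatchedPair.isDoubleLieGroup`).

In the right trivialization a multiplicative bivector field is a one-cocycle (`rightSharp_mul`).
The Poisson condition makes `Lie K` an ideal of `Lie Gs`
(`rdiff_rightSharp_eq_zero_of_isPoissonMap`), so that the covectors on `Lie Gs` given by `Lie H` are
invariant under `Ad K` (`flip_comp_Ad_eq`). Hence the dressing fields of `Lie H` are
tangent to `K`, and in the right trivialization they form a smooth cocycle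
`V : K → Hom(Lie H, Lie K)` (`exists_dressing_cocycle`). By duality, the linearization of `V` at the
identity is the infinitesimal coadjoint action of `Lie H` on `Lie K`, which integrates to a
representation `A` of `H` (`exists_coadjoint_rep`, `rdiff_coadjoint_rep`).

It remains to integrate a cocycle `V` whose linearization integrates to a representation `A` of the
group `H` (`exists_action_of_cocycle`). Along the path `t ↦ h(t) = uncoord (t y)` in `H`, with right
logarithmic derivative `X(t)`, one solves `c' c⁻¹ = V(c) X`. Near the identity of `K` the solutions
exist on `[0, 1]` and depend smoothly on `y` and on the initial point (`exists_smooth_flow`, by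
the implicit function theorem for an integral equation). By the cocycle identity pointwise products
and inverses of solutions are solutions, so on the connected group `K` all solutions exist, and the
time-one maps are smooth endomorphisms of `K` (`exists_local_action`), with differential `A (h 1)`
at the identity. An endomorphism of `K` is determined by its differential
(`hom_eq_of_unitDeriv_eq`), and `H` is generated by any neighbourhood of the identity; therefore for
each `h` there is exactly one smooth endomorphism `φ h` of `K` with differential `A h`, and
`h ↦ φ h` is the action. Completeness of the dressing fields comes from `A` being defined on all of
`H`, and the simple connectedness of `K` enters only through connectedness.

Calculus on a Lie group is done with derivatives moved to the identity by right translation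
(`HasRightDeriv`, `rdiff`), read in the chart at the identity (`coord`). In this way all tangent
spaces are the model space. The bracket enters through `rdiff_Ad_one`: it is the derivative of `Ad`.
-/

section Development

open scoped Manifold ContDiff Topology
open Set Filter

set_option linter.unusedSectionVars false

noncomputable section

namespace PoissonLie

/-! ### Smoothness of composition operators on spaces of continuous functions -/

section Nemytskii

variable {X : Type*} [TopologicalSpace X] [CompactSpace X]

section

variable {E F : Type*} [NormedAddCommGroup E] [NormedSpace ℝ E]
  [NormedAddCommGroup F] [NormedSpace ℝ F]

variable (X E F) in
/-- Pointwise application of a continuous family of operators to a continuous function. -/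
def pointwiseApply : C(X, E →L[ℝ] F) →L[ℝ] C(X, E) →L[ℝ] C(X, F) :=
  LinearMap.mkContinuous₂
    (LinearMap.mk₂ ℝ
      (fun (f : C(X, E →L[ℝ] F)) (u : C(X, E)) => (⟨fun x => f x (u x), by fun_prop⟩ : C(X, F)))
      (fun _ _ _ => by ext; simp) (fun _ _ _ => by ext; simp)
      (fun _ _ _ => by ext; simp) (fun _ _ _ => by ext; simp)) 1
    (fun f u => by
      rw [one_mul, ContinuousMap.norm_le _ (by positivity)]
      intro x
      exact ((f x).le_opNorm _).trans
        (by gcongr; exacts [f.norm_coe_le_norm x, u.norm_coe_le_norm x]))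

@[simp]
lemma pointwiseApply_apply (f : C(X, E →L[ℝ] F)) (u : C(X, E)) (x : X) :
    pointwiseApply X E F f u x = f x (u x) := rfl

variable (X E F) in
lemma contDiff_pointwiseApply {n : ℕ∞ω} :
    ContDiff ℝ n (fun f : C(X, E →L[ℝ] F) => pointwiseApply X E F f) :=
  ContinuousLinearMap.contDiff (𝕜 := ℝ) (E := C(X, E →L[ℝ] F)) (F := C(X, E) →L[ℝ] C(X, F))
    (pointwiseApply X E F)

lemma hasFDerivAt_comp_continuousMap (g : C(E, F)) (g' : C(E, E →L[ℝ] F))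
    (h : ∀ x, HasFDerivAt g (g' x) x) (u : C(X, E)) :
    HasFDerivAt (fun u : C(X, E) => g.comp u) (pointwiseApply X E F (g'.comp u)) u := by
  rw [hasFDerivAt_iff_isLittleO_nhds_zero, Asymptotics.isLittleO_iff]
  intro c hc
  have hcont : ContinuousAt (fun v : C(X, E) => g'.comp v) u :=
    (ContinuousMap.continuous_postcomp g').continuousAt
  obtain ⟨δ, hδ, hδ'⟩ := (Metric.continuousAt_iff (f := fun v : C(X, E) => g'.comp v)
    (a := u)).1 hcont c hc
  filter_upwards [Metric.ball_mem_nhds (0 : C(X, E)) hδ] with v hv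
  rw [mem_ball_zero_iff] at hv
  rw [ContinuousMap.norm_le _ (by positivity)]
  intro x
  -- the mean value inequality on the ball where `g'` oscillates by at most `c`, at the point `x`
  have key := (convex_segment (u x) (u x + v x)).norm_image_sub_le_of_norm_hasFDerivWithin_le'
    (f := g) (f' := fun z => g' z) (φ := g' (u x)) (C := c)
    (fun z _ => (h z).hasFDerivWithinAt) (fun z hz => ?_) (left_mem_segment ℝ _ _)
    (right_mem_segment ℝ _ _)
  · simp only [add_sub_cancel_left] at key
    refine le_trans (le_of_eq ?_) (key.trans ?_)
    · simp
    · gcongr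
      exact v.norm_coe_le_norm x
  · rw [segment_eq_image'] at hz
    obtain ⟨θ, hθ, rfl⟩ := hz
    have h1 : dist (u + θ • v) u < δ := by
      rw [dist_eq_norm, add_sub_cancel_left, norm_smul, Real.norm_of_nonneg hθ.1]
      exact (mul_le_of_le_one_left (norm_nonneg _) hθ.2).trans_lt hv
    have h2 := (ContinuousMap.dist_apply_le_dist x).trans (hδ' h1).le
    simpa [dist_eq_norm] using h2

end

universe u

lemma contDiff_comp_continuousMap_nat {E : Type u} [NormedAddCommGroup E] [NormedSpace ℝ E]
    (n : ℕ) : ∀ {F : Type u} [NormedAddCommGroup F] [NormedSpace ℝ F] (g : C(E, F)),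
      ContDiff ℝ n g → ContDiff ℝ n (fun u : C(X, E) => g.comp u) := by
  induction n with
  | zero =>
    intro F _ _ g _
    exact contDiff_zero.2 (ContinuousMap.continuous_postcomp g)
  | succ n ih =>
    intro F _ _ g hg
    obtain ⟨g', hg', hd⟩ := contDiff_succ_iff_hasFDerivAt.1 hg
    let G' : C(E, E →L[ℝ] F) := ⟨g', hg'.continuous⟩
    exact contDiff_succ_iff_hasFDerivAt.2
      ⟨fun u => pointwiseApply X E F (G'.comp u),
        (contDiff_pointwiseApply X E F).comp (ih G' hg'),
        fun u => hasFDerivAt_comp_continuousMap g G' hd u⟩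

/-- Composition with a smooth map is a smooth operation on continuous functions on a compact
space. -/
lemma contDiff_comp_continuousMap {E F : Type u} [NormedAddCommGroup E] [NormedSpace ℝ E]
    [NormedAddCommGroup F] [NormedSpace ℝ F] (g : C(E, F)) (hg : ContDiff ℝ ∞ g) :
    ContDiff ℝ ∞ (fun u : C(X, E) => g.comp u) :=
  contDiff_infty.2 fun n => contDiff_comp_continuousMap_nat n g (contDiff_infty.1 hg n)

end Nemytskii

/-! ### Smooth dependence of solutions of differential equations -/

section Flow

/-- The time interval on which the differential equations are solved; it contains `[0, 1]` in its
interior. -/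
abbrev TimeInterval : Set ℝ := Icc (-1 : ℝ) 2

/-- The projection of the line onto the time interval. -/
def clampTime (t : ℝ) : TimeInterval := projIcc (-1) 2 (by norm_num) t

lemma continuous_clampTime : Continuous clampTime :=
  continuous_projIcc (h := by norm_num)

lemma clampTime_of_mem {t : ℝ} (ht : t ∈ TimeInterval) : clampTime t = ⟨t, ht⟩ :=
  projIcc_of_mem _ ht

lemma abs_time_le (t : TimeInterval) : |(t : ℝ)| ≤ 2 :=
  abs_le.2 ⟨by linarith [t.2.1], t.2.2⟩

variable {E : Type*} [NormedAddCommGroup E] [NormedSpace ℝ E]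

variable (E) in
/-- Integration from `0`, as an operator on continuous functions on the time interval. -/
def primitive : C(TimeInterval, E) →L[ℝ] C(TimeInterval, E) :=
  LinearMap.mkContinuous
    { toFun := fun f => ⟨fun t => ∫ s in (0 : ℝ)..t, f (clampTime s), by
        have hc : Continuous fun s => f (clampTime s) := f.continuous.comp continuous_clampTime
        exact (intervalIntegral.continuous_primitive
          (fun a b => hc.intervalIntegrable a b) 0).comp continuous_subtype_val⟩
      map_add' := fun f g => by
        ext t
        have hf : Continuous fun s => f (clampTime s) := f.continuous.comp continuous_clampTime
        have hg : Continuous fun s => g (clampTime s) := g.continuous.comp continuous_clampTime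
        exact intervalIntegral.integral_add (hf.intervalIntegrable _ _) (hg.intervalIntegrable _ _)
      map_smul' := fun c f => by
        ext t
        exact intervalIntegral.integral_smul _ _ } 2
    (fun f => by
      rw [ContinuousMap.norm_le _ (by positivity)]
      intro t
      refine (intervalIntegral.norm_integral_le_of_norm_le_const (C := ‖f‖)
        (fun s _ => f.norm_coe_le_norm _)).trans ?_
      rw [sub_zero, mul_comm]
      gcongr
      exact abs_time_le t)

lemma primitive_apply (f : C(TimeInterval, E)) (t : TimeInterval) :
    primitive E f t = ∫ s in (0 : ℝ)..t, f (clampTime s) := rfl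

lemma primitive_clampTime_zero (f : C(TimeInterval, E)) : primitive E f (clampTime 0) = 0 := by
  rw [clampTime_of_mem (by norm_num), primitive_apply]
  simp

lemma hasDerivAt_primitive [CompleteSpace E] (f : C(TimeInterval, E)) {t : ℝ}
    (ht : t ∈ Ioo (-1 : ℝ) 2) :
    HasDerivAt (fun s => primitive E f (clampTime s)) (f (clampTime t)) t := by
  have hc : Continuous fun s => f (clampTime s) := f.continuous.comp continuous_clampTime
  refine (intervalIntegral.integral_hasDerivAt_right (hc.intervalIntegrable 0 t)
    (hc.stronglyMeasurableAtFilter _ _) hc.continuousAt).congr_of_eventuallyEq ?_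
  filter_upwards [Ioo_mem_nhds ht.1 ht.2] with s hs
  rw [clampTime_of_mem (Ioo_subset_Icc_self hs), primitive_apply]

variable {P : Type*} [NormedAddCommGroup P] [NormedSpace ℝ P]

variable (E) in
/-- Constant functions on the time interval. -/
def constPath : E →L[ℝ] C(TimeInterval, E) :=
  LinearMap.mkContinuous
    { toFun := fun x => ContinuousMap.const _ x
      map_add' := fun _ _ => rfl
      map_smul' := fun _ _ => rfl } 1
    (fun x => by
      rw [one_mul, ContinuousMap.norm_le _ (norm_nonneg _)]
      exact fun _ => le_rfl)

@[simp] lemma constPath_apply (x : E) (t : TimeInterval) : constPath E x t = x := rfl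

variable (E P) in
/-- The map sending `(y, u)` to the path `t ↦ (t y, u t)`. -/
def radialPath : P × C(TimeInterval, E) →L[ℝ] C(TimeInterval, P × E) :=
  LinearMap.mkContinuous
    { toFun := fun q => ⟨fun t => ((t : ℝ) • q.1, q.2 t), by fun_prop⟩
      map_add' := fun _ _ => by ext <;> simp
      map_smul' := fun c q => by
        ext t
        · simp [smul_comm (t : ℝ) c]
        · simp } 2
    (fun q => by
      rw [ContinuousMap.norm_le _ (by positivity)]
      intro t
      refine max_le ?_ ?_
      · change ‖(t : ℝ) • q.1‖ ≤ _
        rw [norm_smul]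
        exact mul_le_mul (abs_time_le t) (norm_fst_le q) (norm_nonneg _) zero_le_two
      · calc ‖q.2 t‖ ≤ ‖q.2‖ := q.2.norm_coe_le_norm t
          _ ≤ ‖q‖ := norm_snd_le q
          _ ≤ 2 * ‖q‖ := by linarith [norm_nonneg q])

@[simp] lemma radialPath_apply (q : P × C(TimeInterval, E)) (t : TimeInterval) :
    radialPath E P q t = ((t : ℝ) • q.1, q.2 t) := rfl

/-- The integral operator `(y, u) ↦ ∫₀ᵗ B(s y, u s) y ds` of the equation `u' = B(t y, u) y`. -/
def flowOperator (B : C(P × E, P →L[ℝ] E)) (q : P × C(TimeInterval, E)) : C(TimeInterval, E) :=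
  primitive E (pointwiseApply _ _ _ (B.comp (radialPath E P q)) (constPath P q.1))

lemma contDiff_flowOperator (B : C(P × E, P →L[ℝ] E)) (hB : ContDiff ℝ ∞ B) :
    ContDiff ℝ ∞ (flowOperator B) := by
  have h1 : ContDiff ℝ ∞ (fun q : P × C(TimeInterval, E) =>
      pointwiseApply TimeInterval P E (B.comp (radialPath E P q))) :=
    (contDiff_pointwiseApply TimeInterval P E).comp
      ((contDiff_comp_continuousMap B hB).comp (radialPath E P).contDiff)
  have h2 : ContDiff ℝ ∞ (fun q : P × C(TimeInterval, E) => constPath P q.1) :=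
    (constPath P).contDiff.comp contDiff_fst
  exact (primitive E).contDiff.comp (h1.clm_apply h2)

/-- The equation `flowEquation B ((y, x), u) = 0` says that `u' = B(t y, u) y` and `u 0 = x`. -/
def flowEquation (B : C(P × E, P →L[ℝ] E)) (q : (P × E) × C(TimeInterval, E)) :
    C(TimeInterval, E) :=
  q.2 - constPath E q.1.2 - flowOperator B (q.1.1, q.2)

lemma contDiff_flowEquation (B : C(P × E, P →L[ℝ] E)) (hB : ContDiff ℝ ∞ B) :
    ContDiff ℝ ∞ (flowEquation B) := by
  have h1 : ContDiff ℝ ∞ (fun q : (P × E) × C(TimeInterval, E) => constPath E q.1.2) :=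
    (constPath E).contDiff.comp (contDiff_snd.comp contDiff_fst)
  have h2 : ContDiff ℝ ∞ (fun q : (P × E) × C(TimeInterval, E) =>
      flowOperator B (q.1.1, q.2)) :=
    (contDiff_flowOperator B hB).comp ((contDiff_fst.comp contDiff_fst).prodMk contDiff_snd)
  exact (contDiff_snd.sub h1).sub h2

lemma flowOperator_zero (B : C(P × E, P →L[ℝ] E)) (u : C(TimeInterval, E)) :
    flowOperator B (0, u) = 0 := by
  simp [flowOperator]

lemma fderiv_flowEquation_comp_inr (B : C(P × E, P →L[ℝ] E)) (hB : ContDiff ℝ ∞ B) :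
    fderiv ℝ (flowEquation B) 0 ∘L .inr ℝ (P × E) C(TimeInterval, E) =
      ContinuousLinearMap.id ℝ _ := by
  have h1 : HasFDerivAt (flowEquation B) (fderiv ℝ (flowEquation B) 0)
      (ContinuousLinearMap.inr ℝ (P × E) C(TimeInterval, E) 0) := by
    rw [map_zero]
    exact ((contDiff_flowEquation B hB).differentiable (by simp)).differentiableAt.hasFDerivAt
  have h2 := h1.comp (0 : C(TimeInterval, E))
    (ContinuousLinearMap.inr ℝ (P × E) C(TimeInterval, E)).hasFDerivAt
  refine h2.unique ?_
  have h3 : flowEquation B ∘ ContinuousLinearMap.inr ℝ (P × E) C(TimeInterval, E) = id := by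
    funext u
    simp [flowEquation, flowOperator_zero]
  rw [h3]
  exact hasFDerivAt_id _

/-- The implicit function theorem at all points near the base point. -/
lemma exists_contDiffAt_implicit {E₁ E₂ F : Type*} [NormedAddCommGroup E₁] [NormedSpace ℝ E₁]
    [CompleteSpace E₁] [NormedAddCommGroup E₂] [NormedSpace ℝ E₂] [CompleteSpace E₂]
    [NormedAddCommGroup F] [NormedSpace ℝ F] [CompleteSpace F]
    (f : E₁ × E₂ → F) (hf : ContDiff ℝ ∞ f) (u : E₁ × E₂) (hu : f u = 0)
    (hinv : (fderiv ℝ f u ∘L .inr ℝ E₁ E₂).IsInvertible) :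
    ∃ ψ : E₁ → E₂, ψ u.1 = u.2 ∧ (∀ᶠ v in 𝓝 u, f v = 0 ↔ ψ v.1 = v.2) ∧
      ∀ᶠ p in 𝓝 u.1, ContDiffAt ℝ ∞ ψ p ∧ f (p, ψ p) = 0 := by
  have h0 : (∞ : ℕ∞ω) ≠ 0 := by simp
  set ψ := (hf.contDiffAt (x := u)).implicitFunction h0 hinv with hψ
  have hψu : ψ u.1 = u.2 := ContDiffAt.implicitFunction_apply_self _ _ _
  have hψ1 : ContDiffAt ℝ 1 ψ u.1 :=
    (ContDiffAt.contDiffAt_implicitFunction _ _ _).of_le (by simp)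
  have hzero : ∀ᶠ p in 𝓝 u.1, f (p, ψ p) = 0 := by
    have := (hf.contDiffAt (x := u)).eventually_apply_implicitFunction h0 hinv
    rwa [hu] at this
  refine ⟨ψ, hψu, ?_, ?_⟩
  · have := (hf.contDiffAt (x := u)).eventually_apply_eq_iff_implicitFunction h0 hinv
    rwa [hu] at this
  -- the derivative of the equation stays invertible along the graph of `ψ`
  have hcont : ContinuousAt (fun p => fderiv ℝ f (p, ψ p) ∘L .inr ℝ E₁ E₂) u.1 := by
    have h1 : Continuous (fderiv ℝ f) := hf.continuous_fderiv (by simp)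
    have h2 : ContinuousAt (fun p => fderiv ℝ f (p, ψ p)) u.1 :=
      ContinuousAt.comp (g := fderiv ℝ f) h1.continuousAt
        (continuousAt_id.prodMk hψ1.continuousAt)
    exact h2.clm_comp continuousAt_const
  have hinv' : ∀ᶠ p in 𝓝 u.1, (fderiv ℝ f (p, ψ p) ∘L .inr ℝ E₁ E₂).IsInvertible := by
    obtain ⟨e, he⟩ := hinv
    have : ∀ᶠ A in 𝓝 (fderiv ℝ f (u.1, ψ u.1) ∘L .inr ℝ E₁ E₂), A.IsInvertible := by
      rw [hψu, ← he]
      exact mem_of_superset (ContinuousLinearEquiv.nhds e) (by rintro _ ⟨e', rfl⟩; exact ⟨e', rfl⟩)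
    exact hcont.eventually this
  have hcd : ∀ᶠ p in 𝓝 u.1, ContDiffAt ℝ 1 ψ p := hψ1.eventually (by simp)
  filter_upwards [hzero.eventually_nhds, hinv', hcd] with p hp hpi hpc
  refine ⟨?_, hp.self_of_nhds⟩
  -- near `p`, the function `ψ` is the implicit function based at `(p, ψ p)`
  have key := (hf.contDiffAt (x := (p, ψ p))).eventually_apply_eq_iff_implicitFunction h0 hpi
  rw [hp.self_of_nhds] at key
  have h3 : ContinuousAt (fun q => (q, ψ q)) p := continuousAt_id.prodMk hpc.continuousAt
  refine (ContDiffAt.contDiffAt_implicitFunction (hf.contDiffAt (x := (p, ψ p))) h0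
    hpi).congr_of_eventuallyEq ?_
  filter_upwards [h3.eventually key, hp] with q hq hq0
  exact (hq.1 hq0).symm

/-- A fixed point of an integral equation solves the corresponding differential equation. -/
lemma hasDerivAt_of_eq_add_primitive [CompleteSpace E] {u f : C(TimeInterval, E)} {x : E}
    (h : u = constPath E x + primitive E f) :
    u (clampTime 0) = x ∧
      ∀ t ∈ Ioo (-1 : ℝ) 2, HasDerivAt (fun s => u (clampTime s)) (f (clampTime t)) t := by
  subst h
  refine ⟨by simp [primitive_clampTime_zero], fun t ht => ?_⟩
  simpa using (hasDerivAt_primitive f ht).const_add x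

/-- Smooth dependence on the parameters: the solutions of `u' = B(t y, u) y` with `u 0 = x`, for
`(y, x)` near `0`, form a smooth family if `B(y, 0) = 0` for all `y`. The derivative of the time
one map at `x = 0` is the time one map of the linearized equation. -/
theorem exists_smooth_flow [CompleteSpace E] [CompleteSpace P] (B : P × E → P →L[ℝ] E)
    (hB : ContDiff ℝ ∞ B) (hB0 : ∀ y, B (y, 0) = 0) {O : Set E} (hO : O ∈ 𝓝 (0 : E)) :
    ∃ U : P × E → ℝ → E,
      (∀ᶠ p in 𝓝 (0 : P × E), ContDiffAt ℝ ∞ (fun q => U q 1) p ∧ U p 0 = p.2 ∧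
        (∀ t ∈ Icc (0 : ℝ) 1, U p t ∈ O) ∧
        ∀ t ∈ Icc (0 : ℝ) 1, HasDerivAt (U p) (B (t • p.1, U p t) p.1) t) ∧
      ∀ᶠ y in 𝓝 (0 : P), ∀ ξ : E, ∃ w : ℝ → E, w 0 = ξ ∧
        (∀ t ∈ Icc (0 : ℝ) 1,
          HasDerivAt w (fderiv ℝ (fun x => B (t • y, x)) 0 (w t) y) t) ∧
        HasFDerivAt (fun x => U (y, x) 1) (fderiv ℝ (fun x => U (y, x) 1) 0) 0 ∧
        w 1 = fderiv ℝ (fun x => U (y, x) 1) 0 ξ := by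
  let b : C(P × E, P →L[ℝ] E) := ⟨B, hB.continuous⟩
  have hb : ContDiff ℝ ∞ b := hB
  have hI : ∀ {t : ℝ}, t ∈ Icc (0 : ℝ) 1 → t ∈ Ioo (-1 : ℝ) 2 := fun ht =>
    ⟨by linarith [ht.1], by linarith [ht.2]⟩
  have hclamp : ∀ {t : ℝ}, t ∈ Icc (0 : ℝ) 1 → (clampTime t : ℝ) = t := fun ht => by
    rw [clampTime_of_mem (Ioo_subset_Icc_self (hI ht))]
  have hz : ∀ y : P, flowEquation b ((y, 0), 0) = 0 := by
    intro y
    have : flowOperator b (y, 0) = 0 := by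
      have : pointwiseApply TimeInterval P E (b.comp (radialPath E P (y, 0))) (constPath P y)
          = 0 := by
        ext t
        simp [b, hB0]
      rw [flowOperator, this, map_zero]
    simp [flowEquation, this]
  have hz0 : flowEquation b 0 = 0 := hz 0
  have hinv : (fderiv ℝ (flowEquation b) 0 ∘L .inr ℝ (P × E) C(TimeInterval, E)).IsInvertible := by
    rw [fderiv_flowEquation_comp_inr b hb]
    exact ⟨ContinuousLinearEquiv.refl ℝ _, rfl⟩
  obtain ⟨ψ, hψ0, hψiff, hψ⟩ := exists_contDiffAt_implicit (flowEquation b)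
    (contDiff_flowEquation b hb) 0 hz0 hinv
  simp only [Prod.fst_zero, Prod.snd_zero] at hψ0 hψ
  have hfix : ∀ {p : P × E}, flowEquation b (p, ψ p) = 0 →
      ψ p = constPath E p.2 + flowOperator b (p.1, ψ p) := fun h => by
    rw [flowEquation, sub_sub, sub_eq_zero] at h
    exact h
  let ev : ℝ → C(TimeInterval, E) →L[ℝ] E := fun t => ContinuousMap.evalCLM ℝ (clampTime t)
  refine ⟨fun p t => ψ p (clampTime t), ?_, ?_⟩
  · have hsmall : ∀ᶠ p in 𝓝 (0 : P × E), ∀ t, ψ p t ∈ O := by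
      obtain ⟨ε, hε, hεO⟩ := Metric.mem_nhds_iff.1 hO
      have hc : ContinuousAt ψ 0 := hψ.self_of_nhds.1.continuousAt
      have := hc.eventually (Metric.ball_mem_nhds (ψ 0) hε)
      filter_upwards [this] with p hp t
      apply hεO
      rw [hψ0, dist_zero_right] at hp
      rw [mem_ball_zero_iff]
      exact ((ψ p).norm_coe_le_norm t).trans_lt hp
    filter_upwards [hψ, hsmall] with p hp hps
    have key := hasDerivAt_of_eq_add_primitive (hfix hp.2)
    refine ⟨(ev 1).contDiff.contDiffAt.comp p hp.1, key.1, fun t _ => hps _, fun t ht => ?_⟩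
    have := key.2 t (hI ht)
    simpa [b, hclamp ht] using this
  · have hy : ∀ᶠ y in 𝓝 (0 : P), ψ (y, 0) = 0 := by
      have hc : ContinuousAt (fun y : P => (((y, 0), 0) : (P × E) × C(TimeInterval, E))) 0 := by
        fun_prop
      filter_upwards [hc.eventually hψiff] with y hy
      exact hy.1 (hz y)
    have hc : ContinuousAt (fun y : P => ((y, 0) : P × E)) 0 := by fun_prop
    filter_upwards [hy, hc.eventually hψ.eventually_nhds] with y hy0 hyψ ξ
    have hψy : HasFDerivAt (fun x => ψ (y, x)) (fderiv ℝ (fun x => ψ (y, x)) 0) 0 := by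
      have h1 : DifferentiableAt ℝ ψ (y, 0) :=
        hyψ.self_of_nhds.1.differentiableAt (by simp)
      have h2 : DifferentiableAt ℝ (fun x : E => ψ (y, x)) 0 :=
        DifferentiableAt.comp (g := ψ) (0 : E) h1 (by fun_prop)
      exact h2.hasFDerivAt
    set W := fderiv ℝ (fun x => ψ (y, x)) 0 with hW
    have hU : HasFDerivAt (fun x => ψ (y, x) (clampTime 1)) ((ev 1).comp W) 0 :=
      (ev 1).hasFDerivAt.comp (0 : E) hψy
    -- the derivative of the integral operator at the constant solution
    let B' : C(P × E, P × E →L[ℝ] P →L[ℝ] E) :=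
      ⟨fderiv ℝ B, hB.continuous_fderiv (by simp)⟩
    have hop : HasFDerivAt (fun u => flowOperator b (y, u))
        (primitive E ∘L ((pointwiseApply TimeInterval P E).flip (constPath P y)) ∘L
          (pointwiseApply TimeInterval (P × E) (P →L[ℝ] E) (B'.comp (radialPath E P (y, 0)))) ∘L
            (radialPath E P ∘L .inr ℝ P C(TimeInterval, E))) (ψ (y, 0)) := by
      have h1 : HasFDerivAt (fun u : C(TimeInterval, E) => radialPath E P (y, u))
          (radialPath E P ∘L .inr ℝ P C(TimeInterval, E)) (ψ (y, 0)) :=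
        (radialPath E P).hasFDerivAt.comp (ψ (y, 0)) (hasFDerivAt_prodMk_right y (ψ (y, 0)))
      have h2 := hasFDerivAt_comp_continuousMap b B'
        (fun z => ((hB.differentiable (by simp)) z).hasFDerivAt) (radialPath E P (y, 0))
      rw [← hy0] at h2 ⊢
      have h3 := h2.comp (ψ (y, 0)) h1
      have h4 := ((pointwiseApply TimeInterval P E).flip (constPath P y)).hasFDerivAt.comp
        (ψ (y, 0)) h3
      exact (primitive E).hasFDerivAt.comp (ψ (y, 0)) h4
    have heq : (fun x => ψ (y, x)) =ᶠ[𝓝 0]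
        fun x => constPath E x + flowOperator b (y, ψ (y, x)) := by
      have hc2 : ContinuousAt (fun x : E => ((y, x) : P × E)) 0 := by fun_prop
      filter_upwards [hc2.eventually hyψ] with x hx
      exact hfix hx.2
    have hsum := (constPath E).hasFDerivAt.add (hop.comp (0 : E) hψy)
    have hWeq := hψy.unique (hsum.congr_of_eventuallyEq heq)
    have hWξ : W ξ = constPath E ξ + primitive E
        (pointwiseApply TimeInterval P E (pointwiseApply TimeInterval (P × E) (P →L[ℝ] E)
          (B'.comp (radialPath E P (y, 0))) (radialPath E P (0, W ξ))) (constPath P y)) := by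
      conv_lhs => rw [hWeq]
      rfl
    have key := hasDerivAt_of_eq_add_primitive hWξ
    refine ⟨fun t => W ξ (clampTime t), key.1, fun t ht => ?_, ?_, ?_⟩
    · have h5 := key.2 t (hI ht)
      have h6 : fderiv ℝ (fun x => B (t • y, x)) 0 =
          fderiv ℝ B (t • y, 0) ∘L .inr ℝ P E :=
        (((hB.differentiable (by simp)) (t • y, 0)).hasFDerivAt.comp (0 : E)
          (hasFDerivAt_prodMk_right (t • y) (0 : E))).fderiv
      rw [h6]
      simpa [B', hclamp ht] using h5
    · exact hU.differentiableAt.hasFDerivAt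
    · rw [hU.fderiv]
      rfl

end Flow

/-! ### A chart of a Lie group centred at the identity -/

section Chart

variable {E : Type*} [NormedAddCommGroup E] [NormedSpace ℝ E]
  {G : Type*} [TopologicalSpace G] [ChartedSpace E G] [Group G]
  {V : Type*} [NormedAddCommGroup V] [NormedSpace ℝ V]

variable (E) in
/-- The chart at the identity, translated so that it takes the identity to `0`. -/
def coord (g : G) : E := extChartAt 𝓘(ℝ, E) (1 : G) g - extChartAt 𝓘(ℝ, E) (1 : G) 1

variable (G) in
/-- The inverse of the chart `coord`. -/
def uncoord (z : E) : G := (extChartAt 𝓘(ℝ, E) (1 : G)).symm (z + extChartAt 𝓘(ℝ, E) (1 : G) 1)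

variable (E G) in
/-- The domain of the chart `coord`. -/
def coordSource : Set G := (extChartAt 𝓘(ℝ, E) (1 : G)).source

variable (E G) in
/-- The image of the chart `coord`. -/
def coordTarget : Set E :=
  (fun z => z + extChartAt 𝓘(ℝ, E) (1 : G) 1) ⁻¹' (extChartAt 𝓘(ℝ, E) (1 : G)).target

@[simp] lemma coord_one : coord E (1 : G) = 0 := sub_self _

@[simp] lemma uncoord_zero : uncoord G (0 : E) = 1 := by
  simp [uncoord]

lemma isOpen_coordSource : IsOpen (coordSource E G) := isOpen_extChartAt_source _

lemma isOpen_coordTarget : IsOpen (coordTarget E G) :=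
  (isOpen_extChartAt_target _).preimage (by fun_prop)

lemma one_mem_coordSource : (1 : G) ∈ coordSource E G := mem_extChartAt_source _

lemma zero_mem_coordTarget : (0 : E) ∈ coordTarget E G := by
  simp [coordTarget]

lemma coordSource_mem_nhds : coordSource E G ∈ 𝓝 (1 : G) :=
  isOpen_coordSource.mem_nhds one_mem_coordSource

lemma coordTarget_mem_nhds : coordTarget E G ∈ 𝓝 (0 : E) :=
  isOpen_coordTarget.mem_nhds zero_mem_coordTarget

lemma uncoord_coord {g : G} (hg : g ∈ coordSource E G) : uncoord G (coord E g) = g := by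
  rw [uncoord, coord, sub_add_cancel]
  exact (extChartAt 𝓘(ℝ, E) (1 : G)).left_inv hg

lemma coord_uncoord {z : E} (hz : z ∈ coordTarget E G) : coord E (uncoord G z) = z := by
  rw [uncoord, coord, (extChartAt 𝓘(ℝ, E) (1 : G)).right_inv hz, add_sub_cancel_right]

lemma uncoord_mem {z : E} (hz : z ∈ coordTarget E G) : uncoord G z ∈ coordSource E G :=
  (extChartAt 𝓘(ℝ, E) (1 : G)).map_target hz

lemma continuousAt_coord {g : G} (hg : g ∈ coordSource E G) : ContinuousAt (coord E) g :=
  (continuousAt_extChartAt' hg).sub continuousAt_const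

lemma continuousAt_uncoord {z : E} (hz : z ∈ coordTarget E G) : ContinuousAt (uncoord G) z :=
  ContinuousAt.comp (g := (extChartAt 𝓘(ℝ, E) (1 : G)).symm) (continuousAt_extChartAt_symm'' hz)
    (by fun_prop)

variable [LieGroup 𝓘(ℝ, E) ∞ G]

lemma contMDiffAt_coord {g : G} (hg : g ∈ coordSource E G) :
    ContMDiffAt 𝓘(ℝ, E) 𝓘(ℝ, E) ∞ (coord E) g := by
  refine ContMDiffAt.sub (contMDiffAt_extChartAt' ?_) contMDiffAt_const
  simpa [coordSource] using hg

lemma contMDiffAt_uncoord {z : E} (hz : z ∈ coordTarget E G) :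
    ContMDiffAt 𝓘(ℝ, E) 𝓘(ℝ, E) ∞ (uncoord G) z := by
  have h1 := (contMDiffOn_extChartAt_symm (I := 𝓘(ℝ, E)) (n := ∞) (1 : G)).contMDiffAt
    ((isOpen_extChartAt_target (1 : G)).mem_nhds hz)
  have h2 : ContMDiffAt 𝓘(ℝ, E) 𝓘(ℝ, E) ∞ (fun z => z + extChartAt 𝓘(ℝ, E) (1 : G) 1) z :=
    (contDiff_id.add contDiff_const).contDiffAt.contMDiffAt
  exact ContMDiffAt.comp z h1 h2

lemma contMDiffAt_uncoord_zero : ContMDiffAt 𝓘(ℝ, E) 𝓘(ℝ, E) ∞ (uncoord G) (0 : E) :=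
  contMDiffAt_uncoord zero_mem_coordTarget

lemma contMDiffAt_coord_one : ContMDiffAt 𝓘(ℝ, E) 𝓘(ℝ, E) ∞ (coord E) (1 : G) :=
  contMDiffAt_coord one_mem_coordSource

end Chart

/-! ### Derivatives of maps into a Lie group at points that go to the identity -/

section UnitDeriv

variable {E : Type*} [NormedAddCommGroup E] [NormedSpace ℝ E]
  {G : Type*} [TopologicalSpace G] [ChartedSpace E G] [Group G]
  {E' : Type*} [NormedAddCommGroup E'] [NormedSpace ℝ E']
  {G' : Type*} [TopologicalSpace G'] [ChartedSpace E' G'] [Group G']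
  {V : Type*} [NormedAddCommGroup V] [NormedSpace ℝ V]
  {X : Type*} [NormedAddCommGroup X] [NormedSpace ℝ X]

/-- The map `a` goes through the identity at `x`, with derivative `a'` in the chart `coord`.
Continuity is a separate condition because `coord` has junk values outside its domain. -/
structure HasUnitDeriv (a : X → G) (a' : X →L[ℝ] E) (x : X) : Prop where
  eq_one : a x = 1
  continuousAt : ContinuousAt a x
  hasFDerivAt : HasFDerivAt (fun s => coord E (a s)) a' x

lemma HasUnitDeriv.comp_hasFDerivAt {a : X → G} {a' : X →L[ℝ] E} {x : X}
    (ha : HasUnitDeriv a a' x) {f : G → V} {f' : E →L[ℝ] V}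
    (hf : HasFDerivAt (fun z : E => f (uncoord G z)) f' 0) :
    HasFDerivAt (fun s => f (a s)) (f' ∘L a') x := by
  have h1 : HasFDerivAt (fun z : E => f (uncoord G z)) f' (coord E (a x)) := by
    rwa [ha.eq_one, coord_one]
  refine (h1.comp x ha.hasFDerivAt).congr_of_eventuallyEq ?_
  have h2 : ∀ᶠ s in 𝓝 x, a s ∈ coordSource E G := by
    refine ha.continuousAt.eventually_mem ?_
    rw [ha.eq_one]
    exact coordSource_mem_nhds
  filter_upwards [h2] with s hs
  simp [uncoord_coord hs]

lemma HasUnitDeriv.comp {a : X → G} {a' : X →L[ℝ] E} {x : X}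
    (ha : HasUnitDeriv a a' x) {f : G → G'} (hf1 : f 1 = 1) (hfc : ContinuousAt f 1)
    {f' : E →L[ℝ] E'} (hf : HasFDerivAt (fun z : E => coord E' (f (uncoord G z))) f' 0) :
    HasUnitDeriv (fun s => f (a s)) (f' ∘L a') x where
  eq_one := by rw [ha.eq_one, hf1]
  continuousAt := ContinuousAt.comp (g := f) (by rwa [ha.eq_one]) ha.continuousAt
  hasFDerivAt := ha.comp_hasFDerivAt (f := fun g => coord E' (f g)) hf

lemma hasUnitDeriv_uncoord : HasUnitDeriv (uncoord G) (ContinuousLinearMap.id ℝ E) 0 where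
  eq_one := uncoord_zero
  continuousAt := continuousAt_uncoord zero_mem_coordTarget
  hasFDerivAt := (hasFDerivAt_id _).congr_of_eventuallyEq
    (Filter.mem_of_superset coordTarget_mem_nhds fun _ hz => coord_uncoord hz)

variable [LieGroup 𝓘(ℝ, E) ∞ G] [LieGroup 𝓘(ℝ, E') ∞ G']

lemma contDiffAt_comp_uncoord {f : G → V} (hf : ContMDiffAt 𝓘(ℝ, E) 𝓘(ℝ, V) ∞ f 1) :
    ContDiffAt ℝ ∞ (fun z : E => f (uncoord G z)) 0 := by
  rw [← contMDiffAt_iff_contDiffAt]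
  refine ContMDiffAt.comp (0 : E) (g := f) ?_ contMDiffAt_uncoord_zero
  rwa [uncoord_zero]

lemma contMDiff_mul_left_mul_right (g h : G) :
    ContMDiff 𝓘(ℝ, E) 𝓘(ℝ, E) ∞ (fun x : G => g * x * h) :=
  (contMDiff_const.mul contMDiff_id).mul contMDiff_const

lemma contDiffAt_coord_comp_uncoord {f : G → G'} (hf : ContMDiffAt 𝓘(ℝ, E) 𝓘(ℝ, E') ∞ f 1)
    (hf1 : f 1 = 1) : ContDiffAt ℝ ∞ (fun z : E => coord E' (f (uncoord G z))) 0 := by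
  refine contDiffAt_comp_uncoord (f := fun g => coord E' (f g)) ?_
  refine ContMDiffAt.comp (1 : G) (g := coord E') ?_ hf
  rw [hf1]
  exact contMDiffAt_coord_one

variable (E E') in
/-- The derivative at the identity of a map that preserves the identity, in the charts `coord`. -/
def unitDeriv (f : G → G') : E →L[ℝ] E' := fderiv ℝ (fun z : E => coord E' (f (uncoord G z))) 0

lemma HasUnitDeriv.comp_smooth {a : X → G} {a' : X →L[ℝ] E} {x : X}
    (ha : HasUnitDeriv a a' x) {f : G → G'} (hf : ContMDiffAt 𝓘(ℝ, E) 𝓘(ℝ, E') ∞ f 1)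
    (hf1 : f 1 = 1) : HasUnitDeriv (fun s => f (a s)) (unitDeriv E E' f ∘L a') x :=
  ha.comp hf1 hf.continuousAt
    ((contDiffAt_coord_comp_uncoord hf hf1).differentiableAt (by simp)).hasFDerivAt

lemma HasUnitDeriv.unitDeriv_eq {f : G → G'} {f' : E →L[ℝ] E'}
    (h : HasUnitDeriv (fun z : E => f (uncoord G z)) f' 0) : unitDeriv E E' f = f' :=
  h.hasFDerivAt.fderiv

variable (E G) in
/-- The multiplication in the chart `coord`. -/
def coordMul (p : E × E) : E := coord E (uncoord G p.1 * uncoord G p.2)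

lemma contDiffAt_coordMul : ContDiffAt ℝ ∞ (coordMul E G) 0 := by
  rw [← contMDiffAt_iff_contDiffAt]
  have h1 : ContMDiffAt 𝓘(ℝ, E × E) 𝓘(ℝ, E) ∞ (fun p : E × E => uncoord G p.1) 0 :=
    ContMDiffAt.comp (0 : E × E) (g := uncoord G) contMDiffAt_uncoord_zero
      contDiffAt_fst.contMDiffAt
  have h2 : ContMDiffAt 𝓘(ℝ, E × E) 𝓘(ℝ, E) ∞ (fun p : E × E => uncoord G p.2) 0 :=
    ContMDiffAt.comp (0 : E × E) (g := uncoord G) contMDiffAt_uncoord_zero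
      contDiffAt_snd.contMDiffAt
  refine ContMDiffAt.comp (0 : E × E) (g := coord E) ?_ (h1.mul h2)
  simpa using contMDiffAt_coord_one

lemma coordMul_zero_right {x : E} (hx : x ∈ coordTarget E G) : coordMul E G (x, 0) = x := by
  simp [coordMul, coord_uncoord hx]

lemma coordMul_zero_left {x : E} (hx : x ∈ coordTarget E G) : coordMul E G (0, x) = x := by
  simp [coordMul, coord_uncoord hx]

lemma hasFDerivAt_coordMul : HasFDerivAt (coordMul E G)
    (ContinuousLinearMap.fst ℝ E E + ContinuousLinearMap.snd ℝ E E) 0 := by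
  have h := ((contDiffAt_coordMul (E := E) (G := G)).differentiableAt (by simp)).hasFDerivAt
  have h1 : (fderiv ℝ (coordMul E G) 0) ∘L .inl ℝ E E = .id ℝ E := by
    refine (HasFDerivAt.comp (0 : E) (f := fun x : E => (x, (0 : E))) h
      (hasFDerivAt_prodMk_left 0 0)).unique ((hasFDerivAt_id _).congr_of_eventuallyEq ?_)
    filter_upwards [coordTarget_mem_nhds (E := E) (G := G)] with x hx using coordMul_zero_right hx
  have h2 : (fderiv ℝ (coordMul E G) 0) ∘L .inr ℝ E E = .id ℝ E := by
    refine (HasFDerivAt.comp (0 : E) (f := fun x : E => ((0 : E), x)) h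
      (hasFDerivAt_prodMk_right 0 0)).unique ((hasFDerivAt_id _).congr_of_eventuallyEq ?_)
    filter_upwards [coordTarget_mem_nhds (E := E) (G := G)] with x hx using coordMul_zero_left hx
  have h3 : ContinuousLinearMap.fst ℝ E E + ContinuousLinearMap.snd ℝ E E =
      fderiv ℝ (coordMul E G) 0 :=
    ContinuousLinearMap.prod_ext (by rw [h1]; ext; simp) (by rw [h2]; ext; simp)
  rwa [h3]

lemma HasUnitDeriv.mul {a b : X → G} {a' b' : X →L[ℝ] E} {x : X}
    (ha : HasUnitDeriv a a' x) (hb : HasUnitDeriv b b' x) :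
    HasUnitDeriv (fun s => a s * b s) (a' + b') x where
  eq_one := by rw [ha.eq_one, hb.eq_one, one_mul]
  continuousAt := by
    have := topologicalGroup_of_lieGroup 𝓘(ℝ, E) ∞ (G := G)
    exact ha.continuousAt.mul hb.continuousAt
  hasFDerivAt := by
    have h1 : HasFDerivAt (coordMul E G)
        (ContinuousLinearMap.fst ℝ E E + ContinuousLinearMap.snd ℝ E E)
        (coord E (a x), coord E (b x)) := by
      rw [ha.eq_one, hb.eq_one, coord_one]
      exact hasFDerivAt_coordMul
    have h2 := HasFDerivAt.comp x h1 (ha.hasFDerivAt.prodMk hb.hasFDerivAt)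
    refine (h2.congr_of_eventuallyEq ?_)
    have h3 : ∀ᶠ s in 𝓝 x, a s ∈ coordSource E G :=
      ha.continuousAt.eventually_mem (by rw [ha.eq_one]; exact coordSource_mem_nhds)
    have h4 : ∀ᶠ s in 𝓝 x, b s ∈ coordSource E G :=
      hb.continuousAt.eventually_mem (by rw [hb.eq_one]; exact coordSource_mem_nhds)
    filter_upwards [h3, h4] with s hs hs'
    simp [coordMul, uncoord_coord hs, uncoord_coord hs']

lemma hasUnitDeriv_one (x : X) : HasUnitDeriv (fun _ : X => (1 : G)) (0 : X →L[ℝ] E) x where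
  eq_one := rfl
  continuousAt := continuousAt_const
  hasFDerivAt := hasFDerivAt_const _ _

lemma HasUnitDeriv.inv {a : X → G} {a' : X →L[ℝ] E} {x : X} (ha : HasUnitDeriv a a' x) :
    HasUnitDeriv (fun s => (a s)⁻¹) (-a') x := by
  have h := ha.comp_smooth (f := fun g : G => g⁻¹) (contMDiff_inv 𝓘(ℝ, E) ∞).contMDiffAt inv_one
  have h1 := ha.mul h
  have h2 : HasUnitDeriv (fun s => a s * (a s)⁻¹) (0 : X →L[ℝ] E) x := by
    simpa using hasUnitDeriv_one x
  have h3 := h1.hasFDerivAt.unique h2.hasFDerivAt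
  rwa [eq_neg_of_add_eq_zero_right h3] at h

variable (E) in
/-- The adjoint representation of a Lie group, on the model space. -/
def Ad (g : G) : E →L[ℝ] E := unitDeriv E E (fun x : G => g * x * g⁻¹)

lemma HasUnitDeriv.conj {a : X → G} {a' : X →L[ℝ] E} {x : X} (ha : HasUnitDeriv a a' x) (g : G) :
    HasUnitDeriv (fun s => g * a s * g⁻¹) (Ad E g ∘L a') x :=
  ha.comp_smooth (f := fun x => g * x * g⁻¹) (contMDiff_mul_left_mul_right g g⁻¹).contMDiffAt
    (by simp)

lemma unitDeriv_comp {E'' : Type*} [NormedAddCommGroup E''] [NormedSpace ℝ E'']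
    {G'' : Type*} [TopologicalSpace G''] [ChartedSpace E'' G''] [Group G'']
    [LieGroup 𝓘(ℝ, E'') ∞ G''] {f : G' → G''} {g : G → G'}
    (hf : ContMDiffAt 𝓘(ℝ, E') 𝓘(ℝ, E'') ∞ f 1) (hf1 : f 1 = 1)
    (hg : ContMDiffAt 𝓘(ℝ, E) 𝓘(ℝ, E') ∞ g 1) (hg1 : g 1 = 1) :
    unitDeriv E E'' (fun x => f (g x)) = unitDeriv E' E'' f ∘L unitDeriv E E' g := by
  have h := ((hasUnitDeriv_uncoord (E := E) (G := G)).comp_smooth hg hg1).comp_smooth hf hf1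
  simpa using h.unitDeriv_eq (f := fun x => f (g x))

lemma unitDeriv_id : unitDeriv E E (fun x : G => x) = .id ℝ E :=
  (hasUnitDeriv_uncoord (E := E) (G := G)).unitDeriv_eq (f := fun x : G => x)

lemma Ad_one : Ad E (1 : G) = .id ℝ E := by
  simpa [Ad] using unitDeriv_id (E := E) (G := G)

lemma Ad_mul (g h : G) : Ad E (g * h) = Ad E g ∘L Ad E h := by
  rw [Ad, Ad, Ad, ← unitDeriv_comp (contMDiff_mul_left_mul_right g g⁻¹).contMDiffAt (by simp)
    (contMDiff_mul_left_mul_right h h⁻¹).contMDiffAt (by simp)]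
  congr 1
  funext x
  group

lemma unitDeriv_Ad (φ : G →* G') (hφ : ContMDiff 𝓘(ℝ, E) 𝓘(ℝ, E') ∞ φ) (g : G) :
    unitDeriv E E' φ ∘L Ad E g = Ad E' (φ g) ∘L unitDeriv E E' φ := by
  rw [Ad, Ad, ← unitDeriv_comp hφ.contMDiffAt (map_one φ)
    (contMDiff_mul_left_mul_right g g⁻¹).contMDiffAt (by simp),
    ← unitDeriv_comp (contMDiff_mul_left_mul_right (φ g) (φ g)⁻¹).contMDiffAt (by simp)
      hφ.contMDiffAt (map_one φ)]
  simp

end UnitDeriv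

/-! ### Right logarithmic derivatives -/

section RightDeriv

variable {E : Type*} [NormedAddCommGroup E] [NormedSpace ℝ E]
  {G : Type*} [TopologicalSpace G] [ChartedSpace E G] [Group G] [LieGroup 𝓘(ℝ, E) ∞ G]
  {E' : Type*} [NormedAddCommGroup E'] [NormedSpace ℝ E']
  {G' : Type*} [TopologicalSpace G'] [ChartedSpace E' G'] [Group G'] [LieGroup 𝓘(ℝ, E') ∞ G']
  {V : Type*} [NormedAddCommGroup V] [NormedSpace ℝ V]
  {X : Type*} [NormedAddCommGroup X] [NormedSpace ℝ X]
  {Y : Type*} [NormedAddCommGroup Y] [NormedSpace ℝ Y]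

/-- The derivative of `c` at `x`, moved to the identity by the right translation by `(c x)⁻¹`,
is `c'`. -/
def HasRightDeriv (c : X → G) (c' : X →L[ℝ] E) (x : X) : Prop :=
  HasUnitDeriv (fun s => c s * (c x)⁻¹) c' x

variable (E) in
/-- The differential of a function on a Lie group, moved to the identity by right translation. -/
def rdiff (f : G → V) (g : G) : E →L[ℝ] V := fderiv ℝ (fun z : E => f (uncoord G z * g)) 0

lemma contMDiff_mul_const (g : G) : ContMDiff 𝓘(ℝ, E) 𝓘(ℝ, E) ∞ (fun x : G => x * g) :=
  contMDiff_id.mul contMDiff_const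

lemma hasFDerivAt_rdiff {f : G → V} {g : G} (hf : ContMDiffAt 𝓘(ℝ, E) 𝓘(ℝ, V) ∞ f g) :
    HasFDerivAt (fun z : E => f (uncoord G z * g)) (rdiff E f g) 0 := by
  have h : ContMDiffAt 𝓘(ℝ, E) 𝓘(ℝ, V) ∞ (fun x : G => f (x * g)) 1 := by
    refine ContMDiffAt.comp (1 : G) (g := f) ?_ (contMDiff_mul_const g).contMDiffAt
    rwa [one_mul]
  exact ((contDiffAt_comp_uncoord h).differentiableAt (by simp)).hasFDerivAt

lemma HasRightDeriv.continuousAt {c : X → G} {c' : X →L[ℝ] E} {x : X}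
    (h : HasRightDeriv c c' x) : ContinuousAt c x := by
  have := topologicalGroup_of_lieGroup 𝓘(ℝ, E) ∞ (G := G)
  have h1 := (HasUnitDeriv.continuousAt h).mul (continuousAt_const (y := c x))
  refine h1.congr (Eventually.of_forall fun s => ?_)
  simp

lemma HasRightDeriv.comp_fun {c : X → G} {c' : X →L[ℝ] E} {x : X} (hc : HasRightDeriv c c' x)
    {f : G → V} (hf : ContMDiffAt 𝓘(ℝ, E) 𝓘(ℝ, V) ∞ f (c x)) :
    HasFDerivAt (fun s => f (c s)) (rdiff E f (c x) ∘L c') x := by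
  simpa using HasUnitDeriv.comp_hasFDerivAt hc (f := fun y => f (y * c x)) (hasFDerivAt_rdiff hf)

lemma HasUnitDeriv.hasRightDeriv {c : X → G} {c' : X →L[ℝ] E} {x : X} (h : HasUnitDeriv c c' x) :
    HasRightDeriv c c' x := by
  simpa [HasRightDeriv, h.eq_one] using h

lemma HasRightDeriv.hasUnitDeriv {c : X → G} {c' : X →L[ℝ] E} {x : X} (h : HasRightDeriv c c' x)
    (hx : c x = 1) : HasUnitDeriv c c' x := by
  simpa [HasRightDeriv, hx] using h

lemma hasRightDeriv_const (g : G) (x : X) : HasRightDeriv (fun _ : X => g) (0 : X →L[ℝ] E) x := by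
  simpa [HasRightDeriv] using hasUnitDeriv_one (E := E) (G := G) x

lemma HasRightDeriv.mul {c d : X → G} {c' d' : X →L[ℝ] E} {x : X} (hc : HasRightDeriv c c' x)
    (hd : HasRightDeriv d d' x) :
    HasRightDeriv (fun s => c s * d s) (c' + Ad E (c x) ∘L d') x := by
  have h := HasUnitDeriv.mul hc (HasUnitDeriv.conj hd (c x))
  simpa [HasRightDeriv, mul_assoc] using h

lemma HasRightDeriv.mul_const {c : X → G} {c' : X →L[ℝ] E} {x : X} (hc : HasRightDeriv c c' x)
    (g : G) : HasRightDeriv (fun s => c s * g) c' x := by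
  simpa using hc.mul (hasRightDeriv_const g x)

lemma HasRightDeriv.inv {c : X → G} {c' : X →L[ℝ] E} {x : X} (hc : HasRightDeriv c c' x) :
    HasRightDeriv (fun s => (c s)⁻¹) (-(Ad E (c x)⁻¹ ∘L c')) x := by
  have h := HasUnitDeriv.conj (HasUnitDeriv.inv hc) (c x)⁻¹
  simpa [HasRightDeriv, mul_assoc] using h

lemma HasRightDeriv.map_hom {c : X → G} {c' : X →L[ℝ] E} {x : X} (hc : HasRightDeriv c c' x)
    (φ : G →* G') (hφ : ContMDiffAt 𝓘(ℝ, E) 𝓘(ℝ, E') ∞ φ 1) :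
    HasRightDeriv (fun s => φ (c s)) (unitDeriv E E' φ ∘L c') x := by
  have h := HasUnitDeriv.comp_smooth hc hφ (map_one φ)
  simpa [HasRightDeriv] using h

lemma HasRightDeriv.comp {c : X → G} {c' : X →L[ℝ] E} {u : Y → X} {u' : Y →L[ℝ] X} {y : Y}
    (hc : HasRightDeriv c c' (u y)) (hu : HasFDerivAt u u' y) :
    HasRightDeriv (fun s => c (u s)) (c' ∘L u') y :=
  ⟨mul_inv_cancel _, ContinuousAt.comp (f := u) (HasUnitDeriv.continuousAt hc)
    hu.continuousAt, (HasUnitDeriv.hasFDerivAt hc).comp y hu⟩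

variable (G) in
/-- The right logarithmic derivative of the parametrization `uncoord`. -/
def coordLog (y : E) : E →L[ℝ] E :=
  fderiv ℝ (fun z => coord E (uncoord G z * (uncoord G y)⁻¹)) y

lemma contMDiffAt_coord_uncoord_mul {y : E} (hy : y ∈ coordTarget E G) {g : G}
    (hg : uncoord G y * g ∈ coordSource E G) :
    ContDiffAt ℝ ∞ (fun z => coord E (uncoord G z * g)) y := by
  rw [← contMDiffAt_iff_contDiffAt]
  exact ContMDiffAt.comp y (g := coord E) (contMDiffAt_coord hg)
    (ContMDiffAt.comp y (g := fun x : G => x * g) (contMDiff_mul_const g).contMDiffAt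
      (contMDiffAt_uncoord hy))

lemma hasRightDeriv_uncoord {y : E} (hy : y ∈ coordTarget E G) :
    HasRightDeriv (uncoord G) (coordLog G y) y where
  eq_one := mul_inv_cancel _
  continuousAt := by
    have := topologicalGroup_of_lieGroup 𝓘(ℝ, E) ∞ (G := G)
    exact (continuousAt_uncoord hy).mul continuousAt_const
  hasFDerivAt := ((contMDiffAt_coord_uncoord_mul hy
    (by rw [mul_inv_cancel]; exact one_mem_coordSource)).differentiableAt (by simp)).hasFDerivAt

lemma rdiff_coord_comp_coordLog {y : E} (hy : y ∈ coordTarget E G) :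
    rdiff E (coord E) (uncoord G y) ∘L coordLog G y = .id ℝ E := by
  refine HasFDerivAt.unique ((hasRightDeriv_uncoord hy).comp_fun
    (contMDiffAt_coord (uncoord_mem hy))) ((hasFDerivAt_id y).congr_of_eventuallyEq ?_)
  filter_upwards [isOpen_coordTarget.mem_nhds hy] with z hz using coord_uncoord hz

lemma coordLog_comp_rdiff_coord [FiniteDimensional ℝ E] {y : E} (hy : y ∈ coordTarget E G) :
    coordLog G y ∘L rdiff E (coord E) (uncoord G y) = .id ℝ E := by
  have h := congrArg ContinuousLinearMap.toLinearMap (rdiff_coord_comp_coordLog hy)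
  have h2 := (mul_eq_one_comm (a := (rdiff E (coord E) (uncoord G y)).toLinearMap)
    (b := (coordLog G y).toLinearMap)).1 h
  ext v
  exact LinearMap.congr_fun h2 v

lemma coordLog_zero : coordLog G (0 : E) = .id ℝ E :=
  (((hasRightDeriv_uncoord zero_mem_coordTarget).hasUnitDeriv uncoord_zero).hasFDerivAt).unique
    hasUnitDeriv_uncoord.hasFDerivAt

lemma rdiff_coord_one : rdiff E (coord E) (1 : G) = .id ℝ E := by
  have h := rdiff_coord_comp_coordLog (G := G) (zero_mem_coordTarget (E := E))
  simpa [coordLog_zero] using h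

lemma rdiff_one (f : G → V) : rdiff E f 1 = fderiv ℝ (fun z => f (uncoord G z)) 0 := by
  simp [rdiff]

/-- The derivative in the chart of a curve with a given right logarithmic derivative. -/
lemma HasRightDeriv.hasFDerivAt_coord {c : X → G} {c' : X →L[ℝ] E} {x : X}
    (hc : HasRightDeriv c c' x) (hx : c x ∈ coordSource E G) :
    HasFDerivAt (fun s => coord E (c s)) (rdiff E (coord E) (c x) ∘L c') x :=
  hc.comp_fun (contMDiffAt_coord hx)

/-! ### Smooth dependence of derivatives on parameters -/

lemma contMDiffAt_fderiv_parameter {F B : Type*} [NormedAddCommGroup F] [NormedSpace ℝ F]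
    [TopologicalSpace B] {J : ModelWithCorners ℝ F B} {N : Type*} [TopologicalSpace N]
    [ChartedSpace B N] [IsManifold J ∞ N] {f : N → E → V} {n₀ : N}
    (hf : ContMDiffAt (J.prod 𝓘(ℝ, E)) 𝓘(ℝ, V) ∞ (Function.uncurry f) (n₀, 0)) :
    ContMDiffAt J 𝓘(ℝ, E →L[ℝ] V) ∞ (fun n => fderiv ℝ (f n) 0) n₀ := by
  have h := ContMDiffAt.mfderiv (J := J) (I := 𝓘(ℝ, E)) (I' := 𝓘(ℝ, V)) f (fun _ => (0 : E)) hf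
    contMDiffAt_const (m := ∞) (by simp)
  simp only [mfderiv_eq_fderiv] at h
  have e := inTangentCoordinates_model_space (I := 𝓘(ℝ, E)) (I' := 𝓘(ℝ, V)) (fun _ : N => (0 : E))
    (fun n => f n 0) (fun n => fderiv ℝ (f n) 0) n₀
  exact e ▸ h

lemma contMDiffAt_rdiff {f : G → V} {g : G} (hf : ContMDiffAt 𝓘(ℝ, E) 𝓘(ℝ, V) ∞ f g) :
    ContMDiffAt 𝓘(ℝ, E) 𝓘(ℝ, E →L[ℝ] V) ∞ (rdiff E f) g := by
  have : IsManifold 𝓘(ℝ, E) ∞ G := inferInstance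
  refine contMDiffAt_fderiv_parameter (f := fun (g : G) (z : E) => f (uncoord G z * g)) ?_
  have h : ContMDiffAt (𝓘(ℝ, E).prod 𝓘(ℝ, E)) 𝓘(ℝ, E) ∞
      (fun p : G × E => uncoord G p.2 * p.1) (g, 0) :=
    (ContMDiffAt.comp (g, (0 : E)) (g := uncoord G) contMDiffAt_uncoord_zero
      contMDiffAt_snd).mul contMDiffAt_fst
  refine ContMDiffAt.comp (g, (0 : E)) (g := f) ?_ h
  simpa using hf

lemma contMDiff_Ad : ContMDiff 𝓘(ℝ, E) 𝓘(ℝ, E →L[ℝ] E) ∞ (Ad E : G → E →L[ℝ] E) := by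
  intro g
  refine contMDiffAt_fderiv_parameter
    (f := fun (g : G) (z : E) => coord E (g * uncoord G z * g⁻¹)) ?_
  have h : ContMDiffAt (𝓘(ℝ, E).prod 𝓘(ℝ, E)) 𝓘(ℝ, E) ∞
      (fun p : G × E => p.1 * uncoord G p.2 * p.1⁻¹) (g, 0) :=
    (contMDiffAt_fst.mul (ContMDiffAt.comp (g, (0 : E)) (g := uncoord G) contMDiffAt_uncoord_zero
      contMDiffAt_snd)).mul contMDiffAt_fst.inv
  refine ContMDiffAt.comp (g, (0 : E)) (g := coord E) ?_ h
  simpa using contMDiffAt_coord_one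

/-! ### Connected Lie groups -/

lemma subgroup_eq_top_of_mem_nhds_one {G : Type*} [TopologicalSpace G] [Group G]
    [IsTopologicalGroup G] [ConnectedSpace G] (S : Subgroup G)
    (hS : (S : Set G) ∈ 𝓝 (1 : G)) : S = ⊤ := by
  have ho := S.isOpen_of_mem_nhds hS
  have : (S : Set G) = univ := IsClopen.eq_univ ⟨S.isClosed_of_isOpen ho, ho⟩
    ⟨1, S.one_mem⟩
  exact SetLike.coe_injective this

/-- A function with zero differential on a connected Lie group is constant. -/
lemma eq_of_rdiff_eq_zero [ConnectedSpace G] {f : G → V}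
    (hf : ContMDiff 𝓘(ℝ, E) 𝓘(ℝ, V) ∞ f) (h : ∀ g : G, rdiff E f g = 0) (g : G) : f g = f 1 := by
  have := topologicalGroup_of_lieGroup 𝓘(ℝ, E) ∞ (G := G)
  have hloc : IsLocallyConstant f := by
    rw [IsLocallyConstant.iff_eventually_eq]
    intro g
    obtain ⟨ε, hε, hball⟩ := Metric.mem_nhds_iff.1
      (coordTarget_mem_nhds (E := E) (G := G))
    have hconst : ∀ z ∈ Metric.ball (0 : E) ε, f (uncoord G z * g) = f (uncoord G (0 : E) * g) := by
      intro z hz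
      refine (convex_ball (0 : E) ε).is_const_of_fderivWithin_eq_zero
        (f := fun z => f (uncoord G z * g)) (𝕜 := ℝ) ?_ ?_ hz (Metric.mem_ball_self hε)
      · intro y hy
        exact (((hasRightDeriv_uncoord (hball hy)).mul_const g).comp_fun
          hf.contMDiffAt).differentiableAt.differentiableWithinAt
      · intro y hy
        have h1 := ((hasRightDeriv_uncoord (hball hy)).mul_const g).comp_fun
          (f := f) hf.contMDiffAt
        rw [h, ContinuousLinearMap.zero_comp] at h1
        rw [fderivWithin_of_isOpen Metric.isOpen_ball hy, h1.fderiv]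
    have h1 : ContinuousAt (fun g' : G => g' * g⁻¹) g := by fun_prop
    have h2 : ContinuousAt (fun g' : G => coord E (g' * g⁻¹)) g :=
      ContinuousAt.comp (g := coord E)
        (by rw [mul_inv_cancel]; exact continuousAt_coord one_mem_coordSource) h1
    have h3 : ∀ᶠ g' in 𝓝 g, g' * g⁻¹ ∈ coordSource E G := h1.eventually_mem
      (by rw [mul_inv_cancel]; exact coordSource_mem_nhds)
    have h4 : ∀ᶠ g' in 𝓝 g, coord E (g' * g⁻¹) ∈ Metric.ball (0 : E) ε := h2.eventually_mem
      (by rw [mul_inv_cancel, coord_one]; exact Metric.ball_mem_nhds _ hε)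
    filter_upwards [h3, h4] with g' h3 h4
    simpa [uncoord_coord h3] using hconst _ h4
  exact hloc.apply_eq_of_isPreconnected isPreconnected_univ (mem_univ _) (mem_univ _)

/-- A homomorphism of Lie groups with connected source is determined by its differential: the
function `φ⁻¹ ψ` has zero right logarithmic derivative. -/
lemma hom_eq_of_unitDeriv_eq [ConnectedSpace G] {φ ψ : G →* G'}
    (hφ : ContMDiff 𝓘(ℝ, E) 𝓘(ℝ, E') ∞ φ) (hψ : ContMDiff 𝓘(ℝ, E) 𝓘(ℝ, E') ∞ ψ)
    (h : unitDeriv E E' φ = unitDeriv E E' ψ) : φ = ψ := by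
  have := topologicalGroup_of_lieGroup 𝓘(ℝ, E) ∞ (G := G)
  have := topologicalGroup_of_lieGroup 𝓘(ℝ, E') ∞ (G := G')
  have hd : ∀ y ∈ coordTarget E G,
      HasRightDeriv (fun z => (φ (uncoord G z))⁻¹ * ψ (uncoord G z)) (0 : E →L[ℝ] E') y := by
    intro y hy
    have h1 := (hasRightDeriv_uncoord hy).map_hom ψ hψ.contMDiffAt
    have h2 := ((hasRightDeriv_uncoord hy).map_hom φ hφ.contMDiffAt).inv
    have h3 := h2.mul h1
    rwa [h, neg_add_cancel] at h3
  -- hence the function `φ⁻¹ ψ` is constant near the identity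
  set q : G → G' := fun g => (φ g)⁻¹ * ψ g with hq
  have hqc : Continuous q := hφ.continuous.inv.mul hψ.continuous
  have hq1 : q 1 = 1 := by simp [hq]
  have hnear : ∀ᶠ z in 𝓝 (0 : E), z ∈ coordTarget E G ∧ q (uncoord G z) ∈ coordSource E' G' := by
    refine Filter.Eventually.and coordTarget_mem_nhds ?_
    refine (ContinuousAt.comp (g := q) hqc.continuousAt
      (continuousAt_uncoord (G := G) zero_mem_coordTarget)).eventually_mem ?_
    simpa [hq1] using coordSource_mem_nhds
  obtain ⟨ε, hε, hball⟩ := Metric.mem_nhds_iff.1 hnear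
  have hconst : ∀ z ∈ Metric.ball (0 : E) ε, q (uncoord G z) = 1 := by
    intro z hz
    have hder : ∀ y ∈ Metric.ball (0 : E) ε,
        HasFDerivAt (fun z => coord E' (q (uncoord G z))) (0 : E →L[ℝ] E') y := by
      intro y hy
      have := (hd y (hball hy).1).hasFDerivAt_coord (hball hy).2
      simpa using this
    have h1 := (convex_ball (0 : E) ε).is_const_of_fderivWithin_eq_zero
      (f := fun z => coord E' (q (uncoord G z))) (𝕜 := ℝ)
      (fun y hy => (hder y hy).differentiableAt.differentiableWithinAt)
      (fun y hy => by rw [fderivWithin_of_isOpen Metric.isOpen_ball hy, (hder y hy).fderiv])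
      hz (Metric.mem_ball_self hε)
    have h2 := congrArg (uncoord G') h1
    simpa [uncoord_coord (hball hz).2, hq1] using h2
  have htop : φ.eqLocus ψ = ⊤ := by
    apply subgroup_eq_top_of_mem_nhds_one
    have h1 : ∀ᶠ g in 𝓝 (1 : G), coord E g ∈ Metric.ball (0 : E) ε :=
      (continuousAt_coord one_mem_coordSource).eventually_mem
        (by rw [coord_one]; exact Metric.ball_mem_nhds _ hε)
    filter_upwards [h1, coordSource_mem_nhds (E := E)] with g h1 h2
    have h3 := hconst _ h1
    rw [uncoord_coord h2] at h3
    exact (inv_mul_eq_one.1 h3)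
  exact MonoidHom.eq_of_eqOn_top fun g _ => by
    have : g ∈ φ.eqLocus ψ := htop ▸ Subgroup.mem_top g
    exact this

end RightDeriv

/-! ### Comparison with the differential of maps of manifolds -/

section Comparison

variable {E : Type*} [NormedAddCommGroup E] [NormedSpace ℝ E]
  {G : Type*} [TopologicalSpace G] [ChartedSpace E G] [Group G] [LieGroup 𝓘(ℝ, E) ∞ G]
  {E' : Type*} [NormedAddCommGroup E'] [NormedSpace ℝ E']
  {G' : Type*} [TopologicalSpace G'] [ChartedSpace E' G'] [Group G'] [LieGroup 𝓘(ℝ, E') ∞ G']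
  {V : Type*} [NormedAddCommGroup V] [NormedSpace ℝ V]

lemma mfderiv_one_eq_unitDeriv {f : G → G'} (hf : ContMDiffAt 𝓘(ℝ, E) 𝓘(ℝ, E') ∞ f 1)
    (hf1 : f 1 = 1) :
    (mfderiv 𝓘(ℝ, E) 𝓘(ℝ, E') f 1 : E →L[ℝ] E') = unitDeriv E E' f := by
  have h1 : MDifferentiableAt 𝓘(ℝ, E) 𝓘(ℝ, E') f 1 := hf.mdifferentiableAt (by simp)
  rw [h1.mfderiv, unitDeriv]
  simp only [modelWithCornersSelf_coe, range_id, fderivWithin_univ]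
  have h2 : writtenInExtChartAt 𝓘(ℝ, E) 𝓘(ℝ, E') 1 f =
      fun z => coord E' (f (uncoord G (z - extChartAt 𝓘(ℝ, E) (1 : G) 1))) +
        extChartAt 𝓘(ℝ, E') (1 : G') 1 := by
    funext z
    simp [writtenInExtChartAt, coord, uncoord, hf1]
  rw [h2, fderiv_add_const]
  have h3 := fderiv_comp_sub (𝕜 := ℝ) (f := fun z => coord E' (f (uncoord G z)))
    (extChartAt 𝓘(ℝ, E) (1 : G) 1) (x := extChartAt 𝓘(ℝ, E) (1 : G) 1)
  rw [h3, sub_self]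

lemma mfderiv_one_eq_fderiv {f : G → V} (hf : ContMDiffAt 𝓘(ℝ, E) 𝓘(ℝ, V) ∞ f 1) :
    (mfderiv 𝓘(ℝ, E) 𝓘(ℝ, V) f 1 : E →L[ℝ] V) = rdiff E f 1 := by
  have h1 : MDifferentiableAt 𝓘(ℝ, E) 𝓘(ℝ, V) f 1 := hf.mdifferentiableAt (by simp)
  rw [h1.mfderiv, rdiff_one]
  simp only [modelWithCornersSelf_coe, range_id, fderivWithin_univ]
  have h2 : writtenInExtChartAt 𝓘(ℝ, E) 𝓘(ℝ, V) 1 f =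
      fun z => f (uncoord G (z - extChartAt 𝓘(ℝ, E) (1 : G) 1)) := by
    funext z
    simp only [writtenInExtChartAt, uncoord, sub_add_cancel]
    rfl
  rw [h2]
  have h3 := fderiv_comp_sub (𝕜 := ℝ) (f := fun z => f (uncoord G z))
    (extChartAt 𝓘(ℝ, E) (1 : G) 1) (x := extChartAt 𝓘(ℝ, E) (1 : G) 1)
  rw [h3, sub_self]

/-- The differential of a function is its right invariant differential after `rightTriv`. -/
lemma mfderiv_eq_rdiff_comp_rightTriv {f : G → V} {g : G}
    (hf : ContMDiffAt 𝓘(ℝ, E) 𝓘(ℝ, V) ∞ f g) :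
    (mfderiv 𝓘(ℝ, E) 𝓘(ℝ, V) f g : E →L[ℝ] V) =
      rdiff E f g ∘L (rightTriv E g : E →L[ℝ] E) := by
  have h : ContMDiffAt 𝓘(ℝ, E) 𝓘(ℝ, V) ∞ (fun x : G => f (x * g)) 1 := by
    refine ContMDiffAt.comp (1 : G) (g := f) ?_ (contMDiff_mul_const g).contMDiffAt
    rwa [one_mul]
  have h1 : f = (fun x : G => f (x * g)) ∘ (fun x : G => x * g⁻¹) := by
    funext x; simp
  have h2 : ContMDiffAt 𝓘(ℝ, E) 𝓘(ℝ, V) ∞ (fun x : G => f (x * g)) (g * g⁻¹) := by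
    rwa [mul_inv_cancel]
  have h3 := mfderiv_comp (I := 𝓘(ℝ, E)) (I' := 𝓘(ℝ, E)) (I'' := 𝓘(ℝ, V)) g
    (h2.mdifferentiableAt (by simp))
    ((contMDiff_mul_const (E := E) g⁻¹).contMDiffAt.mdifferentiableAt (by simp))
  have h4 : (mfderiv 𝓘(ℝ, E) 𝓘(ℝ, V) (fun x : G => f (x * g)) (g * g⁻¹) : E →L[ℝ] V) =
      rdiff E f g := by
    rw [mul_inv_cancel, mfderiv_one_eq_fderiv h, rdiff_one]
    rfl
  rw [← h4]
  conv_lhs => rw [h1]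
  exact h3

end Comparison

/-! ### The Lie bracket and the adjoint representation -/

section Bracket

variable {E : Type*} [NormedAddCommGroup E] [NormedSpace ℝ E] [CompleteSpace E]
  {G : Type*} [TopologicalSpace G] [ChartedSpace E G] [Group G] [LieGroup 𝓘(ℝ, E) ∞ G]

/-- The left invariant vector field of `η` in the chart `coord`. -/
lemma mpullbackWithin_mulInvariantVectorField (η : E) {p : E}
    (hp : p ∈ (extChartAt 𝓘(ℝ, E) (1 : G)).target)
    (hd : DifferentiableAt ℝ (coordMul E G) (p - extChartAt 𝓘(ℝ, E) (1 : G) 1, 0)) :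
    (VectorField.mpullbackWithin 𝓘(ℝ, E) 𝓘(ℝ, E) (extChartAt 𝓘(ℝ, E) (1 : G)).symm
      (mulInvariantVectorField (I := 𝓘(ℝ, E)) (G := G) η) (range 𝓘(ℝ, E)) p : E) =
      fderiv ℝ (coordMul E G) (p - extChartAt 𝓘(ℝ, E) (1 : G) 1, 0) (0, η) := by
  have htop := topologicalGroup_of_lieGroup 𝓘(ℝ, E) ∞ (G := G)
  set s₀ := extChartAt 𝓘(ℝ, E) (1 : G) 1 with hs₀
  set φ := extChartAt 𝓘(ℝ, E) (1 : G) with hφ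
  set x := p - s₀ with hx
  have hxt : x ∈ coordTarget E G := by
    rw [coordTarget, mem_preimage, hx, sub_add_cancel]
    exact hp
  have hgx : uncoord G x = φ.symm p := by rw [uncoord, hx, sub_add_cancel]
  have hinv := isInvertible_mfderivWithin_extChartAt_symm (I := 𝓘(ℝ, E)) hp
  rw [VectorField.mpullbackWithin_apply]
  refine (hinv.inverse_apply_eq).2 ?_
  simp only [modelWithCornersSelf_coe, range_id, mfderivWithin_univ]
  have hmd : MDifferentiableAt 𝓘(ℝ, E) 𝓘(ℝ, E) φ.symm p :=
    ((contMDiffOn_extChartAt_symm (I := 𝓘(ℝ, E)) (n := ∞) (1 : G)).contMDiffAt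
      ((isOpen_extChartAt_target (1 : G)).mem_nhds hp)).mdifferentiableAt (by simp)
  -- both sides are the derivative at `0` of `z ↦ uncoord x * uncoord z`
  have hf1 : HasFDerivAt (fun z : E => coordMul E G (x, z) + s₀)
      (fderiv ℝ (coordMul E G) (x, 0) ∘L .inr ℝ E E) 0 :=
    (HasFDerivAt.comp (0 : E) hd.hasFDerivAt (hasFDerivAt_prodMk_right x 0)).add_const s₀
  have hf10 : coordMul E G (x, 0) + s₀ = p := by
    rw [coordMul_zero_right hxt, hx, sub_add_cancel]
  have h1 : HasMFDerivAt 𝓘(ℝ, E) 𝓘(ℝ, E) (fun z : E => φ.symm (coordMul E G (x, z) + s₀)) 0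
      ((mfderiv 𝓘(ℝ, E) 𝓘(ℝ, E) φ.symm p : E →L[ℝ] E) ∘L
        (fderiv ℝ (coordMul E G) (x, 0) ∘L .inr ℝ E E)) := by
    refine HasMFDerivAt.comp (I' := 𝓘(ℝ, E)) (0 : E) (g := φ.symm) ?_ hf1.hasMFDerivAt
    rw [hf10]
    exact hmd.hasMFDerivAt
  have h2 : HasMFDerivAt 𝓘(ℝ, E) 𝓘(ℝ, E) (uncoord G) (0 : E) (.id ℝ E : E →L[ℝ] E) := by
    refine ⟨continuousAt_uncoord zero_mem_coordTarget, ?_⟩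
    simp only [modelWithCornersSelf_coe, range_id]
    refine HasFDerivAt.hasFDerivWithinAt (x := (0 : E)) ?_
    have h3 : HasFDerivAt (fun z : E => z + s₀) (.id ℝ E : E →L[ℝ] E) (0 : E) :=
      (hasFDerivAt_id _).add_const _
    refine h3.congr_of_eventuallyEq ?_
    filter_upwards [coordTarget_mem_nhds (E := E) (G := G)] with z hz
    simp only [writtenInExtChartAt, uncoord_zero, Function.comp]
    exact φ.right_inv hz
  have h4 : HasMFDerivAt 𝓘(ℝ, E) 𝓘(ℝ, E) (fun z : E => φ.symm p * uncoord G z) 0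
      ((mfderiv 𝓘(ℝ, E) 𝓘(ℝ, E) (fun y : G => φ.symm p * y) 1 : E →L[ℝ] E) ∘L .id ℝ E) := by
    refine HasMFDerivAt.comp (I' := 𝓘(ℝ, E)) (0 : E) (g := fun y : G => φ.symm p * y) ?_ h2
    rw [uncoord_zero]
    exact (contMDiff_mul_left (I := 𝓘(ℝ, E)) (n := ∞)).contMDiffAt.mdifferentiableAt
      (by simp) |>.hasMFDerivAt
  have h5 : (fun z : E => φ.symm (coordMul E G (x, z) + s₀)) =ᶠ[𝓝 0]
      fun z : E => φ.symm p * uncoord G z := by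
    have hc : ContinuousAt (fun z : E => uncoord G x * uncoord G z) 0 :=
      continuousAt_const.mul (continuousAt_uncoord zero_mem_coordTarget)
    have h6 : ∀ᶠ z in 𝓝 (0 : E), uncoord G x * uncoord G z ∈ coordSource E G := by
      refine hc.eventually_mem ?_
      rw [uncoord_zero, mul_one]
      exact isOpen_coordSource.mem_nhds (uncoord_mem hxt)
    filter_upwards [h6] with z hz
    have h7 := uncoord_coord hz
    rw [hgx] at h7
    change φ.symm (coord E (uncoord G x * uncoord G z) + s₀) = _
    rw [hgx]
    exact h7
  have h8 := hasMFDerivAt_unique h1 (h4.congr_of_eventuallyEq h5)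
  have h9 := congrArg (fun A : E →L[ℝ] E => A η) h8
  exact h9.symm

/-- Left translation by `x` is `Ad x` followed by right translation by `x`, infinitesimally. -/
lemma fderiv_coordMul_left_eq : ∀ᶠ x in 𝓝 (0 : E), ∀ η : E,
    fderiv ℝ (coordMul E G) (x, 0) (0, η) =
      fderiv ℝ (coordMul E G) (0, x) (Ad E (uncoord G x) η, 0) := by
  have hcd : ∀ᶠ p in 𝓝 (0 : E × E), ContDiffAt ℝ 1 (coordMul E G) p :=
    ((contDiffAt_coordMul (E := E) (G := G)).of_le (by simp)).eventually (by simp)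
  have hc1 : ContinuousAt (fun x : E => (x, (0 : E))) 0 := by fun_prop
  have hc2 : ContinuousAt (fun x : E => ((0 : E), x)) 0 := by fun_prop
  filter_upwards [hc1.eventually hcd, hc2.eventually hcd, coordTarget_mem_nhds (E := E) (G := G)]
    with x h1 h2 hx η
  have h3 : HasFDerivAt (fun z : E => coordMul E G (x, z))
      (fderiv ℝ (coordMul E G) (x, 0) ∘L .inr ℝ E E) 0 :=
    HasFDerivAt.comp (0 : E) (h1.differentiableAt (by simp)).hasFDerivAt
      (hasFDerivAt_prodMk_right x 0)
  have h4 : HasUnitDeriv (fun z : E => uncoord G x * uncoord G z * (uncoord G x)⁻¹)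
      (Ad E (uncoord G x) ∘L .id ℝ E) 0 := hasUnitDeriv_uncoord.conj (uncoord G x)
  have h5 : HasFDerivAt (fun y : E => coordMul E G (y, x))
      (fderiv ℝ (coordMul E G) (0, x) ∘L .inl ℝ E E)
        (coord E (uncoord G x * uncoord G (0 : E) * (uncoord G x)⁻¹) : E) := by
    rw [h4.eq_one, coord_one]
    exact HasFDerivAt.comp (0 : E) (f := fun y : E => (y, x))
      (h2.differentiableAt (by simp)).hasFDerivAt (hasFDerivAt_prodMk_left (0 : E) x)
  have h6 := h5.comp (0 : E) h4.hasFDerivAt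
  have h7 := h3.unique (h6.congr_of_eventuallyEq ?_)
  · simpa using congrArg (fun A => A η) h7
  · have h8 : ∀ᶠ z in 𝓝 (0 : E),
        uncoord G x * uncoord G z * (uncoord G x)⁻¹ ∈ coordSource E G :=
      h4.continuousAt.eventually_mem (by rw [h4.eq_one]; exact coordSource_mem_nhds)
    filter_upwards [h8] with z hz
    simp [coordMul, uncoord_coord hz]

/-- The second derivative of the multiplication in the chart `coord` at the identity. -/
lemma hasFDerivAt_fderiv_coordMul : HasFDerivAt (fderiv ℝ (coordMul E G))
    (fderiv ℝ (fderiv ℝ (coordMul E G)) 0) 0 :=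
  (((contDiffAt_coordMul (E := E) (G := G)).fderiv_right (m := 1) (by norm_cast)).differentiableAt
    (by simp)).hasFDerivAt

variable (G) in
/-- The Lie bracket of the Lie algebra of `G`, as an operation on the model space. -/
def groupBracket (ξ η : E) : E :=
  Bracket.bracket (L := GroupLieAlgebra 𝓘(ℝ, E) G) (M := GroupLieAlgebra 𝓘(ℝ, E) G) ξ η

/-- The bracket is the antisymmetrization of the second derivative of the multiplication. -/
lemma groupBracket_eq_coordMul (ξ η : E) :
    groupBracket G ξ η = fderiv ℝ (fderiv ℝ (coordMul E G)) 0 (ξ, 0) (0, η) -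
      fderiv ℝ (fderiv ℝ (coordMul E G)) 0 (η, 0) (0, ξ) := by
  set s₀ := extChartAt 𝓘(ℝ, E) (1 : G) 1 with hs₀
  -- the left invariant vector fields in the chart, and their derivatives
  let L : E → E → E := fun η p => fderiv ℝ (coordMul E G) (p - s₀, 0) (0, η)
  have hL : ∀ η, HasFDerivAt (L η)
      ((fderiv ℝ (fderiv ℝ (coordMul E G)) 0 ∘L .inl ℝ E E).flip (0, η)) s₀ := by
    intro η
    have h1 : HasFDerivAt (fun p : E => (p - s₀, (0 : E))) (.inl ℝ E E) s₀ :=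
      ((hasFDerivAt_id s₀).sub_const s₀).prodMk (hasFDerivAt_const 0 s₀)
    have h2 : HasFDerivAt (fderiv ℝ (coordMul E G)) (fderiv ℝ (fderiv ℝ (coordMul E G)) 0)
        ((s₀ - s₀, (0 : E)) : E × E) := by
      rw [sub_self]
      exact hasFDerivAt_fderiv_coordMul
    have h3 := (HasFDerivAt.comp s₀ h2 h1).clm_apply (hasFDerivAt_const ((0, η) : E × E) s₀)
    simpa using h3
  have hL0 : ∀ η, L η s₀ = η := by
    intro η
    have h7 : fderiv ℝ (coordMul E G) (0, 0) =
        ContinuousLinearMap.fst ℝ E E + ContinuousLinearMap.snd ℝ E E :=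
      (hasFDerivAt_coordMul (E := E) (G := G)).fderiv
    simp [L, h7]
  have hcd : ∀ᶠ p in 𝓝 (0 : E × E), ContDiffAt ℝ 1 (coordMul E G) p :=
    ((contDiffAt_coordMul (E := E) (G := G)).of_le (by simp)).eventually (by simp)
  have hc1 : ContinuousAt (fun p : E => (p - s₀, (0 : E))) s₀ := by fun_prop
  have hcd' : ∀ᶠ p in 𝓝 s₀, ContDiffAt ℝ 1 (coordMul E G) (p - s₀, 0) := by
    refine hc1.eventually ?_
    have h0 : ((s₀ - s₀, (0 : E)) : E × E) = 0 := by rw [sub_self]; rfl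
    change ∀ᶠ q in 𝓝 ((s₀ - s₀, (0 : E)) : E × E), ContDiffAt ℝ 1 (coordMul E G) q
    rwa [h0]
  have hpull : ∀ η : E, (fun p => (VectorField.mpullbackWithin 𝓘(ℝ, E) 𝓘(ℝ, E)
      (extChartAt 𝓘(ℝ, E) (1 : G)).symm (mulInvariantVectorField (I := 𝓘(ℝ, E)) (G := G) η)
        (range 𝓘(ℝ, E)) p : E)) =ᶠ[𝓝 s₀] L η := by
    intro η
    filter_upwards [extChartAt_target_mem_nhds (I := 𝓘(ℝ, E)) (1 : G), hcd'] with p hp hp'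
    exact mpullbackWithin_mulInvariantVectorField η hp (hp'.differentiableAt (by simp))
  have hbr : groupBracket G ξ η = VectorField.lieBracket ℝ (L ξ) (L η) s₀ := by
    have hid : HasMFDerivAt 𝓘(ℝ, E) 𝓘(ℝ, E) (extChartAt 𝓘(ℝ, E) (1 : G)) 1
        (.id ℝ E : E →L[ℝ] E) := by
      refine ⟨continuousAt_extChartAt (1 : G), ?_⟩
      simp only [modelWithCornersSelf_coe, range_id]
      refine HasFDerivAt.hasFDerivWithinAt (x := s₀) ?_
      refine (hasFDerivAt_id s₀).congr_of_eventuallyEq ?_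
      filter_upwards [extChartAt_target_mem_nhds (I := 𝓘(ℝ, E)) (1 : G)] with p hp
      exact (extChartAt 𝓘(ℝ, E) (1 : G)).right_inv hp
    have h1 := VectorField.mlieBracketWithin_apply (I := 𝓘(ℝ, E))
      (V := mulInvariantVectorField (I := 𝓘(ℝ, E)) (G := G) ξ)
      (W := mulInvariantVectorField (I := 𝓘(ℝ, E)) (G := G) η) (s := univ) (x₀ := 1)
    rw [hid.mfderiv] at h1
    have h2 : groupBracket G ξ η = _ := h1
    rw [h2]
    have h3 : ContinuousLinearMap.inverse (.id ℝ E : E →L[ℝ] E) = .id ℝ E :=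
      ContinuousLinearMap.inverse_id
    have h4 : ∀ v : E, ContinuousLinearMap.inverse (.id ℝ E : E →L[ℝ] E) v = v := by
      rw [h3]; simp
    refine (h4 _).trans ?_
    have h5 : ((extChartAt 𝓘(ℝ, E) (1 : G)).symm ⁻¹' univ ∩ range 𝓘(ℝ, E)) = univ := by simp
    rw [h5]
    refine (congrFun VectorField.lieBracketWithin_univ _).trans ?_
    exact Filter.EventuallyEq.lieBracket_vectorField_eq (hpull ξ) (hpull η)
  rw [hbr, VectorField.lieBracket, (hL ξ).fderiv, (hL η).fderiv, hL0, hL0]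
  simp

/-- The differential of the adjoint representation is the Lie bracket. -/
lemma rdiff_Ad_one (ξ η : E) :
    rdiff E (Ad E : G → E →L[ℝ] E) 1 ξ η = groupBracket G ξ η := by
  rw [groupBracket_eq_coordMul]
  set D2 := fderiv ℝ (fderiv ℝ (coordMul E G)) 0 with hD2
  have hm := hasFDerivAt_fderiv_coordMul (E := E) (G := G)
  have hAd : HasFDerivAt (fun x : E => Ad E (uncoord G x))
      (rdiff E (Ad E : G → E →L[ℝ] E) 1) 0 := by
    simpa using hasFDerivAt_rdiff (contMDiff_Ad (E := E) (G := G)).contMDiffAt (g := 1)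
  have h1 : HasFDerivAt (fun x : E => fderiv ℝ (coordMul E G) (x, 0))
      (D2 ∘L .inl ℝ E E) 0 :=
    HasFDerivAt.comp (0 : E) hm (hasFDerivAt_prodMk_left 0 0)
  have h2 : HasFDerivAt (fun x : E => fderiv ℝ (coordMul E G) (0, x))
      (D2 ∘L .inr ℝ E E) 0 :=
    HasFDerivAt.comp (0 : E) hm (hasFDerivAt_prodMk_right 0 0)
  have h3 := h1.clm_apply (hasFDerivAt_const ((0, η) : E × E) (0 : E))
  have h4 := h2.clm_apply
    ((hAd.clm_apply (hasFDerivAt_const η (0 : E))).prodMk (hasFDerivAt_const (0 : E) (0 : E)))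
  have h5 := h3.unique (h4.congr_of_eventuallyEq
    ((fderiv_coordMul_left_eq (E := E) (G := G)).mono fun x hx => hx η))
  have h6 := congrArg (fun A => A ξ) h5
  have h7 : fderiv ℝ (coordMul E G) (0, 0) =
      ContinuousLinearMap.fst ℝ E E + ContinuousLinearMap.snd ℝ E E :=
    (hasFDerivAt_coordMul (E := E) (G := G)).fderiv
  have hsymm := (contDiffAt_coordMul (E := E) (G := G)).isSymmSndFDerivAt
    (by simp only [minSmoothness_of_isRCLikeNormedField]; norm_cast) (0, ξ) (η, 0)
  simp [h7, Ad_one] at h6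
  rw [← hD2] at hsymm
  rw [← hsymm, h6, add_sub_cancel_right]

end Bracket

/-! ### Flows of multiplicative vector fields -/

section FlowCurves

variable {EH : Type*} [NormedAddCommGroup EH] [NormedSpace ℝ EH]
  {EK : Type*} [NormedAddCommGroup EK] [NormedSpace ℝ EK]
  {H : Type*} [TopologicalSpace H] [ChartedSpace EH H] [Group H] [LieGroup 𝓘(ℝ, EH) ∞ H]
  {K : Type*} [TopologicalSpace K] [ChartedSpace EK K] [Group K] [LieGroup 𝓘(ℝ, EK) ∞ K]

/-- A smooth one-cocycle on `K` with values in `Hom(Lie H, Lie K)`: a family of multiplicative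
vector fields on `K`, linear in an element of `Lie H`, in the right trivialization. -/
structure IsSmoothCocycle (V : K → EH →L[ℝ] EK) : Prop where
  smooth : ContMDiff 𝓘(ℝ, EK) 𝓘(ℝ, EH →L[ℝ] EK) ∞ V
  map_mul : ∀ γ₁ γ₂, V (γ₁ * γ₂) = V γ₁ + Ad EK γ₁ ∘L V γ₂

/-- The curve `c` satisfies `c' c⁻¹ = V(c) X` on `[0, 1]`. -/
def IsFlowCurve (V : K → EH →L[ℝ] EK) (X : ℝ → EH) (c : ℝ → K) : Prop :=
  ∀ t ∈ Icc (0 : ℝ) 1, HasRightDeriv c (.toSpanSingleton ℝ (V (c t) (X t))) t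

variable {V : K → EH →L[ℝ] EK}

lemma IsSmoothCocycle.map_one (hV : IsSmoothCocycle V) : V 1 = 0 := by
  have h := hV.map_mul 1 1
  rw [Ad_one, ContinuousLinearMap.id_comp, one_mul] at h
  exact left_eq_add.1 h

lemma IsSmoothCocycle.map_inv (hV : IsSmoothCocycle V) (γ : K) :
    V γ⁻¹ = -(Ad EK γ⁻¹ ∘L V γ) := by
  have h := hV.map_mul γ⁻¹ γ
  rw [inv_mul_cancel, hV.map_one] at h
  exact eq_neg_of_add_eq_zero_left h.symm

/-- The cocycle identity makes the pointwise product of flow curves a flow curve. -/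
lemma IsFlowCurve.mul (hV : IsSmoothCocycle V) {X : ℝ → EH} {c d : ℝ → K}
    (hc : IsFlowCurve V X c) (hd : IsFlowCurve V X d) : IsFlowCurve V X (fun t => c t * d t) := by
  intro t ht
  convert (hc t ht).mul (hd t ht) using 1
  ext
  simp [hV.map_mul]

lemma IsFlowCurve.inv (hV : IsSmoothCocycle V) {X : ℝ → EH} {c : ℝ → K}
    (hc : IsFlowCurve V X c) : IsFlowCurve V X (fun t => (c t)⁻¹) := by
  intro t ht
  convert (hc t ht).inv using 1
  ext
  simp [hV.map_inv]

lemma IsFlowCurve.continuousOn {X : ℝ → EH} {c : ℝ → K} (hc : IsFlowCurve V X c) :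
    ContinuousOn c (Icc 0 1) :=
  fun t ht => (hc t ht).continuousAt.continuousWithinAt

variable (EH EK K) in
/-- The vector fields on `K` given by `V` in the right trivialization, read in the chart `coord`. -/
def coordField (V : K → EH →L[ℝ] EK) (x : EK) : EH →L[ℝ] EK :=
  rdiff EK (coord EK) (uncoord K x) ∘L V (uncoord K x)

lemma contDiffAt_rdiff_coord {x : EK} (hx : x ∈ coordTarget EK K) :
    ContDiffAt ℝ ∞ (fun x => rdiff EK (coord EK) (uncoord K x)) x := by
  rw [← contMDiffAt_iff_contDiffAt]
  exact ContMDiffAt.comp x (g := rdiff EK (coord EK))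
    (contMDiffAt_rdiff (contMDiffAt_coord (uncoord_mem hx))) (contMDiffAt_uncoord hx)

lemma contDiffAt_coordField (hV : IsSmoothCocycle V) {x : EK} (hx : x ∈ coordTarget EK K) :
    ContDiffAt ℝ ∞ (coordField EH EK K V) x := by
  have h1 : ContDiffAt ℝ ∞ (fun x => V (uncoord K x)) x := by
    rw [← contMDiffAt_iff_contDiffAt]
    exact ContMDiffAt.comp x (g := V) hV.smooth.contMDiffAt (contMDiffAt_uncoord hx)
  exact (contDiffAt_rdiff_coord hx).clm_comp h1

lemma coordField_zero (hV : IsSmoothCocycle V) : coordField EH EK K V 0 = 0 := by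
  simp [coordField, hV.map_one]

lemma fderiv_coordField_zero (hV : IsSmoothCocycle V) :
    fderiv ℝ (coordField EH EK K V) 0 = rdiff EK V 1 := by
  have h1 : HasFDerivAt (fun x => V (uncoord K x)) (rdiff EK V 1) 0 := by
    simpa using hasFDerivAt_rdiff (hV.smooth.contMDiffAt (x := 1))
  have h2 := ((contDiffAt_rdiff_coord (EK := EK) (K := K)
    zero_mem_coordTarget).differentiableAt (by simp)).hasFDerivAt
  refine (h2.clm_comp h1).fderiv.trans ?_
  ext
  simp [hV.map_one, rdiff_coord_one]

/-- A flow curve that starts at the identity is constant. -/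
lemma IsFlowCurve.eq_one (hV : IsSmoothCocycle V) {X : ℝ → EH} {C : ℝ}
    (hX : ∀ t ∈ Icc (0 : ℝ) 1, ‖X t‖ ≤ C) {c : ℝ → K} (hc : IsFlowCurve V X c) (h0 : c 0 = 1)
    {t : ℝ} (ht : t ∈ Icc (0 : ℝ) 1) : c t = 1 := by
  have : T1Space K := ChartedSpace.t1Space EK K
  -- the field vanishes at the identity, hence it is at most linear near it
  obtain ⟨L, hL⟩ : ∃ L : ℝ, ∀ᶠ x in 𝓝 (0 : EK), ‖coordField EH EK K V x‖ ≤ L * ‖x‖ := by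
    have h1 := ((contDiffAt_coordField (K := K) hV zero_mem_coordTarget).differentiableAt
      (by simp)).hasFDerivAt.isBigO_sub
    obtain ⟨L, hL⟩ := h1.bound
    refine ⟨L, ?_⟩
    simpa [coordField_zero hV] using hL
  have hC : 0 ≤ C := (norm_nonneg _).trans (hX 0 (by simp))
  have hsub : Icc (0 : ℝ) 1 ⊆ {t | c t = 1} := by
    refine IsClosed.Icc_subset_of_forall_exists_gt ?_ h0 ?_
    · have := hc.continuousOn.preimage_isClosed_of_isClosed isClosed_Icc
        (isClosed_singleton (x := (1 : K)))
      rwa [inter_comm] at this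
    · rintro s ⟨hs1, hs⟩ y hy
      have hs1 : c s = 1 := hs1
      have hcs := (hc s (Ico_subset_Icc_self hs)).continuousAt
      have h2 : ∀ᶠ r in 𝓝 s, c r ∈ coordSource EK K :=
        hcs.eventually_mem (by rw [hs1]; exact coordSource_mem_nhds)
      have h3 : ∀ᶠ r in 𝓝 s, ‖coordField EH EK K V (coord EK (c r))‖ ≤ L * ‖coord EK (c r)‖ := by
        have h4 : ContinuousAt (fun r => coord EK (c r)) s := ContinuousAt.comp (g := coord EK)
          (by rw [hs1]; exact continuousAt_coord one_mem_coordSource) hcs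
        refine h4.eventually (p := fun x => ‖coordField EH EK K V x‖ ≤ L * ‖x‖) ?_
        simpa only [hs1, coord_one] using hL
      obtain ⟨ε, hε, hball⟩ := Metric.eventually_nhds_iff_ball.1 (h2.and h3)
      set b := min (min y 1) (s + ε / 2) with hb
      have hsb : s < b := lt_min (lt_min hy hs.2) (by linarith)
      have hb1 : b ≤ 1 := (min_le_left _ _).trans (min_le_right _ _)
      have hby : b ≤ y := (min_le_left _ _).trans (min_le_left _ _)
      have hmem : ∀ r ∈ Icc s b, r ∈ Icc (0 : ℝ) 1 ∧ r ∈ Metric.ball s ε := by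
        intro r hr
        refine ⟨⟨hs.1.trans hr.1, hr.2.trans hb1⟩, ?_⟩
        rw [Metric.mem_ball, Real.dist_eq, abs_of_nonneg (by linarith [hr.1])]
        linarith [hr.2, min_le_right (min y 1) (s + ε / 2)]
      have hder : ∀ r ∈ Icc s b, HasDerivAt (fun r => coord EK (c r))
          (coordField EH EK K V (coord EK (c r)) (X r)) r := by
        intro r hr
        have h5 := ((hc r (hmem r hr).1).hasFDerivAt_coord
          (hball r (hmem r hr).2).1).hasDerivAt
        simpa [coordField, uncoord_coord (hball r (hmem r hr).2).1] using h5
      have hgr := norm_le_gronwallBound_of_norm_deriv_right_le (δ := 0) (K := L * C) (ε := 0)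
        (f := fun r => coord EK (c r))
        (fun r hr => (hder r hr).continuousAt.continuousWithinAt)
        (fun r hr => (hder r (Ico_subset_Icc_self hr)).hasDerivWithinAt)
        (by simp [hs1]) (fun r hr => ?_) b ⟨hsb.le, le_rfl⟩
      · rw [gronwallBound_ε0_δ0] at hgr
        have h6 : coord EK (c b) = 0 := norm_le_zero_iff.1 hgr
        have h7 := uncoord_coord (hball b (hmem b ⟨hsb.le, le_rfl⟩).2).1
        rw [h6, uncoord_zero] at h7
        exact ⟨b, h7.symm, hsb, hby⟩
      · have hr' := hmem r (Ico_subset_Icc_self hr)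
        have h8 := (hball r hr'.2).2
        calc ‖coordField EH EK K V (coord EK (c r)) (X r)‖
            ≤ ‖coordField EH EK K V (coord EK (c r))‖ * ‖X r‖ :=
              ContinuousLinearMap.le_opNorm _ _
          _ ≤ (L * ‖coord EK (c r)‖) * C :=
              mul_le_mul h8 (hX r hr'.1) (norm_nonneg _) ((norm_nonneg _).trans h8)
          _ = L * C * ‖coord EK (c r)‖ + 0 := by ring
  exact hsub ht

lemma IsFlowCurve.eq (hV : IsSmoothCocycle V) {X : ℝ → EH} {C : ℝ}
    (hX : ∀ t ∈ Icc (0 : ℝ) 1, ‖X t‖ ≤ C) {c d : ℝ → K} (hc : IsFlowCurve V X c)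
    (hd : IsFlowCurve V X d) (h0 : c 0 = d 0) {t : ℝ} (ht : t ∈ Icc (0 : ℝ) 1) : c t = d t :=
  inv_mul_eq_one.1 (((hc.inv hV).mul hV hd).eq_one hV hX (by simp [h0]) ht)

variable (H) in
/-- The right logarithmic derivative of the path `t ↦ uncoord H (t y)`. -/
def radialLog (y : EH) (t : ℝ) : EH := coordLog H (t • y) y

lemma hasRightDeriv_radial {y : EH} {t : ℝ} (h : t • y ∈ coordTarget EH H) :
    HasRightDeriv (fun t : ℝ => uncoord H (t • y)) (.toSpanSingleton ℝ (radialLog H y t)) t := by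
  have h1 : HasFDerivAt (fun t : ℝ => t • y) (.toSpanSingleton ℝ y : ℝ →L[ℝ] EH) t := by
    simpa using (hasDerivAt_id t).smul_const y |>.hasFDerivAt
  convert HasRightDeriv.comp (u := fun t : ℝ => t • y) (hasRightDeriv_uncoord h) h1 using 1
  ext
  simp [radialLog]

lemma radialLog_zero (y : EH) : radialLog H y 0 = y := by
  simp [radialLog, coordLog_zero]

/-- Restricting the path to `[0, s]`, reparametrized, gives the path to `s y`. -/
lemma IsFlowCurve.rescale {y : EH} {c : ℝ → K} (hc : IsFlowCurve V (radialLog H y) c) {s : ℝ}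
    (hs : s ∈ Icc (0 : ℝ) 1) : IsFlowCurve V (radialLog H (s • y)) (fun t => c (s * t)) := by
  intro t ht
  have hst : s * t ∈ Icc (0 : ℝ) 1 :=
    ⟨mul_nonneg hs.1 ht.1, mul_le_one₀ hs.2 ht.1 ht.2⟩
  have h1 : HasFDerivAt (fun t : ℝ => s * t) (.toSpanSingleton ℝ s : ℝ →L[ℝ] ℝ) t := by
    simpa using ((hasDerivAt_id t).const_mul s).hasFDerivAt
  convert (hc (s * t) hst).comp h1 using 1
  ext
  simp [radialLog, smul_smul, mul_comm]

variable [FiniteDimensional ℝ EH]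

lemma coordLog_eq_inverse {y : EH} (hy : y ∈ coordTarget EH H) :
    coordLog H y = ContinuousLinearMap.inverse (rdiff EH (coord EH) (uncoord H y)) :=
  (ContinuousLinearMap.inverse_eq (rdiff_coord_comp_coordLog hy)
    (coordLog_comp_rdiff_coord hy)).symm

lemma contDiffAt_coordLog {y : EH} (hy : y ∈ coordTarget EH H) :
    ContDiffAt ℝ ∞ (coordLog H : EH → EH →L[ℝ] EH) y := by
  have : CompleteSpace EH := FiniteDimensional.complete ℝ EH
  have h1 := contDiffAt_map_inverse (𝕜 := ℝ) (n := ∞) (ContinuousLinearEquiv.equivOfInverse'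
    (rdiff EH (coord EH) (uncoord H y)) (coordLog H y) (rdiff_coord_comp_coordLog hy)
    (coordLog_comp_rdiff_coord hy))
  have h2 := ContDiffAt.comp y (f := fun y => rdiff EH (coord EH) (uncoord H y)) h1
    (contDiffAt_rdiff_coord hy)
  refine h2.congr_of_eventuallyEq ?_
  filter_upwards [isOpen_coordTarget.mem_nhds hy] with z hz using coordLog_eq_inverse hz

lemma exists_norm_radialLog_le {y : EH} (hy : ∀ t ∈ Icc (0 : ℝ) 1, t • y ∈ coordTarget EH H) :
    ∃ C : ℝ, ∀ t ∈ Icc (0 : ℝ) 1, ‖radialLog H y t‖ ≤ C := by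
  refine isCompact_Icc.exists_bound_of_continuousOn fun t ht => ?_
  have h1 : ContinuousAt (fun t : ℝ => coordLog H (t • y)) t :=
    ContinuousAt.comp (g := coordLog H) (contDiffAt_coordLog (hy t ht)).continuousAt (by fun_prop)
  exact (h1.clm_apply continuousAt_const).continuousWithinAt

end FlowCurves

/-! ### The local action of a neighbourhood of the identity -/

section LocalAction

variable {EH : Type*} [NormedAddCommGroup EH] [NormedSpace ℝ EH] [FiniteDimensional ℝ EH]
  {EK : Type*} [NormedAddCommGroup EK] [NormedSpace ℝ EK] [FiniteDimensional ℝ EK]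
  {H : Type*} [TopologicalSpace H] [ChartedSpace EH H] [Group H] [LieGroup 𝓘(ℝ, EH) ∞ H]
  {K : Type*} [TopologicalSpace K] [ChartedSpace EK K] [Group K] [LieGroup 𝓘(ℝ, EK) ∞ K]
  {V : K → EH →L[ℝ] EK}

variable (H) in
/-- A globally defined smooth field that agrees near the origin with the coordinate expression of
the equation for the flow curves along the radial paths of `H`. -/
lemma exists_cutoff_field (hV : IsSmoothCocycle V) :
    ∃ (B : EH × EK → EH →L[ℝ] EK) (r : ℝ), 0 < r ∧ ContDiff ℝ ∞ B ∧ (∀ y, B (y, 0) = 0) ∧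
      ∀ y ∈ Metric.ball (0 : EH) r, ∀ x ∈ Metric.ball (0 : EK) r,
        y ∈ coordTarget EH H ∧ x ∈ coordTarget EK K ∧
          B (y, x) = coordField EH EK K V x ∘L coordLog H y := by
  have hmem : (coordTarget EH H ×ˢ coordTarget EK K : Set (EH × EK)) ∈ 𝓝 (0 : EH × EK) :=
    prod_mem_nhds coordTarget_mem_nhds coordTarget_mem_nhds
  obtain ⟨R, hR, hRsub⟩ := Metric.nhds_basis_closedBall.mem_iff.1 hmem
  let χ : ContDiffBump (0 : EH × EK) := ⟨R / 2, R, by positivity, by linarith⟩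
  refine ⟨fun p => χ p • (coordField EH EK K V p.2 ∘L coordLog H p.1), R / 2, by positivity,
    ?_, ?_, ?_⟩
  · rw [contDiff_iff_contDiffAt]
    intro p
    by_cases hp : p ∈ tsupport χ
    · have h1 : p ∈ (coordTarget EH H ×ˢ coordTarget EK K : Set (EH × EK)) := by
        rw [χ.tsupport_eq] at hp
        exact hRsub hp
      have h2 : ContDiffAt ℝ ∞ (fun p : EH × EK => coordField EH EK K V p.2) p :=
        ContDiffAt.comp p (g := coordField EH EK K V) (contDiffAt_coordField hV h1.2)
          contDiffAt_snd
      have h3 : ContDiffAt ℝ ∞ (fun p : EH × EK => coordLog H p.1) p :=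
        ContDiffAt.comp p (g := coordLog H) (contDiffAt_coordLog h1.1) contDiffAt_fst
      exact χ.contDiffAt.smul (h2.clm_comp h3)
    · have h1 := notMem_tsupport_iff_eventuallyEq.1 hp
      refine contDiffAt_const (c := (0 : EH →L[ℝ] EK)) |>.congr_of_eventuallyEq ?_
      filter_upwards [h1] with q hq
      simp [hq]
  · intro y
    simp [coordField_zero hV]
  · intro y hy x hx
    have h1 : (y, x) ∈ Metric.closedBall (0 : EH × EK) (R / 2) := by
      rw [mem_closedBall_zero_iff, Prod.norm_def, max_le_iff]
      exact ⟨(mem_ball_zero_iff.1 hy).le, (mem_ball_zero_iff.1 hx).le⟩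
    have h2 := hRsub (Metric.closedBall_subset_closedBall (by linarith) h1)
    refine ⟨h2.1, h2.2, ?_⟩
    simp [χ.one_of_mem_closedBall h1]

lemma smul_mem_ball {r : ℝ} {y : EH} (hy : y ∈ Metric.ball (0 : EH) r) {t : ℝ}
    (ht : t ∈ Icc (0 : ℝ) 1) : t • y ∈ Metric.ball (0 : EH) r := by
  rw [mem_ball_zero_iff] at hy ⊢
  rw [norm_smul, Real.norm_of_nonneg ht.1]
  exact (mul_le_of_le_one_left (norm_nonneg _) ht.2).trans_lt hy

variable (H) in
/-- Near the identity of `K` the flow curves along short radial paths exist, depend smoothly on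
the path and the initial point, and their linearization at the identity solves the linearized
equation. -/
lemma exists_flow_near_one (hV : IsSmoothCocycle V) :
    ∃ (U : EH × EK → ℝ → EK) (r : ℝ), 0 < r ∧
      (∀ y ∈ Metric.ball (0 : EH) r, y ∈ coordTarget EH H ∧
        (∀ x ∈ Metric.ball (0 : EK) r, x ∈ coordTarget EK K ∧ U (y, x) 0 = x ∧
          (∀ t ∈ Icc (0 : ℝ) 1, U (y, x) t ∈ coordTarget EK K) ∧
          ContDiffAt ℝ ∞ (fun p => U p 1) (y, x) ∧
          IsFlowCurve V (radialLog H y) (fun t => uncoord K (U (y, x) t))) ∧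
        ∀ ξ : EK, ∃ w : ℝ → EK, w 0 = ξ ∧
          (∀ t ∈ Icc (0 : ℝ) 1, HasDerivAt w (rdiff EK V 1 (w t) (radialLog H y t)) t) ∧
          HasFDerivAt (fun x => U (y, x) 1) (fderiv ℝ (fun x => U (y, x) 1) 0) 0 ∧
          w 1 = fderiv ℝ (fun x => U (y, x) 1) 0 ξ) := by
  have : CompleteSpace EH := FiniteDimensional.complete ℝ EH
  have : CompleteSpace EK := FiniteDimensional.complete ℝ EK
  obtain ⟨B, r₀, hr₀, hB, hB0, hBeq⟩ := exists_cutoff_field (K := K) H hV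
  obtain ⟨U, hU1, hU2⟩ := exists_smooth_flow B hB hB0 (Metric.ball_mem_nhds (0 : EK) hr₀)
  obtain ⟨r₁, hr₁, hU1⟩ := Metric.eventually_nhds_iff_ball.1 hU1
  obtain ⟨r₂, hr₂, hU2⟩ := Metric.eventually_nhds_iff_ball.1 hU2
  refine ⟨U, min r₀ (min r₁ r₂), by positivity, fun y hy => ?_⟩
  have hy0 : y ∈ Metric.ball (0 : EH) r₀ := Metric.ball_subset_ball (min_le_left _ _) hy
  have hy1 : y ∈ Metric.ball (0 : EH) r₁ :=
    Metric.ball_subset_ball ((min_le_right _ _).trans (min_le_left _ _)) hy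
  have hy2 : y ∈ Metric.ball (0 : EH) r₂ :=
    Metric.ball_subset_ball ((min_le_right _ _).trans (min_le_right _ _)) hy
  have h00 : (0 : EK) ∈ Metric.ball (0 : EK) r₀ := Metric.mem_ball_self hr₀
  refine ⟨(hBeq y hy0 0 h00).1, fun x hx => ?_, fun ξ => ?_⟩
  · have hx0 : x ∈ Metric.ball (0 : EK) r₀ := Metric.ball_subset_ball (min_le_left _ _) hx
    have hx1 : x ∈ Metric.ball (0 : EK) r₁ :=
      Metric.ball_subset_ball ((min_le_right _ _).trans (min_le_left _ _)) hx
    obtain ⟨hc, hstart, hO, hder⟩ := hU1 (y, x) (by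
      rw [mem_ball_zero_iff] at *
      exact max_lt hy1 hx1)
    refine ⟨(hBeq y hy0 x hx0).2.1, hstart, fun t ht => (hBeq y hy0 _ (hO t ht)).2.1, hc, ?_⟩
    intro t ht
    have h1 := hBeq (t • y) (smul_mem_ball hy0 ht) _ (hO t ht)
    have h2 := HasRightDeriv.comp (u := U (y, x)) (hasRightDeriv_uncoord h1.2.1)
      (hder t ht).hasFDerivAt
    convert h2 using 1
    ext
    have h3 := coordLog_comp_rdiff_coord (G := K) h1.2.1
    have h4 := DFunLike.congr_fun h3
    simp only [ContinuousLinearMap.comp_apply, ContinuousLinearMap.id_apply] at h4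
    simp [h1.2.2, coordField, h4, radialLog]
  · obtain ⟨w, hw0, hw, hd, hw1⟩ := hU2 y hy2 ξ
    refine ⟨w, hw0, fun t ht => ?_, hd, hw1⟩
    have h1 : fderiv ℝ (fun x => B (t • y, x)) 0 = fderiv ℝ (fun x =>
        coordField EH EK K V x ∘L coordLog H (t • y)) 0 := by
      refine Filter.EventuallyEq.fderiv_eq ?_
      filter_upwards [Metric.ball_mem_nhds (0 : EK) hr₀] with x hx
      exact (hBeq _ (smul_mem_ball hy0 ht) x hx).2.2
    have h2 : HasFDerivAt (coordField EH EK K V) (rdiff EK V 1) 0 := by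
      rw [← fderiv_coordField_zero hV]
      exact ((contDiffAt_coordField hV zero_mem_coordTarget).differentiableAt
        (by simp)).hasFDerivAt
    have h3 := h2.clm_comp (hasFDerivAt_const (coordLog H (t • y)) (0 : EK))
    have h4 := hw t ht
    rw [h1, h3.fderiv] at h4
    simpa [radialLog] using h4

/-- The time-one maps of the flow along the radial path to `uncoord H y`, for small `y`, form a
smooth family of endomorphisms of `K`. -/
lemma exists_local_action [ConnectedSpace K] (hV : IsSmoothCocycle V) :
    ∃ (F : EH → K → K) (r : ℝ), 0 < r ∧ ∀ y ∈ Metric.ball (0 : EH) r,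
      y ∈ coordTarget EH H ∧
      (∀ γ, ∃ c, IsFlowCurve V (radialLog H y) c ∧ c 0 = γ ∧ c 1 = F y γ) ∧
      (∀ γ₁ γ₂, F y (γ₁ * γ₂) = F y γ₁ * F y γ₂) ∧
      (∀ γ, ContMDiffAt (𝓘(ℝ, EH).prod 𝓘(ℝ, EK)) 𝓘(ℝ, EK) ∞
        (fun p : EH × K => F p.1 p.2) (y, γ)) ∧
      ∀ ξ : EK, ∃ w : ℝ → EK, w 0 = ξ ∧
        (∀ t ∈ Icc (0 : ℝ) 1, HasDerivAt w (rdiff EK V 1 (w t) (radialLog H y t)) t) ∧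
        w 1 = unitDeriv EK EK (F y) ξ := by
  have := topologicalGroup_of_lieGroup 𝓘(ℝ, EK) ∞ (G := K)
  obtain ⟨U, r, hr, hU⟩ := exists_flow_near_one (K := K) H hV
  have hbound : ∀ y ∈ Metric.ball (0 : EH) r,
      ∃ C : ℝ, ∀ t ∈ Icc (0 : ℝ) 1, ‖radialLog H y t‖ ≤ C := fun y hy =>
    exists_norm_radialLog_le fun t ht => (hU _ (smul_mem_ball hy ht)).1
  -- the initial points from which all flow curves exist form a subgroup
  let S : Subgroup K :=
    { carrier := {γ | ∀ y ∈ Metric.ball (0 : EH) r,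
        ∃ c, IsFlowCurve V (radialLog H y) c ∧ c 0 = γ}
      one_mem' := fun y hy => ⟨_, (hU y hy).2.1 0 (Metric.mem_ball_self hr) |>.2.2.2.2, by
        simp [((hU y hy).2.1 0 (Metric.mem_ball_self hr)).2.1]⟩
      mul_mem' := fun {a b} ha hb y hy => by
        obtain ⟨c, hc, hca⟩ := ha y hy
        obtain ⟨d, hd, hdb⟩ := hb y hy
        exact ⟨_, hc.mul hV hd, by simp [hca, hdb]⟩
      inv_mem' := fun {a} ha y hy => by
        obtain ⟨c, hc, hca⟩ := ha y hy
        exact ⟨_, hc.inv hV, by simp [hca]⟩ }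
  have hnear : ∀ᶠ γ in 𝓝 (1 : K), γ ∈ coordSource EK K ∧ coord EK γ ∈ Metric.ball (0 : EK) r :=
    Filter.Eventually.and coordSource_mem_nhds
      ((continuousAt_coord one_mem_coordSource).eventually_mem
        (by rw [coord_one]; exact Metric.ball_mem_nhds _ hr))
  have hcurve : ∀ y ∈ Metric.ball (0 : EH) r, ∀ γ, γ ∈ coordSource EK K →
      coord EK γ ∈ Metric.ball (0 : EK) r → ∃ c, IsFlowCurve V (radialLog H y) c ∧ c 0 = γ ∧
        c 1 = uncoord K (U (y, coord EK γ) 1) := fun y hy γ h1 h2 =>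
    ⟨_, ((hU y hy).2.1 _ h2).2.2.2.2, by simp [((hU y hy).2.1 _ h2).2.1, uncoord_coord h1], rfl⟩
  have hS : S = ⊤ := by
    apply subgroup_eq_top_of_mem_nhds_one
    filter_upwards [hnear] with γ hγ y hy
    obtain ⟨c, hc, h0, -⟩ := hcurve y hy γ hγ.1 hγ.2
    exact ⟨c, hc, h0⟩
  have hex : ∀ y ∈ Metric.ball (0 : EH) r, ∀ γ : K,
      ∃ c, IsFlowCurve V (radialLog H y) c ∧ c 0 = γ := fun y hy γ => by
    have : γ ∈ S := hS ▸ Subgroup.mem_top γ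
    exact this y hy
  choose! c hc hc0 using hex
  have huniq : ∀ y ∈ Metric.ball (0 : EH) r, ∀ d, IsFlowCurve V (radialLog H y) d →
      d 1 = c y (d 0) 1 := fun y hy d hd => by
    obtain ⟨C, hC⟩ := hbound y hy
    exact hd.eq hV hC (hc y hy (d 0)) (hc0 y hy _).symm (by simp)
  have hmul : ∀ y ∈ Metric.ball (0 : EH) r, ∀ γ₁ γ₂,
      c y (γ₁ * γ₂) 1 = c y γ₁ 1 * c y γ₂ 1 := fun y hy γ₁ γ₂ => by
    have := huniq y hy _ ((hc y hy γ₁).mul hV (hc y hy γ₂))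
    simpa [hc0 y hy] using this.symm
  have hinv : ∀ y ∈ Metric.ball (0 : EH) r, ∀ γ,
      c y γ⁻¹ 1 = (c y γ 1)⁻¹ := fun y hy γ => by
    have := huniq y hy _ ((hc y hy γ).inv hV)
    simpa [hc0 y hy] using this.symm
  have hloc : ∀ y ∈ Metric.ball (0 : EH) r, ∀ γ, γ ∈ coordSource EK K →
      coord EK γ ∈ Metric.ball (0 : EK) r → c y γ 1 = uncoord K (U (y, coord EK γ) 1) := by
    intro y hy γ h1 h2
    obtain ⟨d, hd, h0, hd1⟩ := hcurve y hy γ h1 h2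
    rw [← hd1, huniq y hy d hd, h0]
  have hball : ∀ y ∈ Metric.ball (0 : EH) r, ∀ γ₀ : K,
      ∀ᶠ p : EH × K in 𝓝 (y, γ₀), p.1 ∈ Metric.ball (0 : EH) r := fun y hy γ₀ =>
    continuousAt_fst.eventually_mem (Metric.isOpen_ball.mem_nhds hy)
  have hsmooth : ∀ᶠ γ in 𝓝 (1 : K), ∀ y ∈ Metric.ball (0 : EH) r,
      ContMDiffAt (𝓘(ℝ, EH).prod 𝓘(ℝ, EK)) 𝓘(ℝ, EK) ∞
        (fun p : EH × K => c p.1 p.2 1) (y, γ) := by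
    filter_upwards [hnear.eventually_nhds] with γ hγ y hy
    obtain ⟨hγ1, hγ2⟩ := hγ.self_of_nhds
    have h1 : ContMDiffAt (𝓘(ℝ, EH).prod 𝓘(ℝ, EK)) 𝓘(ℝ, EH × EK) ∞
        (fun p : EH × K => (p.1, coord EK p.2)) (y, γ) := by
      rw [modelWithCornersSelf_prod, ← chartedSpaceSelf_prod]
      exact contMDiffAt_fst.prodMk (ContMDiffAt.comp (y, γ) (g := coord EK)
        (contMDiffAt_coord hγ1) contMDiffAt_snd)
    have h2 := ((hU y hy).2.1 _ hγ2).2.2.2.1.contMDiffAt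
    have h3 : ContMDiffAt (𝓘(ℝ, EH).prod 𝓘(ℝ, EK)) 𝓘(ℝ, EK) ∞
        (fun p : EH × K => uncoord K (U (p.1, coord EK p.2) 1)) (y, γ) :=
      ContMDiffAt.comp (y, γ) (g := uncoord K)
        (contMDiffAt_uncoord (((hU y hy).2.1 _ hγ2).2.2.1 1 (by simp)))
        (ContMDiffAt.comp (y, γ) (f := fun p : EH × K => (p.1, coord EK p.2)) h2 h1)
    refine h3.congr_of_eventuallyEq ?_
    filter_upwards [hball y hy γ, continuousAt_snd.eventually hγ] with p hp1 hp2
    exact hloc _ hp1 _ hp2.1 hp2.2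
  -- the points at which the time-one maps are smooth form a subgroup
  let T : Subgroup K :=
    { carrier := {γ | ∀ y ∈ Metric.ball (0 : EH) r,
        ContMDiffAt (𝓘(ℝ, EH).prod 𝓘(ℝ, EK)) 𝓘(ℝ, EK) ∞
          (fun p : EH × K => c p.1 p.2 1) (y, γ)}
      one_mem' := hsmooth.self_of_nhds
      mul_mem' := fun {a b} ha hb y hy => by
        have h1 : ContMDiffAt (𝓘(ℝ, EH).prod 𝓘(ℝ, EK)) 𝓘(ℝ, EK) ∞
            (fun p : EH × K => c p.1 (p.2 * b⁻¹) 1) (y, a * b) :=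
          ContMDiffAt.comp (y, a * b) (g := fun p : EH × K => c p.1 p.2 1)
            (f := fun p : EH × K => (p.1, p.2 * b⁻¹)) (by simpa using ha y hy)
            (contMDiffAt_fst.prodMk (contMDiffAt_snd.mul contMDiffAt_const))
        have h2 : ContMDiffAt (𝓘(ℝ, EH).prod 𝓘(ℝ, EK)) 𝓘(ℝ, EK) ∞
            (fun p : EH × K => c p.1 b 1) (y, a * b) :=
          ContMDiffAt.comp (y, a * b) (g := fun p : EH × K => c p.1 p.2 1)
            (f := fun p : EH × K => (p.1, b)) (hb y hy)
            (contMDiffAt_fst.prodMk contMDiffAt_const)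
        refine (h1.mul h2).congr_of_eventuallyEq ?_
        filter_upwards [hball y hy (a * b)] with p hp
        simp [← hmul _ hp]
      inv_mem' := fun {a} ha y hy => by
        have h1 : ContMDiffAt (𝓘(ℝ, EH).prod 𝓘(ℝ, EK)) 𝓘(ℝ, EK) ∞
            (fun p : EH × K => c p.1 p.2⁻¹ 1) (y, a⁻¹) :=
          ContMDiffAt.comp (y, a⁻¹) (g := fun p : EH × K => c p.1 p.2 1)
            (f := fun p : EH × K => (p.1, p.2⁻¹)) (by simpa using ha y hy)
            (contMDiffAt_fst.prodMk contMDiffAt_snd.inv)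
        refine h1.inv.congr_of_eventuallyEq ?_
        filter_upwards [hball y hy a⁻¹] with p hp
        simp [hinv _ hp] }
  have hT : T = ⊤ := by
    exact subgroup_eq_top_of_mem_nhds_one T hsmooth
  refine ⟨fun y γ => c y γ 1, r, hr, fun y hy => ⟨(hU y hy).1,
    fun γ => ⟨c y γ, hc y hy γ, hc0 y hy γ, rfl⟩, hmul y hy, fun γ => ?_, fun ξ => ?_⟩⟩
  · have : γ ∈ T := hT ▸ Subgroup.mem_top γ
    exact this y hy
  · obtain ⟨w, hw0, hw, hd, hw1⟩ := (hU y hy).2.2 ξ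
    refine ⟨w, hw0, hw, ?_⟩
    rw [hw1, unitDeriv]
    refine congrArg (fun L : EK →L[ℝ] EK => L ξ) (Filter.EventuallyEq.fderiv_eq ?_)
    filter_upwards [Metric.ball_mem_nhds (0 : EK) hr] with x hx
    have hx' := (hU y hy).2.1 x hx
    rw [hloc y hy _ (uncoord_mem hx'.1) (by rwa [coord_uncoord hx'.1]), coord_uncoord hx'.1,
      coord_uncoord (hx'.2.2.1 1 (by simp))]

end LocalAction

/-! ### Integration of a multiplicative infinitesimal action -/

section GlobalAction

variable {EH : Type*} [NormedAddCommGroup EH] [NormedSpace ℝ EH]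
  {EK : Type*} [NormedAddCommGroup EK] [NormedSpace ℝ EK]
  {H : Type*} [TopologicalSpace H] [ChartedSpace EH H] [Group H] [LieGroup 𝓘(ℝ, EH) ∞ H]
  {K : Type*} [TopologicalSpace K] [ChartedSpace EK K] [Group K] [LieGroup 𝓘(ℝ, EK) ∞ K]

variable (EH) in
/-- A smooth linear representation of `H`. -/
structure IsSmoothRep (A : H → EK →L[ℝ] EK) : Prop where
  smooth : ContMDiff 𝓘(ℝ, EH) 𝓘(ℝ, EK →L[ℝ] EK) ∞ A
  map_one : A 1 = .id ℝ EK
  map_mul : ∀ g h, A (g * h) = A g ∘L A h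

/-- The differential of a representation is determined by its differential at the identity. -/
lemma IsSmoothRep.rdiff_eq {A : H → EK →L[ℝ] EK} (hA : IsSmoothRep EH A) (g : H) (X : EH) :
    rdiff EH A g X = rdiff EH A 1 X ∘L A g := by
  have h1 := hasFDerivAt_rdiff (hA.smooth.contMDiffAt (x := (1 : H)))
  have h2 := hasFDerivAt_rdiff (hA.smooth.contMDiffAt (x := g))
  simp only [mul_one] at h1
  have h3 := h1.clm_comp (hasFDerivAt_const (A g) (0 : EH))
  have h4 : (fun z : EH => A (uncoord H z * g)) = fun z => A (uncoord H z) ∘L A g := by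
    funext z
    rw [hA.map_mul]
  rw [h4] at h2
  rw [h2.unique h3]
  ext
  simp

/-- The equation linearized at the identity of `K`, along the radial path to `uncoord H y`, is solved
by the representation `A`. -/
lemma solution_eq_rep {V : K → EH →L[ℝ] EK} {A : H → EK →L[ℝ] EK} (hA : IsSmoothRep EH A)
    (hAV : ∀ X ξ, rdiff EH A 1 X ξ = rdiff EK V 1 ξ X) {y : EH}
    (hy : ∀ t ∈ Icc (0 : ℝ) 1, t • y ∈ coordTarget EH H) {C : ℝ}
    (hC : ∀ t ∈ Icc (0 : ℝ) 1, ‖radialLog H y t‖ ≤ C) {w : ℝ → EK}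
    (hw : ∀ t ∈ Icc (0 : ℝ) 1, HasDerivAt w (rdiff EK V 1 (w t) (radialLog H y t)) t) :
    w 1 = A (uncoord H y) (w 0) := by
  have hd : ∀ t ∈ Icc (0 : ℝ) 1, HasDerivAt (fun t => w t - A (uncoord H (t • y)) (w 0))
      (rdiff EK V 1 (w t - A (uncoord H (t • y)) (w 0)) (radialLog H y t)) t := by
    intro t ht
    have h1 := ((hasRightDeriv_radial (hy t ht)).comp_fun
      (hA.smooth.contMDiffAt (x := uncoord H (t • y)))).hasDerivAt
    have h2 := h1.clm_apply (hasDerivAt_const t (w 0))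
    refine ((hw t ht).sub h2).congr_deriv ?_
    simp [hA.rdiff_eq (uncoord H (t • y)), hAV]
  have hgr := norm_le_gronwallBound_of_norm_deriv_right_le (δ := 0)
    (K := ‖rdiff EK V 1‖ * C) (ε := 0) (f := fun t => w t - A (uncoord H (t • y)) (w 0))
    (fun r hr => (hd r hr).continuousAt.continuousWithinAt)
    (fun r hr => (hd r (Ico_subset_Icc_self hr)).hasDerivWithinAt)
    (by simp [hA.map_one]) (fun r hr => ?_) 1 (by simp)
  · rw [gronwallBound_ε0_δ0] at hgr
    simpa [sub_eq_zero] using norm_le_zero_iff.1 hgr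
  · have h3 := hC r (Ico_subset_Icc_self hr)
    have h4 := (rdiff EK V 1).le_opNorm (w r - A (uncoord H (r • y)) (w 0))
    have h5 := (rdiff EK V 1 (w r - A (uncoord H (r • y)) (w 0))).le_opNorm (radialLog H y r)
    calc _ ≤ _ := h5
      _ ≤ (‖rdiff EK V 1‖ * ‖w r - A (uncoord H (r • y)) (w 0)‖) * C := by gcongr
      _ = _ := by ring

variable [FiniteDimensional ℝ EH] [FiniteDimensional ℝ EK] [ConnectedSpace H] [ConnectedSpace K]

/-- A cocycle `V` on `K` whose linearization at the identity integrates to a representation of `H`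
integrates to a smooth action of `H` on `K` by automorphisms. -/
theorem exists_action_of_cocycle {V : K → EH →L[ℝ] EK} (hV : IsSmoothCocycle V)
    {A : H → EK →L[ℝ] EK} (hA : IsSmoothRep EH A)
    (hAV : ∀ X ξ, rdiff EH A 1 X ξ = rdiff EK V 1 ξ X) :
    ∃ φ : H → K →* K, (∀ γ, φ 1 γ = γ) ∧ (∀ g h γ, φ (g * h) γ = φ g (φ h γ)) ∧
      ContMDiff (𝓘(ℝ, EH).prod 𝓘(ℝ, EK)) 𝓘(ℝ, EK) ∞ (fun p : H × K => φ p.1 p.2) ∧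
      ∀ γ, HasRightDeriv (fun z : EH => φ (uncoord H z) γ) (V γ) 0 := by
  have := topologicalGroup_of_lieGroup 𝓘(ℝ, EK) ∞ (G := K)
  have := topologicalGroup_of_lieGroup 𝓘(ℝ, EH) ∞ (G := H)
  obtain ⟨F, r, hr, hF⟩ := exists_local_action (EH := EH) (H := H) hV
  have hrad : ∀ y ∈ Metric.ball (0 : EH) r, ∀ t ∈ Icc (0 : ℝ) 1, t • y ∈ coordTarget EH H :=
    fun y hy t ht => (hF _ (smul_mem_ball hy ht)).1
  have hFsmooth : ∀ y ∈ Metric.ball (0 : EH) r, ContMDiff 𝓘(ℝ, EK) 𝓘(ℝ, EK) ∞ (F y) :=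
    fun y hy γ => ContMDiffAt.comp γ (g := fun p : EH × K => F p.1 p.2) (f := fun γ => (y, γ))
      ((hF y hy).2.2.2.1 γ) (contMDiffAt_const.prodMk contMDiffAt_id)
  have hFA : ∀ y ∈ Metric.ball (0 : EH) r, unitDeriv EK EK (F y) = A (uncoord H y) := by
    intro y hy
    obtain ⟨C, hC⟩ := exists_norm_radialLog_le (hrad y hy)
    ext ξ
    obtain ⟨w, hw0, hw, hw1⟩ := (hF y hy).2.2.2.2 ξ
    rw [← hw1, ← hw0]
    exact solution_eq_rep hA hAV (hrad y hy) hC hw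
  let Fhom : ∀ y ∈ Metric.ball (0 : EH) r, K →* K := fun y hy =>
    MonoidHom.mk' (F y) (hF y hy).2.2.1
  have hnear : ∀ᶠ h in 𝓝 (1 : H), h ∈ coordSource EH H ∧ coord EH h ∈ Metric.ball (0 : EH) r :=
    Filter.Eventually.and coordSource_mem_nhds
      ((continuousAt_coord one_mem_coordSource).eventually_mem
        (by rw [coord_one]; exact Metric.ball_mem_nhds _ hr))
  -- the elements `h` for which `A h` is the differential of an endomorphism of `K`
  let P : H → Prop := fun h => ∃ φ : K →* K, ContMDiff 𝓘(ℝ, EK) 𝓘(ℝ, EK) ∞ φ ∧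
    unitDeriv EK EK φ = A h
  have hPnear : ∀ᶠ h in 𝓝 (1 : H), P h := by
    filter_upwards [hnear] with h hh
    refine ⟨Fhom _ hh.2, hFsmooth _ hh.2, ?_⟩
    exact (hFA _ hh.2).trans (congrArg A (uncoord_coord hh.1))
  have hPmul : ∀ {g h}, P g → P h → P (g * h) := by
    rintro g h ⟨φ, hφ, hφA⟩ ⟨χ, hχ, hχA⟩
    refine ⟨φ.comp χ, hφ.comp hχ, ?_⟩
    rw [hA.map_mul, ← hφA, ← hχA]
    exact unitDeriv_comp hφ.contMDiffAt (map_one φ) hχ.contMDiffAt (map_one χ)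
  let S : Subgroup H :=
    { carrier := {h | P h ∧ P h⁻¹}
      one_mem' := ⟨hPnear.self_of_nhds, by simpa using hPnear.self_of_nhds⟩
      mul_mem' := fun {a b} ha hb => ⟨hPmul ha.1 hb.1, by
        rw [mul_inv_rev]; exact hPmul hb.2 ha.2⟩
      inv_mem' := fun {a} ha => ⟨ha.2, by simpa using ha.1⟩ }
  have hS : S = ⊤ := by
    refine subgroup_eq_top_of_mem_nhds_one S (hPnear.and ?_)
    have h1 : ContinuousAt (fun h : H => h⁻¹) 1 := continuousAt_inv
    exact h1.eventually (p := P) (by simpa using hPnear)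
  have hP : ∀ h, P h := fun h => by
    have : h ∈ S := hS ▸ Subgroup.mem_top h
    exact this.1
  choose φ hφ hφA using hP
  have huniq : ∀ h (χ : K →* K), ContMDiff 𝓘(ℝ, EK) 𝓘(ℝ, EK) ∞ χ →
      unitDeriv EK EK χ = A h → φ h = χ := fun h χ hχ hχA =>
    hom_eq_of_unitDeriv_eq (hφ h) hχ ((hφA h).trans hχA.symm)
  have hφ1 : φ 1 = MonoidHom.id K := huniq _ _ contMDiff_id (by
    rw [hA.map_one]; exact unitDeriv_id)
  have hφmul : ∀ g h, φ (g * h) = (φ g).comp (φ h) := fun g h =>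
    huniq _ _ ((hφ g).comp (hφ h)) (by
      rw [hA.map_mul, ← hφA, ← hφA]
      exact unitDeriv_comp (hφ g).contMDiffAt (map_one _) (hφ h).contMDiffAt (map_one _))
  have hφF : ∀ y ∈ Metric.ball (0 : EH) r, ∀ γ, φ (uncoord H y) γ = F y γ := fun y hy γ => by
    rw [huniq _ (Fhom y hy) (hFsmooth y hy) (hFA y hy)]
    rfl
  have hφF' : ∀ᶠ h in 𝓝 (1 : H), ∀ γ, φ h γ = F (coord EH h) γ := by
    filter_upwards [hnear] with h hh γ
    rw [← hφF _ hh.2, uncoord_coord hh.1]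
  have hsm1 : ∀ γ, ContMDiffAt (𝓘(ℝ, EH).prod 𝓘(ℝ, EK)) 𝓘(ℝ, EK) ∞
      (fun p : H × K => φ p.1 p.2) (1, γ) := by
    intro γ
    have h1 : ContMDiffAt (𝓘(ℝ, EH).prod 𝓘(ℝ, EK)) 𝓘(ℝ, EK) ∞
        (fun p : H × K => F (coord EH p.1) p.2) (1, γ) :=
      ContMDiffAt.comp (1, γ) (g := fun p : EH × K => F p.1 p.2)
        (f := fun p : H × K => (coord EH p.1, p.2))
        ((hF _ (by rw [coord_one]; exact Metric.mem_ball_self hr)).2.2.2.1 γ)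
        ((ContMDiffAt.comp (1, γ) (g := coord EH) (f := fun p : H × K => p.1)
          contMDiffAt_coord_one contMDiffAt_fst).prodMk contMDiffAt_snd)
    refine h1.congr_of_eventuallyEq ?_
    have hfst : ContinuousAt (fun p : H × K => p.1) (1, γ) := continuousAt_fst
    filter_upwards [hfst.eventually hφF'] with p hp
    exact hp _
  refine ⟨φ, fun γ => by rw [hφ1]; rfl, fun g h γ => by rw [hφmul]; rfl, ?_, fun γ => ?_⟩
  · -- smoothness at `h₀` follows from smoothness at `1`, since `φ h = φ h₀ ∘ φ (h₀⁻¹ h)`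
    rintro ⟨h₀, γ₀⟩
    have h1 : ContMDiffAt (𝓘(ℝ, EH).prod 𝓘(ℝ, EK)) 𝓘(ℝ, EK) ∞
        (fun p : H × K => φ h₀ (φ (h₀⁻¹ * p.1) p.2)) (h₀, γ₀) := by
      refine ContMDiffAt.comp (h₀, γ₀) (g := φ h₀)
        (f := fun p : H × K => φ (h₀⁻¹ * p.1) p.2) (hφ h₀).contMDiffAt ?_
      exact ContMDiffAt.comp (h₀, γ₀) (g := fun p : H × K => φ p.1 p.2)
        (f := fun p : H × K => (h₀⁻¹ * p.1, p.2)) (by simpa using hsm1 γ₀)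
        ((contMDiffAt_const.mul contMDiffAt_fst).prodMk contMDiffAt_snd)
    refine h1.congr_of_eventuallyEq (Eventually.of_forall fun p => ?_)
    change φ p.1 p.2 = φ h₀ (φ (h₀⁻¹ * p.1) p.2)
    conv_lhs => rw [← mul_inv_cancel_left h₀ p.1, hφmul]
    rfl
  · -- the derivative exists, and along each ray it is the initial velocity of a flow curve
    have hsm : ContMDiffAt 𝓘(ℝ, EH) 𝓘(ℝ, EK) ∞ (fun z : EH => φ (uncoord H z) γ * γ⁻¹) 0 := by
      refine ContMDiffAt.mul ?_ contMDiffAt_const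
      refine ContMDiffAt.comp (0 : EH) (g := fun p : H × K => φ p.1 p.2)
        (f := fun z : EH => (uncoord H z, γ)) (by simpa using hsm1 γ)
        (contMDiffAt_uncoord_zero.prodMk contMDiffAt_const)
    have hone : φ (uncoord H (0 : EH)) γ * γ⁻¹ = 1 := by simp [hφ1]
    have hsm' : ContMDiffAt 𝓘(ℝ, EH) 𝓘(ℝ, EK) ∞
        (fun z : EH => coord EK (φ (uncoord H z) γ * γ⁻¹)) 0 := by
      refine ContMDiffAt.comp (0 : EH) (g := coord EK) ?_ hsm
      rw [hone]
      exact contMDiffAt_coord_one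
    have hd := (hsm'.contDiffAt.differentiableAt (by simp)).hasFDerivAt
    set L := fderiv ℝ (fun z : EH => coord EK (φ (uncoord H z) γ * γ⁻¹)) 0 with hL
    have hLV : ∀ y ∈ Metric.ball (0 : EH) r, L y = V γ y := by
      intro y hy
      obtain ⟨c, hc, hc0, hc1⟩ := (hF y hy).2.1 γ
      obtain ⟨C, hC⟩ := exists_norm_radialLog_le (hrad y hy)
      have hray : ∀ s ∈ Icc (0 : ℝ) 1, φ (uncoord H (s • y)) γ = c s := by
        intro s hs
        have hsy := smul_mem_ball hy hs
        obtain ⟨d, hd, hd0, hd1⟩ := (hF _ hsy).2.1 γ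
        obtain ⟨C', hC'⟩ := exists_norm_radialLog_le (hrad _ hsy)
        rw [hφF _ hsy, ← hd1, hd.eq hV hC' (hc.rescale hs) (by simp [hd0, hc0]) (by simp),
          mul_one]
      have h1 : HasDerivWithinAt (fun s : ℝ => coord EK (φ (uncoord H (s • y)) γ * γ⁻¹)) (L y)
          (Icc 0 1) 0 := by
        have h2 : HasDerivAt (fun s : ℝ => s • y) y 0 := by
          simpa using (hasDerivAt_id (0 : ℝ)).smul_const y
        have h3 : HasFDerivAt (fun z : EH => coord EK (φ (uncoord H z) γ * γ⁻¹)) L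
            ((0 : ℝ) • y) := by rwa [zero_smul]
        exact (h3.comp_hasDerivAt (0 : ℝ) h2).hasDerivWithinAt
      have h4 : HasDerivWithinAt (fun s : ℝ => coord EK (φ (uncoord H (s • y)) γ * γ⁻¹)) (V γ y)
          (Icc 0 1) 0 := by
        have h5 := (HasUnitDeriv.hasFDerivAt (hc 0 (by simp))).hasDerivAt.hasDerivWithinAt
          (s := Icc 0 1)
        simp only [hc0, radialLog_zero, ContinuousLinearMap.toSpanSingleton_apply, one_smul] at h5
        refine h5.congr (fun s hs => by rw [hray s hs]) (by rw [hray 0 (by simp), hc0])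
      exact (uniqueDiffOn_Icc zero_lt_one 0 (by simp)).eq_deriv _ h1 h4
    have hLV' : L = V γ := by
      have h6 : ∀ᶠ y in 𝓝 (0 : EH), L y = V γ y := by
        filter_upwards [Metric.ball_mem_nhds (0 : EH) hr] with y hy using hLV y hy
      have h7 : HasFDerivAt L (V γ) 0 := (V γ).hasFDerivAt.congr_of_eventuallyEq h6
      exact L.hasFDerivAt.unique h7
    have hu : HasUnitDeriv (fun z : EH => φ (uncoord H z) γ * γ⁻¹) (V γ) 0 :=
      ⟨hone, hsm.continuousAt, hLV' ▸ hd⟩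
    simpa [HasRightDeriv, hφ1] using hu

end GlobalAction

/-! ### Multiplicative Poisson structures in the right trivialization -/

section SmoothTesting

variable {E : Type*} [NormedAddCommGroup E] [NormedSpace ℝ E]
  {M : Type*} [TopologicalSpace M] [ChartedSpace E M]
  {D : Type*} [NormedAddCommGroup D] [NormedSpace ℝ D] [FiniteDimensional ℝ D]
  {W : Type*} [NormedAddCommGroup W] [NormedSpace ℝ W]

lemma contMDiffAt_of_clm_apply {f : M → D →L[ℝ] W} {x : M}
    (h : ∀ y, ContMDiffAt 𝓘(ℝ, E) 𝓘(ℝ, W) ∞ (fun x => f x y) x) :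
    ContMDiffAt 𝓘(ℝ, E) 𝓘(ℝ, D →L[ℝ] W) ∞ f x := by
  let d := Module.finrank ℝ D
  have hd : d = Module.finrank ℝ (Fin d → ℝ) := (Module.finrank_fin_fun ℝ).symm
  let e₁ := ContinuousLinearEquiv.ofFinrankEq hd
  let e₂ := (e₁.arrowCongr (1 : W ≃L[ℝ] W)).trans (ContinuousLinearEquiv.piRing (Fin d))
  have h1 : f = fun x => e₂.symm (e₂ (f x)) := by
    funext x
    simp
  rw [h1]
  refine ContMDiffAt.comp x (g := e₂.symm) (f := fun x => e₂ (f x))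
    e₂.symm.contDiff.contMDiff.contMDiffAt ?_
  exact contMDiffAt_pi_space.2 fun i => h _

lemma contMDiffAt_of_dual_apply {f : M → D} {x : M}
    (h : ∀ α : D →L[ℝ] ℝ, ContMDiffAt 𝓘(ℝ, E) 𝓘(ℝ, ℝ) ∞ (fun x => α (f x)) x) :
    ContMDiffAt 𝓘(ℝ, E) 𝓘(ℝ, D) ∞ f x := by
  let d := Module.finrank ℝ D
  have hd : d = Module.finrank ℝ (Fin d → ℝ) := (Module.finrank_fin_fun ℝ).symm
  let e := ContinuousLinearEquiv.ofFinrankEq hd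
  have h1 : f = fun x => e.symm (e (f x)) := by
    funext x
    simp
  rw [h1]
  refine ContMDiffAt.comp x (g := e.symm) (f := fun x => e (f x))
    e.symm.contDiff.contMDiff.contMDiffAt ?_
  exact contMDiffAt_pi_space.2 fun i =>
    h (ContinuousLinearMap.proj (R := ℝ) (φ := fun _ : Fin d => ℝ) i ∘L e.toContinuousLinearMap)

end SmoothTesting

section RightSharp

variable {E : Type*} [NormedAddCommGroup E] [NormedSpace ℝ E] [FiniteDimensional ℝ E]
  {G : Type*} [TopologicalSpace G] [ChartedSpace E G] [Group G] [LieGroup 𝓘(ℝ, E) ∞ G]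

variable (E G) in
/-- A smooth map `G → E` that agrees near the identity with the chart `coord`. -/
lemma exists_smooth_extension_coord : ∃ y : G → E, ContMDiff 𝓘(ℝ, E) 𝓘(ℝ, E) ∞ y ∧
    y =ᶠ[𝓝 1] coord E := by
  have := topologicalGroup_of_lieGroup 𝓘(ℝ, E) ∞ (G := G)
  have : T1Space G := ChartedSpace.t1Space E G
  have : T2Space G := inferInstance
  let χ : SmoothBumpFunction 𝓘(ℝ, E) (1 : G) := Classical.arbitrary _
  refine ⟨fun g => χ g • coord E g, χ.contMDiff_smul fun g hg => ?_, ?_⟩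
  · refine (contMDiffAt_coord ?_).contMDiffWithinAt
    rwa [coordSource, extChartAt_source]
  · filter_upwards [χ.eventuallyEq_one] with g hg
    simp [hg]

lemma rdiff_clm_comp {f : G → E} {V : Type*} [NormedAddCommGroup V] [NormedSpace ℝ V]
    {g : G} (hf : ContMDiffAt 𝓘(ℝ, E) 𝓘(ℝ, E) ∞ f g) (L : E →L[ℝ] V) :
    rdiff E (fun x => L (f x)) g = L ∘L rdiff E f g :=
  (L.hasFDerivAt.comp (0 : E) (hasFDerivAt_rdiff hf)).fderiv

lemma rdiff_one_congr {V : Type*} [NormedAddCommGroup V] [NormedSpace ℝ V] {f f' : G → V}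
    (h : f =ᶠ[𝓝 1] f') : rdiff E f 1 = rdiff E f' 1 := by
  rw [rdiff_one, rdiff_one]
  refine Filter.EventuallyEq.fderiv_eq ?_
  have h1 := continuousAt_uncoord (G := G) (zero_mem_coordTarget (E := E))
  rw [ContinuousAt, uncoord_zero] at h1
  exact h1.eventually h

variable (G) in
/-- Every covector at the identity is the differential of a smooth function. -/
lemma exists_smooth_rdiff_one_eq (α : E →L[ℝ] ℝ) :
    ∃ f : G → ℝ, ContMDiff 𝓘(ℝ, E) 𝓘(ℝ, ℝ) ∞ f ∧ rdiff E f 1 = α := by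
  obtain ⟨y, hy, hyc⟩ := exists_smooth_extension_coord E G
  refine ⟨fun g => α (y g), α.contDiff.contMDiff.comp hy, ?_⟩
  rw [rdiff_clm_comp hy.contMDiffAt, rdiff_one_congr hyc, rdiff_coord_one]
  simp

/-- The bundle map `π♯` in the right trivialization, as an operator from `(Lie G)*` to `Lie G`. -/
def PoissonStructure.rightSharp (π : PoissonStructure E G) (g : G) : (E →L[ℝ] ℝ) →L[ℝ] E :=
  LinearMap.toContinuousLinearMap
    ((rightTriv E g : E →L[ℝ] E).toLinearMap ∘ₗ (π.sharp g : (E →L[ℝ] ℝ) →ₗ[ℝ] E) ∘ₗ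
      ((ContinuousLinearMap.compL ℝ E E ℝ).flip (rightTriv E g : E →L[ℝ] E)).toLinearMap)

variable (π : PoissonStructure E G)

lemma rightSharp_apply (g : G) (α : E →L[ℝ] ℝ) : π.rightSharp g α =
    (rightTriv E g : E →L[ℝ] E) (π.sharp g (α ∘L (rightTriv E g : E →L[ℝ] E))) := rfl

lemma bracket_eq_rightSharp {f₁ f₂ : G → ℝ} (h₁ : ContMDiff 𝓘(ℝ, E) 𝓘(ℝ, ℝ) ∞ f₁)
    (h₂ : ContMDiff 𝓘(ℝ, E) 𝓘(ℝ, ℝ) ∞ f₂) (g : G) :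
    π.bracket f₁ f₂ g = rdiff E f₁ g (π.rightSharp g (rdiff E f₂ g)) := by
  have e₁ : diff E f₁ g = rdiff E f₁ g ∘L (rightTriv E g : E →L[ℝ] E) :=
    mfderiv_eq_rdiff_comp_rightTriv h₁.contMDiffAt
  have e₂ : diff E f₂ g = rdiff E f₂ g ∘L (rightTriv E g : E →L[ℝ] E) :=
    mfderiv_eq_rdiff_comp_rightTriv h₂.contMDiffAt
  rw [PoissonStructure.bracket, e₁, e₂]
  rfl

lemma contMDiff_mul_left' (g : G) : ContMDiff 𝓘(ℝ, E) 𝓘(ℝ, E) ∞ (fun x : G => g * x) :=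
  contMDiff_const.mul contMDiff_id

lemma rightTriv_comp_mfderiv_mul_right (g h : G) :
    (rightTriv E (g * h) : E →L[ℝ] E) ∘L
      (mfderiv 𝓘(ℝ, E) 𝓘(ℝ, E) (fun x : G => x * h) g : E →L[ℝ] E) = rightTriv E g := by
  have h1 := mfderiv_comp (I := 𝓘(ℝ, E)) (I' := 𝓘(ℝ, E)) (I'' := 𝓘(ℝ, E)) g
    (g := fun x : G => x * (g * h)⁻¹) (f := fun x : G => x * h)
    ((contMDiff_mul_const (E := E) _).contMDiffAt.mdifferentiableAt (by simp))
    ((contMDiff_mul_const (E := E) _).contMDiffAt.mdifferentiableAt (by simp))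
  refine h1.symm.trans ?_
  have h2 : (fun x : G => x * (g * h)⁻¹) ∘ (fun x : G => x * h) = fun x => x * g⁻¹ := by
    funext x
    simp [mul_assoc]
  rw [h2]
  rfl

lemma rightTriv_comp_mfderiv_mul_left (g h : G) :
    (rightTriv E (g * h) : E →L[ℝ] E) ∘L
      (mfderiv 𝓘(ℝ, E) 𝓘(ℝ, E) (fun x : G => g * x) h : E →L[ℝ] E) =
        Ad E g ∘L (rightTriv E h : E →L[ℝ] E) := by
  have h1 := mfderiv_comp (I := 𝓘(ℝ, E)) (I' := 𝓘(ℝ, E)) (I'' := 𝓘(ℝ, E)) h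
    (g := fun x : G => x * (g * h)⁻¹) (f := fun x : G => g * x)
    ((contMDiff_mul_const (E := E) _).contMDiffAt.mdifferentiableAt (by simp))
    ((contMDiff_mul_left' (E := E) _).contMDiffAt.mdifferentiableAt (by simp))
  have h3 := mfderiv_comp (I := 𝓘(ℝ, E)) (I' := 𝓘(ℝ, E)) (I'' := 𝓘(ℝ, E)) h
    (g := fun x : G => g * x * g⁻¹) (f := fun x : G => x * h⁻¹)
    ((contMDiff_mul_left_mul_right (E := E) g g⁻¹).contMDiffAt.mdifferentiableAt (by simp))
    ((contMDiff_mul_const (E := E) _).contMDiffAt.mdifferentiableAt (by simp))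
  have h4 : (mfderiv 𝓘(ℝ, E) 𝓘(ℝ, E) (fun x : G => g * x * g⁻¹) (h * h⁻¹) : E →L[ℝ] E) =
      Ad E g := by
    rw [mul_inv_cancel]
    exact mfderiv_one_eq_unitDeriv (contMDiff_mul_left_mul_right (E := E) g g⁻¹).contMDiffAt
      (by simp)
  refine h1.symm.trans ?_
  rw [← h4]
  refine Eq.trans ?_ h3
  have h2 : (fun x : G => x * (g * h)⁻¹) ∘ (fun x : G => g * x) =
      (fun x : G => g * x * g⁻¹) ∘ (fun x : G => x * h⁻¹) := by
    funext x
    simp [mul_assoc]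
  rw [h2]

variable {π}

/-- In the right trivialization a multiplicative bivector field is a one-cocycle. -/
lemma rightSharp_mul (hπ : π.IsMultiplicative) (g h : G) (α : E →L[ℝ] ℝ) :
    π.rightSharp (g * h) α =
      π.rightSharp g α + Ad E g (π.rightSharp h (α ∘L Ad E g)) := by
  have h1 := hπ g h (α ∘L (rightTriv E (g * h) : E →L[ℝ] E))
  have h2 := congrArg (rightTriv E (g * h) : E →L[ℝ] E) h1
  have hr := rightTriv_comp_mfderiv_mul_right (E := E) g h
  have hl := rightTriv_comp_mfderiv_mul_left (E := E) g h
  rw [rightSharp_apply]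
  refine h2.trans ?_
  refine (map_add (rightTriv E (g * h) : E →L[ℝ] E) _ _).trans ?_
  rw [add_comm]
  congr 1
  · refine (DFunLike.congr_fun hr _).trans ?_
    refine congrArg (fun L : E →L[ℝ] ℝ => (rightTriv E g : E →L[ℝ] E) (π.sharp g L)) ?_
    exact congrArg (fun L : E →L[ℝ] E => α ∘L L) hr
  · refine (DFunLike.congr_fun hl _).trans ?_
    refine congrArg (fun L : E →L[ℝ] ℝ =>
      Ad E g ((rightTriv E h : E →L[ℝ] E) (π.sharp h L))) ?_
    exact congrArg (fun L : E →L[ℝ] E => α ∘L L) hl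

lemma rightSharp_one (hπ : π.IsMultiplicative) : π.rightSharp 1 = 0 := by
  ext1 α
  have h := rightSharp_mul hπ 1 1 α
  rw [Ad_one, ContinuousLinearMap.comp_id, mul_one] at h
  exact left_eq_add.1 h

/-- Brackets of smooth functions are smooth, so the matrix `N π♯ Nᵀ` of `π♯` in smooth coordinates is
smooth, and near the identity the Jacobian `N` of the coordinates can be inverted. -/
lemma contMDiffAt_rightSharp_one : ContMDiffAt 𝓘(ℝ, E) 𝓘(ℝ, (E →L[ℝ] ℝ) →L[ℝ] E) ∞
    (π.rightSharp) 1 := by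
  have : CompleteSpace E := FiniteDimensional.complete ℝ E
  obtain ⟨y, hy, hyc⟩ := exists_smooth_extension_coord E G
  -- the matrix of `π♯` in the coordinates `y`
  let N : G → E →L[ℝ] E := rdiff E y
  have hN : ContMDiffAt 𝓘(ℝ, E) 𝓘(ℝ, E →L[ℝ] E) ∞ N 1 := contMDiffAt_rdiff hy.contMDiffAt
  have hN1 : N 1 = .id ℝ E := (rdiff_one_congr hyc).trans rdiff_coord_one
  have hS : ContMDiffAt 𝓘(ℝ, E) 𝓘(ℝ, (E →L[ℝ] ℝ) →L[ℝ] E) ∞ (fun g => N g ∘L π.rightSharp g ∘L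
      ((ContinuousLinearMap.compL ℝ E E ℝ).flip (N g))) 1 := by
    refine contMDiffAt_of_clm_apply fun β => contMDiffAt_of_dual_apply fun α => ?_
    have h1 := (π.smooth _ _ (α.contDiff.contMDiff.comp hy)
      (β.contDiff.contMDiff.comp hy)).contMDiffAt (x := 1)
    refine h1.congr_of_eventuallyEq (Eventually.of_forall fun g => ?_)
    refine Eq.trans ?_ (bracket_eq_rightSharp π (α.contDiff.contMDiff.comp hy)
      (β.contDiff.contMDiff.comp hy) g).symm
    have e₁ : rdiff E (α ∘ y) g = α ∘L N g := rdiff_clm_comp hy.contMDiffAt α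
    have e₂ : rdiff E (β ∘ y) g = β ∘L N g := rdiff_clm_comp hy.contMDiffAt β
    rw [e₁, e₂]
    rfl
  have hinv : ContMDiffAt 𝓘(ℝ, E) 𝓘(ℝ, E →L[ℝ] E) ∞
      (fun g => ContinuousLinearMap.inverse (N g)) 1 := by
    have h1 := contDiffAt_map_inverse (𝕜 := ℝ) (n := ∞) (ContinuousLinearEquiv.refl ℝ E)
    refine ContMDiffAt.comp (1 : G) (g := ContinuousLinearMap.inverse) (f := N) ?_ hN
    rw [hN1]
    exact h1.contMDiffAt
  have hflip : ContMDiffAt 𝓘(ℝ, E) 𝓘(ℝ, (E →L[ℝ] ℝ) →L[ℝ] (E →L[ℝ] ℝ)) ∞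
      (fun g => (ContinuousLinearMap.compL ℝ E E ℝ).flip (ContinuousLinearMap.inverse (N g))) 1 :=
    ContMDiffAt.comp (1 : G) (g := (ContinuousLinearMap.compL ℝ E E ℝ).flip)
      (ContinuousLinearMap.contDiff _).contMDiff.contMDiffAt hinv
  refine ((hinv.clm_comp hS).clm_comp hflip).congr_of_eventuallyEq ?_
  have hunit : ∀ᶠ g in 𝓝 (1 : G), (N g).IsInvertible := by
    have h1 : ∀ᶠ L in 𝓝 (ContinuousLinearMap.id ℝ E), L.IsInvertible :=
      ContinuousLinearEquiv.nhds (ContinuousLinearEquiv.refl ℝ E)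
    have h2 := hN.continuousAt
    rw [ContinuousAt, hN1] at h2
    exact h2.eventually h1
  filter_upwards [hunit] with g hg
  ext1 β
  have h1 : ∀ v, ContinuousLinearMap.inverse (N g) (N g v) = v := fun v =>
    DFunLike.congr_fun hg.inverse_comp_self v
  have h2 : (β ∘L ContinuousLinearMap.inverse (N g)) ∘L N g = β := by
    ext v
    simp [h1]
  change _ = ContinuousLinearMap.inverse (N g) (N g (π.rightSharp g
    ((β ∘L ContinuousLinearMap.inverse (N g)) ∘L N g)))
  rw [h1, h2]

/-- The cocycle identity carries smoothness from the identity to all other points. -/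
lemma contMDiff_rightSharp (hπ : π.IsMultiplicative) :
    ContMDiff 𝓘(ℝ, E) 𝓘(ℝ, (E →L[ℝ] ℝ) →L[ℝ] E) ∞ π.rightSharp := by
  intro g₀
  have h0 : ContMDiffAt 𝓘(ℝ, E) 𝓘(ℝ, E) ∞ (fun g : G => g * g₀⁻¹) g₀ :=
    (contMDiff_mul_const g₀⁻¹).contMDiffAt
  have h1 : ContMDiffAt 𝓘(ℝ, E) 𝓘(ℝ, (E →L[ℝ] ℝ) →L[ℝ] E) ∞
      (fun g => π.rightSharp (g * g₀⁻¹)) g₀ :=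
    ContMDiffAt.comp g₀ (g := π.rightSharp) (by
      rw [mul_inv_cancel]; exact contMDiffAt_rightSharp_one) h0
  have h2 : ContMDiffAt 𝓘(ℝ, E) 𝓘(ℝ, E →L[ℝ] E) ∞ (fun g : G => Ad E (g * g₀⁻¹)) g₀ :=
    ContMDiffAt.comp g₀ (g := Ad E) contMDiff_Ad.contMDiffAt h0
  have h3 : ContMDiffAt 𝓘(ℝ, E) 𝓘(ℝ, (E →L[ℝ] ℝ) →L[ℝ] (E →L[ℝ] ℝ)) ∞
      (fun g : G => (ContinuousLinearMap.compL ℝ E E ℝ).flip (Ad E (g * g₀⁻¹))) g₀ :=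
    ContMDiffAt.comp g₀ (g := (ContinuousLinearMap.compL ℝ E E ℝ).flip)
      (ContinuousLinearMap.contDiff _).contMDiff.contMDiffAt h2
  refine (h1.add ((h2.clm_comp (contMDiffAt_const (c := π.rightSharp g₀))).clm_comp
    h3)).congr_of_eventuallyEq (Eventually.of_forall fun g => ?_)
  ext1 α
  have := rightSharp_mul hπ (g * g₀⁻¹) g₀ α
  rw [inv_mul_cancel_right] at this
  exact this

/-- The linearization of the bracket at the identity, through the derivative of `π♯`. -/
lemma rdiff_bracket_one (hπ : π.IsMultiplicative) {f₁ f₂ : G → ℝ}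
    (h₁ : ContMDiff 𝓘(ℝ, E) 𝓘(ℝ, ℝ) ∞ f₁) (h₂ : ContMDiff 𝓘(ℝ, E) 𝓘(ℝ, ℝ) ∞ f₂) (ξ : E) :
    rdiff E (π.bracket f₁ f₂) 1 ξ =
      rdiff E f₁ 1 (rdiff E π.rightSharp 1 ξ (rdiff E f₂ 1)) := by
  have e₁ := hasFDerivAt_rdiff (contMDiffAt_rdiff (h₁.contMDiffAt (x := 1)))
  have e₂ := hasFDerivAt_rdiff (contMDiffAt_rdiff (h₂.contMDiffAt (x := 1)))
  have e₃ := hasFDerivAt_rdiff ((contMDiff_rightSharp hπ).contMDiffAt (x := 1))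
  have e₄ := e₁.clm_apply (e₃.clm_apply e₂)
  have e₅ : π.bracket f₁ f₂ = fun g => rdiff E f₁ g (π.rightSharp g (rdiff E f₂ g)) :=
    funext (bracket_eq_rightSharp π h₁ h₂)
  rw [e₅, rdiff, e₄.fderiv]
  simp [rightSharp_one hπ]

lemma contMDiff_bracket {f₁ f₂ : G → ℝ} (h₁ : ContMDiff 𝓘(ℝ, E) 𝓘(ℝ, ℝ) ∞ f₁)
    (h₂ : ContMDiff 𝓘(ℝ, E) 𝓘(ℝ, ℝ) ∞ f₂) :
    ContMDiff 𝓘(ℝ, E) 𝓘(ℝ, ℝ) ∞ (π.bracket f₁ f₂) := π.smooth f₁ f₂ h₁ h₂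

end RightSharp

/-! ### Homomorphisms, brackets and duality -/

section Hom

variable {E : Type*} [NormedAddCommGroup E] [NormedSpace ℝ E]
  {G : Type*} [TopologicalSpace G] [ChartedSpace E G] [Group G] [LieGroup 𝓘(ℝ, E) ∞ G]
  {E' : Type*} [NormedAddCommGroup E'] [NormedSpace ℝ E']
  {G' : Type*} [TopologicalSpace G'] [ChartedSpace E' G'] [Group G'] [LieGroup 𝓘(ℝ, E') ∞ G']
  {W : Type*} [NormedAddCommGroup W] [NormedSpace ℝ W]

lemma lieMap_eq_unitDeriv {j : G →* G'} (hj : ContMDiff 𝓘(ℝ, E) 𝓘(ℝ, E') ∞ j) :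
    (lieMap E E' j : E →L[ℝ] E') = unitDeriv E E' j :=
  mfderiv_one_eq_unitDeriv hj.contMDiffAt (map_one j)

lemma rdiff_comp_hom {j : G →* G'} (hj : ContMDiff 𝓘(ℝ, E) 𝓘(ℝ, E') ∞ j) {f : G' → W}
    (hf : ContMDiff 𝓘(ℝ, E') 𝓘(ℝ, W) ∞ f) (g : G) :
    rdiff E (fun x => f (j x)) g = rdiff E' f (j g) ∘L unitDeriv E E' j := by
  have h1 := (((hasUnitDeriv_uncoord (E := E) (G := G)).hasRightDeriv.mul_const g).map_hom j
    hj.contMDiffAt).comp_fun (f := f) hf.contMDiffAt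
  simpa [rdiff] using h1.fderiv

lemma Ad_comp_isSmoothRep {j : G →* G'} (hj : ContMDiff 𝓘(ℝ, E) 𝓘(ℝ, E') ∞ j) :
    IsSmoothRep E (fun g => Ad E' (j g)) where
  smooth := contMDiff_Ad.comp hj
  map_one := by rw [map_one, Ad_one]
  map_mul g h := by rw [map_mul, Ad_mul]

lemma groupBracket_swap [CompleteSpace E] (ξ η : E) :
    groupBracket G ξ η = -groupBracket G η ξ := by
  rw [groupBracket_eq_coordMul, groupBracket_eq_coordMul, neg_sub]

lemma unitDeriv_groupBracket [CompleteSpace E] [CompleteSpace E'] {j : G →* G'}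
    (hj : ContMDiff 𝓘(ℝ, E) 𝓘(ℝ, E') ∞ j) (ξ η : E) :
    unitDeriv E E' j (groupBracket G ξ η) =
      groupBracket G' (unitDeriv E E' j ξ) (unitDeriv E E' j η) := by
  have h1 : HasFDerivAt (fun z => Ad E (uncoord G z)) (rdiff E (Ad E : G → E →L[ℝ] E) 1) 0 := by
    simpa using hasFDerivAt_rdiff (contMDiff_Ad (E := E) (G := G)).contMDiffAt (g := 1)
  have h2 : HasFDerivAt (fun z => Ad E' (j (uncoord G z)))
      (rdiff E (fun g => Ad E' (j g)) 1) 0 := by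
    simpa using hasFDerivAt_rdiff (Ad_comp_isSmoothRep hj).smooth.contMDiffAt (g := 1)
  have h3 := (hasFDerivAt_const (unitDeriv E E' j) (0 : E)).clm_comp h1
  have h4 := h2.clm_comp (hasFDerivAt_const (unitDeriv E E' j) (0 : E))
  have h5 : (fun z : E => unitDeriv E E' j ∘L Ad E (uncoord G z)) =
      fun z => Ad E' (j (uncoord G z)) ∘L unitDeriv E E' j :=
    funext fun z => unitDeriv_Ad j hj _
  rw [h5] at h3
  have h6 := DFunLike.congr_fun (DFunLike.congr_fun (h3.unique h4) ξ) η
  rw [rdiff_comp_hom hj contMDiff_Ad] at h6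
  simpa [rdiff_Ad_one] using h6

end Hom

section Duality

variable {E : Type*} [NormedAddCommGroup E] [NormedSpace ℝ E] [FiniteDimensional ℝ E]
  {F : Type*} [NormedAddCommGroup F] [NormedSpace ℝ F] [FiniteDimensional ℝ F]
  {G : Type*} [TopologicalSpace G] [ChartedSpace E G] [Group G] [LieGroup 𝓘(ℝ, E) ∞ G]
  {Gs : Type*} [TopologicalSpace Gs] [ChartedSpace F Gs] [Group Gs] [LieGroup 𝓘(ℝ, F) ∞ Gs]
  {πG : PoissonStructure E G} {πGs : PoissonStructure F Gs}

/-- The derivative of `π_G♯` at the identity is the bracket of `Lie Gs`. Here `ψ'` is `ψ` with both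
Lie algebras regarded as model spaces. -/
lemma IsDualPair.apply_rdiff_rightSharp
    {ψ : GroupLieAlgebra 𝓘(ℝ, F) Gs ≃L[ℝ] (GroupLieAlgebra 𝓘(ℝ, E) G →L[ℝ] ℝ)}
    (hψ : IsDualPair πG πGs ψ) (ψ' : F ≃L[ℝ] (E →L[ℝ] ℝ)) (hψ' : ψ' = ψ)
    (hG : πG.IsMultiplicative) (ξ₁ ξ₂ : F) (X : E) :
    ψ' ξ₁ (rdiff E πG.rightSharp 1 X (ψ' ξ₂)) = ψ' (groupBracket Gs ξ₁ ξ₂) X := by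
  obtain ⟨f₁, hf₁, h₁⟩ := exists_smooth_rdiff_one_eq G (ψ' ξ₁)
  obtain ⟨f₂, hf₂, h₂⟩ := exists_smooth_rdiff_one_eq G (ψ' ξ₂)
  subst hψ'
  have h := hψ.linearization ξ₁ ξ₂ f₁ f₂ hf₁ hf₂
    ((mfderiv_one_eq_fderiv hf₁.contMDiffAt).trans h₁)
    ((mfderiv_one_eq_fderiv hf₂.contMDiffAt).trans h₂)
  have h3 : diff E (πG.bracket f₁ f₂) 1 = rdiff E (πG.bracket f₁ f₂) 1 :=
    mfderiv_one_eq_fderiv (contMDiff_bracket hf₁ hf₂).contMDiffAt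
  have h4 := rdiff_bracket_one hG hf₁ hf₂ X
  rw [h₁, h₂] at h4
  exact h4.symm.trans ((DFunLike.congr_fun h3 X).symm.trans (DFunLike.congr_fun h X))

/-- The derivative of `π_{Gs}♯` at the identity is the bracket of `Lie G`, where the elements of
`Lie G` are covectors on `Lie Gs` through `ψ'`. -/
lemma IsDualPair.apply_rdiff_rightSharp_dual
    {ψ : GroupLieAlgebra 𝓘(ℝ, F) Gs ≃L[ℝ] (GroupLieAlgebra 𝓘(ℝ, E) G →L[ℝ] ℝ)}
    (hψ : IsDualPair πG πGs ψ) (ψ' : F ≃L[ℝ] (E →L[ℝ] ℝ)) (hψ' : ψ' = ψ)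
    (hGs : πGs.IsMultiplicative) (X₁ X₂ : E) (ξ : F) :
    ψ' (rdiff F πGs.rightSharp 1 ξ (ψ'.toContinuousLinearMap.flip X₂)) X₁ =
      ψ' ξ (groupBracket G X₁ X₂) := by
  obtain ⟨f₁, hf₁, h₁⟩ := exists_smooth_rdiff_one_eq Gs (ψ'.toContinuousLinearMap.flip X₁)
  obtain ⟨f₂, hf₂, h₂⟩ := exists_smooth_rdiff_one_eq Gs (ψ'.toContinuousLinearMap.flip X₂)
  subst hψ'
  have e₁ := (mfderiv_one_eq_fderiv hf₁.contMDiffAt).trans h₁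
  have e₂ := (mfderiv_one_eq_fderiv hf₂.contMDiffAt).trans h₂
  have h := hψ.linearization_dual X₁ X₂ f₁ f₂ hf₁ hf₂
    (fun ξ => DFunLike.congr_fun e₁ ξ) (fun ξ => DFunLike.congr_fun e₂ ξ) ξ
  have h3 : diff F (πGs.bracket f₁ f₂) 1 = rdiff F (πGs.bracket f₁ f₂) 1 :=
    mfderiv_one_eq_fderiv (contMDiff_bracket hf₁ hf₂).contMDiffAt
  have h4 := rdiff_bracket_one hGs hf₁ hf₂ ξ
  rw [h₁, h₂] at h4
  exact h4.symm.trans ((DFunLike.congr_fun h3 ξ).symm.trans h)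

end Duality

/-! ### Poisson Lie subgroups and their annihilators -/

section Subgroup

variable {E EH : Type*} [NormedAddCommGroup E] [NormedSpace ℝ E] [FiniteDimensional ℝ E]
  [NormedAddCommGroup EH] [NormedSpace ℝ EH] [FiniteDimensional ℝ EH]
  {G : Type*} [TopologicalSpace G] [ChartedSpace E G] [Group G] [LieGroup 𝓘(ℝ, E) ∞ G]
  {H : Type*} [TopologicalSpace H] [ChartedSpace EH H] [Group H] [LieGroup 𝓘(ℝ, EH) ∞ H]
  {πG : PoissonStructure E G} {πH : PoissonStructure EH H}

lemma PoissonStructure.IsPoissonMap.bracket_comp {ι : H → G} (hι : πH.IsPoissonMap πG ι)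
    {f₁ f₂ : G → ℝ} (h₁ : ContMDiff 𝓘(ℝ, E) 𝓘(ℝ, ℝ) ∞ f₁)
    (h₂ : ContMDiff 𝓘(ℝ, E) 𝓘(ℝ, ℝ) ∞ f₂) (h : H) :
    πG.bracket f₁ f₂ (ι h) = πH.bracket (f₁ ∘ ι) (f₂ ∘ ι) h := by
  have e : ∀ f : G → ℝ, ContMDiff 𝓘(ℝ, E) 𝓘(ℝ, ℝ) ∞ f →
      diff EH (f ∘ ι) h = (diff E f (ι h)).comp (mfderiv 𝓘(ℝ, EH) 𝓘(ℝ, E) ι h) := fun f hf =>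
    mfderiv_comp h (hf.contMDiffAt.mdifferentiableAt (by simp))
      (hι.1.contMDiffAt.mdifferentiableAt (by simp))
  rw [PoissonStructure.bracket, PoissonStructure.bracket, e f₁ h₁, e f₂ h₂, hι.2]
  rfl

/-- The derivative at the identity of the bivector field of `G`, along a Poisson Lie subgroup `H`,
vanishes on pairs of covectors one of which annihilates `Lie H`. -/
lemma rdiff_rightSharp_eq_zero_of_isPoissonMap (hG : πG.IsMultiplicative)
    (hH : πH.IsMultiplicative) {ι : H →* G} (hι : πH.IsPoissonMap πG ι) {α β : E →L[ℝ] ℝ}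
    (hα : α ∘L unitDeriv EH E ι = 0) (X : EH) :
    α (rdiff E πG.rightSharp 1 (unitDeriv EH E ι X) β) = 0 := by
  obtain ⟨f₁, hf₁, h₁⟩ := exists_smooth_rdiff_one_eq G α
  obtain ⟨f₂, hf₂, h₂⟩ := exists_smooth_rdiff_one_eq G β
  have h3 := rdiff_bracket_one hG hf₁ hf₂ (unitDeriv EH E ι X)
  rw [h₁, h₂] at h3
  rw [← h3]
  have h4 := rdiff_comp_hom (j := ι) hι.1 (contMDiff_bracket (π := πG) hf₁ hf₂) 1
  rw [map_one] at h4
  have h5 := DFunLike.congr_fun h4 X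
  rw [ContinuousLinearMap.comp_apply] at h5
  rw [← h5, funext (hι.bracket_comp hf₁ hf₂)]
  have h6 : rdiff EH (f₁ ∘ ι) 1 = 0 := by
    have := rdiff_comp_hom (j := ι) hι.1 hf₁ 1
    rw [map_one, h₁, hα] at this
    exact this
  refine (rdiff_bracket_one hH (hf₁.comp hι.1) (hf₂.comp hι.1) X).trans ?_
  rw [h6]
  rfl

/-- `π♯` maps the covectors that annihilate the tangent spaces of a Poisson Lie subgroup to zero. -/
lemma sharp_comp_leftTriv_eq_zero {ι : H →* G} (hι : πH.IsPoissonMap πG ι) {α : E →L[ℝ] ℝ}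
    (hα : α ∘L unitDeriv EH E ι = 0) (h : H) :
    πG.sharp (ι h) (α ∘L (leftTriv E (ι h) : E →L[ℝ] E)) = 0 := by
  have hl : ∀ g : G, ContMDiff 𝓘(ℝ, E) 𝓘(ℝ, E) ∞ (fun x : G => g * x) := contMDiff_mul_left'
  have hl' : ∀ g : H, ContMDiff 𝓘(ℝ, EH) 𝓘(ℝ, EH) ∞ (fun x : H => g * x) := fun g =>
    contMDiff_const.mul contMDiff_id
  have h1 := mfderiv_comp (I := 𝓘(ℝ, EH)) (I' := 𝓘(ℝ, E)) (I'' := 𝓘(ℝ, E)) h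
    (g := fun x : G => (ι h)⁻¹ * x) (f := ι)
    ((hl _).contMDiffAt.mdifferentiableAt (by simp))
    (hι.1.contMDiffAt.mdifferentiableAt (by simp))
  have h2 := mfderiv_comp (I := 𝓘(ℝ, EH)) (I' := 𝓘(ℝ, EH)) (I'' := 𝓘(ℝ, E)) h
    (g := ι) (f := fun x : H => h⁻¹ * x)
    (hι.1.contMDiffAt.mdifferentiableAt (by simp))
    ((hl' _).contMDiffAt.mdifferentiableAt (by simp))
  have h3 : (fun x : G => (ι h)⁻¹ * x) ∘ ι = ι ∘ fun x : H => h⁻¹ * x := by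
    funext x
    simp
  rw [h3] at h1
  have h4 : (mfderiv 𝓘(ℝ, EH) 𝓘(ℝ, E) ι (h⁻¹ * h) : EH →L[ℝ] E) = unitDeriv EH E ι := by
    rw [inv_mul_cancel]
    exact mfderiv_one_eq_unitDeriv hι.1.contMDiffAt (map_one ι)
  have h5 : (leftTriv E (ι h) : E →L[ℝ] E) ∘L (mfderiv 𝓘(ℝ, EH) 𝓘(ℝ, E) ι h : EH →L[ℝ] E) =
      unitDeriv EH E ι ∘L (leftTriv EH h : EH →L[ℝ] EH) := by
    rw [← h4]
    exact h1.symm.trans h2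
  have h6 : (α ∘L (leftTriv E (ι h) : E →L[ℝ] E)) ∘L
      (mfderiv 𝓘(ℝ, EH) 𝓘(ℝ, E) ι h : EH →L[ℝ] E) = 0 := by
    refine (congrArg (fun L : EH →L[ℝ] E => α ∘L L) h5).trans ?_
    exact congrArg (fun L : EH →L[ℝ] ℝ => L ∘L (leftTriv EH h : EH →L[ℝ] EH)) hα
  refine (hι.2 h _).trans ?_
  refine (congrArg (fun L : EH →L[ℝ] ℝ => (mfderiv 𝓘(ℝ, EH) 𝓘(ℝ, E) ι h : EH →L[ℝ] E)
    (πH.sharp h L)) h6).trans ?_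
  change (mfderiv 𝓘(ℝ, EH) 𝓘(ℝ, E) ι h : EH →L[ℝ] E) (πH.sharp h 0) = 0
  rw [map_zero]
  exact map_zero (mfderiv 𝓘(ℝ, EH) 𝓘(ℝ, E) ι h : EH →L[ℝ] E)

end Subgroup

/-! ### The dressing cocycle and the coadjoint representation -/

section Dressing

variable {E F EH EK : Type*}
  [NormedAddCommGroup E] [NormedSpace ℝ E] [FiniteDimensional ℝ E]
  [NormedAddCommGroup F] [NormedSpace ℝ F] [FiniteDimensional ℝ F]
  [NormedAddCommGroup EH] [NormedSpace ℝ EH] [FiniteDimensional ℝ EH]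
  [NormedAddCommGroup EK] [NormedSpace ℝ EK] [FiniteDimensional ℝ EK]
  {G : Type*} [TopologicalSpace G] [ChartedSpace E G] [Group G] [LieGroup 𝓘(ℝ, E) ∞ G]
  {Gs : Type*} [TopologicalSpace Gs] [ChartedSpace F Gs] [Group Gs] [LieGroup 𝓘(ℝ, F) ∞ Gs]
  {H : Type*} [TopologicalSpace H] [ChartedSpace EH H] [Group H] [LieGroup 𝓘(ℝ, EH) ∞ H]
  {K : Type*} [TopologicalSpace K] [ChartedSpace EK K] [Group K] [LieGroup 𝓘(ℝ, EK) ∞ K]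
  {ψ : F ≃L[ℝ] (E →L[ℝ] ℝ)} {ι : H →* G} {j : K →* Gs}

/-- If `Lie K` pairs to zero with `Lie H` after bracketing with anything, the covectors on
`Lie Gs` given by `Lie H` are invariant under the coadjoint action of `K`. -/
lemma flip_comp_Ad_eq [ConnectedSpace K] (hj : ContMDiff 𝓘(ℝ, EK) 𝓘(ℝ, F) ∞ j)
    (hideal : ∀ (ξ : EK) (η : F) (X : EH),
      ψ (groupBracket Gs (unitDeriv EK F j ξ) η) (unitDeriv EH E ι X) = 0) (X : EH) (γ : K) :
    ψ.toContinuousLinearMap.flip (unitDeriv EH E ι X) ∘L Ad F (j γ) =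
      ψ.toContinuousLinearMap.flip (unitDeriv EH E ι X) := by
  have : CompleteSpace F := FiniteDimensional.complete ℝ F
  set α := ψ.toContinuousLinearMap.flip (unitDeriv EH E ι X) with hα
  have hrep := Ad_comp_isSmoothRep hj
  have hsm : ContMDiff 𝓘(ℝ, EK) 𝓘(ℝ, F →L[ℝ] ℝ) ∞ (fun γ => α ∘L Ad F (j γ)) :=
    contMDiff_const.clm_comp hrep.smooth
  have h := eq_of_rdiff_eq_zero hsm (fun γ => ?_) γ
  · simpa [Ad_one] using h
  · have h1 := (hasFDerivAt_const α (0 : EK)).clm_comp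
      (hasFDerivAt_rdiff (hrep.smooth.contMDiffAt (x := γ)))
    rw [rdiff, h1.fderiv]
    ext ξ η
    have h2 : rdiff EK (fun g => Ad F (j g)) γ ξ η =
        groupBracket Gs (unitDeriv EK F j ξ) (Ad F (j γ) η) := by
      rw [hrep.rdiff_eq γ, rdiff_comp_hom hj contMDiff_Ad, map_one, ← rdiff_Ad_one]
      rfl
    simp [h2, hα, hideal]

variable {πGs : PoissonStructure F Gs}

/-- The dressing vector fields of `Lie H` on `Gs` are tangent to `K`; in the right trivialization
they form a cocycle on `K`. -/
lemma exists_dressing_cocycle [ConnectedSpace K] (hGs : πGs.IsMultiplicative)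
    (hj : ContMDiff 𝓘(ℝ, EK) 𝓘(ℝ, F) ∞ j) (hι : ContMDiff 𝓘(ℝ, EH) 𝓘(ℝ, E) ∞ ι)
    (hinj : Function.Injective (unitDeriv EK F j))
    (hrange : ∀ ξ : F, ξ ∈ range (unitDeriv EK F j) ↔ ∀ X : EH, ψ ξ (unitDeriv EH E ι X) = 0)
    (hdual : ∀ (X₁ X₂ : E) (ξ : F),
      ψ (rdiff F πGs.rightSharp 1 ξ (ψ.toContinuousLinearMap.flip X₂)) X₁ =
        ψ ξ (groupBracket G X₁ X₂))
    (hideal : ∀ (ξ : EK) (η : F) (X : EH),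
      ψ (groupBracket Gs (unitDeriv EK F j ξ) η) (unitDeriv EH E ι X) = 0) :
    ∃ V : K → EH →L[ℝ] EK, IsSmoothCocycle V ∧
      (∀ γ X, unitDeriv EK F j (V γ X) =
        πGs.rightSharp (j γ) (ψ.toContinuousLinearMap.flip (unitDeriv EH E ι X))) ∧
      ∀ ξ X Y, ψ (unitDeriv EK F j (rdiff EK V 1 ξ X)) Y =
        ψ (unitDeriv EK F j ξ) (groupBracket G Y (unitDeriv EH E ι X)) := by
  have : CompleteSpace E := FiniteDimensional.complete ℝ E
  have : CompleteSpace EH := FiniteDimensional.complete ℝ EH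
  have h_sharp : ContMDiff 𝓘(ℝ, EK) 𝓘(ℝ, (F →L[ℝ] ℝ) →L[ℝ] F) ∞
      (fun γ : K => πGs.rightSharp (j γ)) :=
    (contMDiff_rightSharp hGs).comp hj
  set cov : EH →L[ℝ] (F →L[ℝ] ℝ) := ψ.toContinuousLinearMap.flip ∘L unitDeriv EH E ι with hcov
  have hcovAd : ∀ X γ, cov X ∘L Ad F (j γ) = cov X := flip_comp_Ad_eq hj hideal
  have hcoc : ∀ γ₁ γ₂ X, πGs.rightSharp (j (γ₁ * γ₂)) (cov X) =
      πGs.rightSharp (j γ₁) (cov X) + Ad F (j γ₁) (πGs.rightSharp (j γ₂) (cov X)) := by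
    intro γ₁ γ₂ X
    rw [map_mul, rightSharp_mul hGs, hcovAd]
  have hderiv : ∀ ξ, rdiff EK (fun γ : K => πGs.rightSharp (j γ)) 1 ξ =
      rdiff F πGs.rightSharp 1 (unitDeriv EK F j ξ) := by
    intro ξ
    rw [rdiff_comp_hom hj (contMDiff_rightSharp hGs), map_one]
    rfl
  -- the fields are tangent to `K`: a covector from `Lie H` pairs with them to a homomorphism
  -- into `ℝ` whose differential vanishes
  have htan : ∀ γ X, πGs.rightSharp (j γ) (cov X) ∈ range (unitDeriv EK F j) := by
    intro γ X
    rw [hrange]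
    intro Y
    set p : K → ℝ := fun γ => cov Y (πGs.rightSharp (j γ) (cov X)) with hp
    have hpsm : ContMDiff 𝓘(ℝ, EK) 𝓘(ℝ, ℝ) ∞ p :=
      contMDiff_const.clm_apply (h_sharp.clm_apply contMDiff_const)
    have hpmul : ∀ γ₁ γ₂, p (γ₁ * γ₂) = p γ₁ + p γ₂ := by
      intro γ₁ γ₂
      have h1 := DFunLike.congr_fun (hcovAd Y γ₁) (πGs.rightSharp (j γ₂) (cov X))
      rw [ContinuousLinearMap.comp_apply] at h1
      simp only [hp, hcoc, map_add, h1]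
    have hp1 : rdiff EK p 1 = 0 := by
      have h1 := (hasFDerivAt_const (cov Y) (0 : EK)).clm_apply
        ((hasFDerivAt_rdiff (h_sharp.contMDiffAt (x := 1))).clm_apply
          (hasFDerivAt_const (cov X) (0 : EK)))
      rw [rdiff, h1.fderiv]
      ext ξ
      have h2 := hdual (unitDeriv EH E ι Y) (unitDeriv EH E ι X) (unitDeriv EK F j ξ)
      rw [← unitDeriv_groupBracket hι, (hrange _).1 ⟨ξ, rfl⟩] at h2
      simpa [hderiv, hcov] using h2
    have h := eq_of_rdiff_eq_zero hpsm (fun γ => ?_) γ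
    · have h2 : p 1 = 0 := by simp [hp, rightSharp_one hGs]
      rw [h2] at h
      exact h
    · have h3 : (fun z : EK => p (uncoord K z * γ)) = fun z => p (uncoord K z * 1) + p γ := by
        funext z
        rw [hpmul, mul_one]
      rw [rdiff, h3, fderiv_add_const]
      exact hp1
  obtain ⟨P, hP⟩ := (unitDeriv EK F j).toLinearMap.exists_leftInverse_of_injective
    (LinearMap.ker_eq_bot.2 hinj)
  -- a linear left inverse of `Lie K → Lie Gs` gives the smoothness of `V`
  set Q : F →L[ℝ] EK := LinearMap.toContinuousLinearMap P
  have hQ : ∀ ξ, Q (unitDeriv EK F j ξ) = ξ := fun ξ => LinearMap.congr_fun hP ξ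
  have hQ' : ∀ η ∈ range (unitDeriv EK F j), unitDeriv EK F j (Q η) = η := by
    rintro _ ⟨ξ, rfl⟩
    rw [hQ]
  set V : K → EH →L[ℝ] EK := fun γ => Q ∘L πGs.rightSharp (j γ) ∘L cov with hV
  have hjV : ∀ γ X, unitDeriv EK F j (V γ X) = πGs.rightSharp (j γ) (cov X) := fun γ X =>
    hQ' _ (htan γ X)
  have hVsm : ContMDiff 𝓘(ℝ, EK) 𝓘(ℝ, EH →L[ℝ] EK) ∞ V :=
    contMDiff_const.clm_comp (h_sharp.clm_comp contMDiff_const)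
  refine ⟨V, ⟨hVsm, fun γ₁ γ₂ => ?_⟩, hjV, fun ξ X Y => ?_⟩
  · ext X
    apply hinj
    have h1 := DFunLike.congr_fun (unitDeriv_Ad j hj γ₁) (V γ₂ X)
    have h5 : unitDeriv EK F j ((Ad EK γ₁ ∘L V γ₂) X) =
        Ad F (j γ₁) (unitDeriv EK F j (V γ₂ X)) := h1
    rw [hjV, hcoc, add_apply, map_add, h5, hjV, hjV]
  · have h1 := (hasFDerivAt_const (unitDeriv EK F j) (0 : EK)).clm_comp
      (hasFDerivAt_rdiff (hVsm.contMDiffAt (x := 1)))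
    have h2 := (hasFDerivAt_rdiff (h_sharp.contMDiffAt (x := 1))).clm_comp
      (hasFDerivAt_const cov (0 : EK))
    have h3 : (fun z : EK => unitDeriv EK F j ∘L V (uncoord K z * 1)) =
        fun z => πGs.rightSharp (j (uncoord K z * 1)) ∘L cov := by
      funext z
      ext1 X
      exact hjV _ X
    rw [h3] at h1
    have h4 := DFunLike.congr_fun (DFunLike.congr_fun (h1.unique h2) ξ) X
    simp [hderiv] at h4
    rw [h4, ← hdual]
    rfl

/-- The coadjoint action of `H` on `Lie Gs`, identified with the dual of `Lie G`, preserves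
`Lie K`. -/
lemma exists_coadjoint_rep (hι : ContMDiff 𝓘(ℝ, EH) 𝓘(ℝ, E) ∞ ι)
    (hinj : Function.Injective (unitDeriv EK F j))
    (hrange : ∀ ξ : F, ξ ∈ range (unitDeriv EK F j) ↔ ∀ X : EH, ψ ξ (unitDeriv EH E ι X) = 0) :
    ∃ A : H → EK →L[ℝ] EK, IsSmoothRep EH A ∧
      ∀ h ξ, ψ (unitDeriv EK F j (A h ξ)) = ψ (unitDeriv EK F j ξ) ∘L Ad E (ι h⁻¹) := by
  obtain ⟨P, hP⟩ := (unitDeriv EK F j).toLinearMap.exists_leftInverse_of_injective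
    (LinearMap.ker_eq_bot.2 hinj)
  set Q : F →L[ℝ] EK := LinearMap.toContinuousLinearMap P
  have hQ : ∀ ξ, Q (unitDeriv EK F j ξ) = ξ := fun ξ => LinearMap.congr_fun hP ξ
  have hQ' : ∀ η ∈ range (unitDeriv EK F j), unitDeriv EK F j (Q η) = η := by
    rintro _ ⟨ξ, rfl⟩
    rw [hQ]
  set A : H → EK →L[ℝ] EK := fun h => (Q ∘L ψ.symm.toContinuousLinearMap) ∘L
    ((ContinuousLinearMap.compL ℝ E E ℝ).flip (Ad E (ι h⁻¹))) ∘L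
      (ψ.toContinuousLinearMap ∘L unitDeriv EK F j) with hA
  have hjA : ∀ h ξ, ψ (unitDeriv EK F j (A h ξ)) =
      ψ (unitDeriv EK F j ξ) ∘L Ad E (ι h⁻¹) := by
    intro h ξ
    have h1 : ψ.symm (ψ (unitDeriv EK F j ξ) ∘L Ad E (ι h⁻¹)) ∈ range (unitDeriv EK F j) := by
      rw [hrange]
      intro X
      have h2 := DFunLike.congr_fun (unitDeriv_Ad ι hι h⁻¹) X
      simp only [ContinuousLinearMap.comp_apply] at h2
      rw [ψ.apply_symm_apply, ContinuousLinearMap.comp_apply, ← h2]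
      exact (hrange _).1 ⟨ξ, rfl⟩ _
    have h3 : unitDeriv EK F j (A h ξ) = ψ.symm (ψ (unitDeriv EK F j ξ) ∘L Ad E (ι h⁻¹)) :=
      hQ' _ h1
    rw [h3, ψ.apply_symm_apply]
  have hψj : Function.Injective fun ξ => ψ (unitDeriv EK F j ξ) := ψ.injective.comp hinj
  refine ⟨A, ⟨?_, ?_, fun g h => ?_⟩, hjA⟩
  · have h1 : ContMDiff 𝓘(ℝ, EH) 𝓘(ℝ, E →L[ℝ] E) ∞ (fun h : H => Ad E (ι h⁻¹)) :=
      (contMDiff_Ad.comp hι).comp (contMDiff_id.inv)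
    have h2 : ContMDiff 𝓘(ℝ, EH) 𝓘(ℝ, (E →L[ℝ] ℝ) →L[ℝ] (E →L[ℝ] ℝ)) ∞
        (fun h : H => (ContinuousLinearMap.compL ℝ E E ℝ).flip (Ad E (ι h⁻¹))) :=
      (ContinuousLinearMap.contDiff _).contMDiff.comp h1
    exact contMDiff_const.clm_comp (h2.clm_comp contMDiff_const)
  · ext1 ξ
    apply hψj
    simp only [hjA, inv_one, map_one, Ad_one]
    rfl
  · ext1 ξ
    apply hψj
    simp only [hjA, mul_inv_rev, map_mul, Ad_mul, ContinuousLinearMap.comp_apply]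
    rfl

/-- The infinitesimal coadjoint action of `Lie H` on `Lie K`; the right-hand side is the same as for
the linearization of the dressing cocycle. -/
lemma rdiff_coadjoint_rep (hι : ContMDiff 𝓘(ℝ, EH) 𝓘(ℝ, E) ∞ ι)
    {A : H → EK →L[ℝ] EK} (hA : IsSmoothRep EH A)
    (hjA : ∀ h ξ, ψ (unitDeriv EK F j (A h ξ)) = ψ (unitDeriv EK F j ξ) ∘L Ad E (ι h⁻¹))
    (X : EH) (ξ : EK) (Y : E) :
    ψ (unitDeriv EK F j (rdiff EH A 1 X ξ)) Y =
      ψ (unitDeriv EK F j ξ) (groupBracket G Y (unitDeriv EH E ι X)) := by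
  have : CompleteSpace E := FiniteDimensional.complete ℝ E
  -- `⟨A h ξ, Ad h Y⟩ = ⟨ξ, Y⟩` is differentiated at the identity
  have hrep := Ad_comp_isSmoothRep hι
  have h1 := (hasFDerivAt_rdiff (hA.smooth.contMDiffAt (x := 1))).clm_apply
    (hasFDerivAt_const ξ (0 : EH))
  have h2 := (hasFDerivAt_const (ψ.toContinuousLinearMap ∘L unitDeriv EK F j)
    (0 : EH)).clm_apply h1
  have h3 := (hasFDerivAt_rdiff (hrep.smooth.contMDiffAt (x := 1))).clm_apply
    (hasFDerivAt_const Y (0 : EH))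
  have h4 := h2.clm_apply h3
  have h5 : ∀ h : H, ψ (unitDeriv EK F j (A h ξ)) (Ad E (ι h) Y) = ψ (unitDeriv EK F j ξ) Y := by
    intro h
    have h0 := DFunLike.congr_fun (hrep.map_mul h⁻¹ h) Y
    simp only [inv_mul_cancel, hrep.map_one, ContinuousLinearMap.comp_apply,
      ContinuousLinearMap.id_apply] at h0
    rw [hjA, ContinuousLinearMap.comp_apply, ← h0]
  have h6 := h4.unique ((hasFDerivAt_const (ψ (unitDeriv EK F j ξ) Y)
    (0 : EH)).congr_of_eventuallyEq (Eventually.of_forall fun z => h5 _))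
  have h7 := DFunLike.congr_fun h6 X
  simp [hA.map_one, Ad_one, rdiff_comp_hom hι contMDiff_Ad, rdiff_Ad_one] at h7
  rw [groupBracket_swap, map_neg]
  linarith

end Dressing

/-! ### The double Lie group of a matched pair -/

namespace MatchedPair

variable {EH EK : Type*} [NormedAddCommGroup EH] [NormedSpace ℝ EH]
  [NormedAddCommGroup EK] [NormedSpace ℝ EK]
  {H : Type*} [TopologicalSpace H] [ChartedSpace EH H] [Group H]
  {K : Type*} [TopologicalSpace K] [ChartedSpace EK K] [Group K]

/-- The double group of a matched pair: the pair `(h, γ)` stands for the product `γ h`. -/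
def Double (_ : MatchedPair EH EK H K) : Type _ := H × K

variable (P : MatchedPair EH EK H K)

lemma left_apply_one (h : H) : P.left h 1 = 1 := by
  have := P.mul_left h 1 1
  rw [P.right_one, one_mul] at this
  exact left_eq_mul.1 this

lemma right_one_apply (γ : K) : P.right 1 γ = 1 := by
  have := P.mul_right 1 1 γ
  rw [P.left_one, one_mul] at this
  exact left_eq_mul.1 this

instance : TopologicalSpace P.Double := inferInstanceAs (TopologicalSpace (H × K))

instance : ChartedSpace (ModelProd EH EK) P.Double :=
  inferInstanceAs (ChartedSpace (ModelProd EH EK) (H × K))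

/-- The product `γ₁ h₁ γ₂ h₂ = γ₁ (ʰ¹γ₂) (h₁^γ₂) h₂`. -/
instance : Group P.Double where
  mul d e := ((P.right d.1 e.2 * e.1, d.2 * P.left d.1 e.2) : H × K)
  one := ((1, 1) : H × K)
  inv d := ((P.right d.1⁻¹ d.2⁻¹, P.left d.1⁻¹ d.2⁻¹) : H × K)
  mul_assoc a b c := by
    refine Prod.ext ?_ ?_
    · change P.right (P.right a.1 b.2 * b.1) c.2 * c.1 =
        P.right a.1 (b.2 * P.left b.1 c.2) * (P.right b.1 c.2 * c.1)
      rw [P.mul_right, P.right_mul, mul_assoc]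
    · change a.2 * P.left a.1 b.2 * P.left (P.right a.1 b.2 * b.1) c.2 =
        a.2 * P.left a.1 (b.2 * P.left b.1 c.2)
      rw [P.mul_left, P.left_mul, mul_assoc]
  one_mul d := by
    refine Prod.ext ?_ ?_
    · change P.right 1 d.2 * d.1 = d.1
      rw [P.right_one_apply, one_mul]
    · change 1 * P.left 1 d.2 = d.2
      rw [P.left_one, one_mul]
  mul_one d := by
    refine Prod.ext ?_ ?_
    · change P.right d.1 1 * 1 = d.1
      rw [P.right_one, mul_one]
    · change d.2 * P.left d.1 1 = d.2
      rw [P.left_apply_one, mul_one]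
  inv_mul_cancel d := by
    refine Prod.ext ?_ ?_
    · change P.right (P.right d.1⁻¹ d.2⁻¹) d.2 * d.1 = 1
      rw [← P.right_mul, inv_mul_cancel, P.right_one, inv_mul_cancel]
    · change P.left d.1⁻¹ d.2⁻¹ * P.left (P.right d.1⁻¹ d.2⁻¹) d.2 = 1
      rw [← P.mul_left, inv_mul_cancel, P.left_apply_one]

/-- The inclusion of `H` in the double group. -/
def inclLeft : H →* P.Double where
  toFun h := ((h, 1) : H × K)
  map_one' := rfl
  map_mul' h₁ h₂ := by
    refine Prod.ext ?_ ?_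
    · change h₁ * h₂ = P.right h₁ 1 * h₂
      rw [P.right_one]
    · change (1 : K) = 1 * P.left h₁ 1
      rw [P.left_apply_one, one_mul]

/-- The inclusion of `K` in the double group. -/
def inclRight : K →* P.Double where
  toFun γ := ((1, γ) : H × K)
  map_one' := rfl
  map_mul' γ₁ γ₂ := by
    refine Prod.ext ?_ ?_
    · change (1 : H) = P.right 1 γ₂ * 1
      rw [P.right_one_apply, one_mul]
    · change γ₁ * γ₂ = γ₁ * P.left 1 γ₂
      rw [P.left_one]

lemma inclRight_mul_inclLeft (h : H) (γ : K) :
    P.inclRight γ * P.inclLeft h = ((h, γ) : H × K) := by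
  refine Prod.ext ?_ ?_
  · change P.right 1 1 * h = h
    rw [P.right_one, one_mul]
  · change γ * P.left 1 1 = γ
    rw [P.left_one, mul_one]

lemma inclLeft_mul_inclRight (h : H) (γ : K) :
    P.inclLeft h * P.inclRight γ = ((P.right h γ, P.left h γ) : H × K) := by
  refine Prod.ext ?_ ?_
  · change P.right h γ * 1 = _
    rw [mul_one]
  · change 1 * P.left h γ = _
    rw [one_mul]

variable [LieGroup 𝓘(ℝ, EH) ∞ H] [LieGroup 𝓘(ℝ, EK) ∞ K]

instance : LieGroup (𝓘(ℝ, EH).prod 𝓘(ℝ, EK)) ∞ P.Double :=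
  have hm : IsManifold (𝓘(ℝ, EH).prod 𝓘(ℝ, EK)) ∞ P.Double :=
    inferInstanceAs (IsManifold (𝓘(ℝ, EH).prod 𝓘(ℝ, EK)) ∞ (H × K))
  have hmul : ContMDiff ((𝓘(ℝ, EH).prod 𝓘(ℝ, EK)).prod (𝓘(ℝ, EH).prod 𝓘(ℝ, EK)))
      (𝓘(ℝ, EH).prod 𝓘(ℝ, EK)) ∞ (fun p : (H × K) × (H × K) =>
        (P.right p.1.1 p.2.2 * p.2.1, p.1.2 * P.left p.1.1 p.2.2)) := by
    have h1 : ContMDiff ((𝓘(ℝ, EH).prod 𝓘(ℝ, EK)).prod (𝓘(ℝ, EH).prod 𝓘(ℝ, EK)))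
        (𝓘(ℝ, EH).prod 𝓘(ℝ, EK)) ∞ (fun p : (H × K) × (H × K) => (p.1.1, p.2.2)) :=
      (contMDiff_fst.comp contMDiff_fst).prodMk (contMDiff_snd.comp contMDiff_snd)
    exact ((P.smooth_right.comp h1).mul (contMDiff_fst.comp contMDiff_snd)).prodMk
      ((contMDiff_snd.comp contMDiff_fst).mul (P.smooth_left.comp h1))
  have hinv : ContMDiff (𝓘(ℝ, EH).prod 𝓘(ℝ, EK)) (𝓘(ℝ, EH).prod 𝓘(ℝ, EK)) ∞
      (fun p : H × K => (P.right p.1⁻¹ p.2⁻¹, P.left p.1⁻¹ p.2⁻¹)) := by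
    have h1 : ContMDiff (𝓘(ℝ, EH).prod 𝓘(ℝ, EK)) (𝓘(ℝ, EH).prod 𝓘(ℝ, EK)) ∞
        (fun p : H × K => (p.1⁻¹, p.2⁻¹)) := contMDiff_fst.inv.prodMk contMDiff_snd.inv
    exact (P.smooth_right.comp h1).prodMk (P.smooth_left.comp h1)
  { hm with
    contMDiff_mul := hmul
    contMDiff_inv := hinv }

lemma contMDiff_inv_prod : ContMDiff (𝓘(ℝ, EH).prod 𝓘(ℝ, EK)) (𝓘(ℝ, EH).prod 𝓘(ℝ, EK)) ∞
    (fun p : H × K => (p.1⁻¹, p.2⁻¹)) := contMDiff_fst.inv.prodMk contMDiff_snd.inv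

/-- Every matched pair of Lie groups has a double Lie group. -/
theorem isDoubleLieGroup : IsDoubleLieGroup P P.inclLeft P.inclRight where
  left_subgroup :=
    { smooth := (contMDiff_id.prodMk contMDiff_const :
        ContMDiff 𝓘(ℝ, EH) (𝓘(ℝ, EH).prod 𝓘(ℝ, EK)) ∞ (fun h : H => (h, (1 : K))))
      immersion := fun h => by
        have h1 := mfderiv_comp (I := 𝓘(ℝ, EH)) (I' := 𝓘(ℝ, EH).prod 𝓘(ℝ, EK))
          (I'' := 𝓘(ℝ, EH)) h (g := fun p : H × K => p.1) (f := fun h : H => (h, (1 : K)))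
          mdifferentiableAt_fst (mdifferentiableAt_id.prodMk mdifferentiableAt_const)
        have h2 : (fun p : H × K => p.1) ∘ (fun h : H => (h, (1 : K))) = id := rfl
        rw [h2, mfderiv_id] at h1
        refine Function.LeftInverse.injective (g := mfderiv (𝓘(ℝ, EH).prod 𝓘(ℝ, EK)) 𝓘(ℝ, EH)
          (fun p : H × K => p.1) (h, (1 : K))) fun v => ?_
        exact (DFunLike.congr_fun h1 v).symm
      isClosedEmbedding := by
        have : T1Space K := ChartedSpace.t1Space EK K
        refine (⟨isEmbedding_prodMkLeft (1 : K), ?_⟩ :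
          Topology.IsClosedEmbedding (fun h : H => (h, (1 : K))))
        have h1 : range (fun h : H => (h, (1 : K))) = Prod.snd ⁻¹' {1} := by
          ext ⟨h, γ⟩
          simp [eq_comm]
        rw [h1]
        exact isClosed_singleton.preimage continuous_snd }
  right_subgroup :=
    { smooth := (contMDiff_const.prodMk contMDiff_id :
        ContMDiff 𝓘(ℝ, EK) (𝓘(ℝ, EH).prod 𝓘(ℝ, EK)) ∞ (fun γ : K => ((1 : H), γ)))
      immersion := fun γ => by
        have h1 := mfderiv_comp (I := 𝓘(ℝ, EK)) (I' := 𝓘(ℝ, EH).prod 𝓘(ℝ, EK))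
          (I'' := 𝓘(ℝ, EK)) γ (g := fun p : H × K => p.2) (f := fun γ : K => ((1 : H), γ))
          mdifferentiableAt_snd (mdifferentiableAt_const.prodMk mdifferentiableAt_id)
        have h2 : (fun p : H × K => p.2) ∘ (fun γ : K => ((1 : H), γ)) = id := rfl
        rw [h2, mfderiv_id] at h1
        refine Function.LeftInverse.injective (g := mfderiv (𝓘(ℝ, EH).prod 𝓘(ℝ, EK)) 𝓘(ℝ, EK)
          (fun p : H × K => p.2) ((1 : H), γ)) fun v => ?_
        exact (DFunLike.congr_fun h1 v).symm
      isClosedEmbedding := by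
        have : T1Space H := ChartedSpace.t1Space EH H
        refine (⟨isEmbedding_prodMkRight (1 : H), ?_⟩ :
          Topology.IsClosedEmbedding (fun γ : K => ((1 : H), γ)))
        have h1 : range (fun γ : K => ((1 : H), γ)) = Prod.fst ⁻¹' {1} := by
          ext ⟨h, γ⟩
          simp [eq_comm]
        rw [h1]
        exact isClosed_singleton.preimage continuous_fst }
  factorization := by
    -- `h γ = (γ⁻¹ h⁻¹)⁻¹`, so the factorization is the inversion of `H × K` followed by that of `D`
    -- `h γ = (γ⁻¹ h⁻¹)⁻¹`: the factorization is inversion in `H × K` followed by inversion in `D`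
    let s : H × K ≃ P.Double :=
      { toFun := fun p => ((p.1⁻¹, p.2⁻¹) : H × K)
        invFun := fun d => (d.1⁻¹, d.2⁻¹)
        left_inv := fun p => Prod.ext (inv_inv p.1) (inv_inv p.2)
        right_inv := fun d => Prod.ext (inv_inv d.1) (inv_inv d.2) }
    have hs : ∀ h γ, P.inclLeft h * P.inclRight γ = (s (h, γ))⁻¹ := fun h γ => by
      refine eq_inv_of_mul_eq_one_left ?_
      have h1 : s (h, γ) = P.inclRight γ⁻¹ * P.inclLeft h⁻¹ :=
        (P.inclRight_mul_inclLeft h⁻¹ γ⁻¹).symm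
      rw [h1, map_inv, map_inv]
      group
    exact ⟨⟨s.trans (Equiv.inv P.Double),
      (contMDiff_inv (𝓘(ℝ, EH).prod 𝓘(ℝ, EK)) ∞ (G := P.Double)).comp contMDiff_inv_prod,
      contMDiff_inv_prod.comp (contMDiff_inv (𝓘(ℝ, EH).prod 𝓘(ℝ, EK)) ∞ (G := P.Double))⟩,
      fun h γ => (hs h γ).symm⟩
  exchange h γ := by rw [inclLeft_mul_inclRight, inclRight_mul_inclLeft]

end MatchedPair

/-! ### The generators of the action -/

section Final

variable {EH EK : Type*} [NormedAddCommGroup EH] [NormedSpace ℝ EH]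
  [NormedAddCommGroup EK] [NormedSpace ℝ EK]
  {H : Type*} [TopologicalSpace H] [ChartedSpace EH H] [Group H]
  {K : Type*} [TopologicalSpace K] [ChartedSpace EK K] [Group K]

/-- An action by automorphisms gives a matched pair in which the right action is trivial; its
double group is the semidirect product. -/
def MatchedPair.ofAction (φ : H → K →* K) (h1 : ∀ γ, φ 1 γ = γ)
    (hmul : ∀ g h γ, φ (g * h) γ = φ g (φ h γ))
    (hφ : ContMDiff (𝓘(ℝ, EH).prod 𝓘(ℝ, EK)) 𝓘(ℝ, EK) ∞ (fun p : H × K => φ p.1 p.2)) :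
    MatchedPair EH EK H K where
  left h γ := φ h γ
  right h _ := h
  smooth_left := hφ
  smooth_right := contMDiff_fst
  left_one := h1
  left_mul := hmul
  right_one _ := rfl
  right_mul _ _ _ := rfl
  mul_right _ _ _ := rfl
  mul_left h γ₁ γ₂ := map_mul (φ h) γ₁ γ₂

variable {F : Type*} [NormedAddCommGroup F] [NormedSpace ℝ F]
  {Gs : Type*} [TopologicalSpace Gs] [ChartedSpace F Gs] [Group Gs] [LieGroup 𝓘(ℝ, F) ∞ Gs]

lemma rightTriv_injective (g : Gs) : Function.Injective (rightTriv F g : F →L[ℝ] F) := by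
  have h1 := mfderiv_comp (I := 𝓘(ℝ, F)) (I' := 𝓘(ℝ, F)) (I'' := 𝓘(ℝ, F)) g
    (g := fun x : Gs => x * g) (f := fun x : Gs => x * g⁻¹)
    ((contMDiff_mul_const (E := F) g).contMDiffAt.mdifferentiableAt (by simp))
    ((contMDiff_mul_const (E := F) g⁻¹).contMDiffAt.mdifferentiableAt (by simp))
  have h2 : (fun x : Gs => x * g) ∘ (fun x : Gs => x * g⁻¹) = id := by
    funext x
    simp
  rw [h2, mfderiv_id] at h1
  refine Function.LeftInverse.injective
    (g := (mfderiv 𝓘(ℝ, F) 𝓘(ℝ, F) (fun x : Gs => x * g) (g * g⁻¹) : F →L[ℝ] F)) fun v => ?_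
  exact (DFunLike.congr_fun h1 v).symm

variable [LieGroup 𝓘(ℝ, EH) ∞ H] [LieGroup 𝓘(ℝ, EK) ∞ K]

lemma rightTriv_comp_mfderiv_one {f : H → Gs} (hf : ContMDiff 𝓘(ℝ, EH) 𝓘(ℝ, F) ∞ f) {g : Gs}
    (hg : f 1 = g) :
    (rightTriv F g : F →L[ℝ] F) ∘L (mfderiv 𝓘(ℝ, EH) 𝓘(ℝ, F) f 1 : EH →L[ℝ] F) =
      unitDeriv EH F (fun h => f h * g⁻¹) := by
  subst hg
  have h1 := mfderiv_comp (I := 𝓘(ℝ, EH)) (I' := 𝓘(ℝ, F)) (I'' := 𝓘(ℝ, F)) (1 : H)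
    (g := fun x : Gs => x * (f 1)⁻¹) (f := f)
    ((contMDiff_mul_const (E := F) _).contMDiffAt.mdifferentiableAt (by simp))
    (hf.contMDiffAt.mdifferentiableAt (by simp))
  refine h1.symm.trans ?_
  exact mfderiv_one_eq_unitDeriv ((contMDiff_mul_const (E := F) _).comp hf).contMDiffAt (by simp)

end Final

end PoissonLie

end

end Development

open PoissonLie in
theorem mainTheorem7
    {E F EH EK : Type*}
    [NormedAddCommGroup E] [NormedSpace ℝ E] [FiniteDimensional ℝ E]
    [NormedAddCommGroup F] [NormedSpace ℝ F] [FiniteDimensional ℝ F]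
    [NormedAddCommGroup EH] [NormedSpace ℝ EH] [FiniteDimensional ℝ EH]
    [NormedAddCommGroup EK] [NormedSpace ℝ EK] [FiniteDimensional ℝ EK]
    -- the Poisson Lie group `G`
    {G : Type*} [TopologicalSpace G] [ChartedSpace E G] [Group G] [LieGroup 𝓘(ℝ, E) ∞ G]
    (πG : PoissonLie.PoissonStructure E G) (hG : πG.IsMultiplicative)
    -- the dual Poisson Lie group `Gs`
    {Gs : Type*} [TopologicalSpace Gs] [ChartedSpace F Gs] [Group Gs] [LieGroup 𝓘(ℝ, F) ∞ Gs]
    [SimplyConnectedSpace Gs]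
    (πGs : PoissonLie.PoissonStructure F Gs) (hGs : πGs.IsMultiplicative)
    (ψ : GroupLieAlgebra 𝓘(ℝ, F) Gs ≃L[ℝ] (GroupLieAlgebra 𝓘(ℝ, E) G →L[ℝ] ℝ))
    (hψ : PoissonLie.IsDualPair πG πGs ψ)
    -- the connected closed Poisson Lie subgroup `H` of `G`
    {H : Type*} [TopologicalSpace H] [ChartedSpace EH H] [Group H] [LieGroup 𝓘(ℝ, EH) ∞ H]
    [ConnectedSpace H]
    (ι : H →* G) (hι : PoissonLie.IsClosedLieSubgroup 𝓘(ℝ, EH) 𝓘(ℝ, E) ι)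
    (hH : PoissonLie.IsPoissonLieSubgroup (EH := EH) πG ι)
    -- the simply connected closed subgroup `K` of `Gs` whose Lie algebra is the annihilator
    -- of the Lie algebra of `H`
    {K : Type*} [TopologicalSpace K] [ChartedSpace EK K] [Group K] [LieGroup 𝓘(ℝ, EK) ∞ K]
    [SimplyConnectedSpace K]
    (j : K →* Gs) (hj : PoissonLie.IsClosedLieSubgroup 𝓘(ℝ, EK) 𝓘(ℝ, F) j)
    (hK : ∀ ξ : GroupLieAlgebra 𝓘(ℝ, F) Gs,
      ξ ∈ Set.range (PoissonLie.lieMap EK F j) ↔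
        ∀ X : GroupLieAlgebra 𝓘(ℝ, EH) H, ψ ξ (PoissonLie.lieMap EH E ι X) = 0) :
    PoissonLie.IsRelativelyComplete (EH := EH) (EK := EK) πG πGs ψ ι j := by
  obtain ⟨πH, hπH, hιP⟩ := hH
  have hιE := lieMap_eq_unitDeriv hι.smooth
  have hjE := lieMap_eq_unitDeriv hj.smooth
  -- the model spaces replace the Lie algebras
  let ψ' : F ≃L[ℝ] (E →L[ℝ] ℝ) := ψ
  have hinj : Function.Injective (unitDeriv EK F j) := by
    rw [← hjE]
    exact hj.immersion 1
  have hrange : ∀ ξ : F, ξ ∈ Set.range (unitDeriv EK F j) ↔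
      ∀ X : EH, ψ' ξ (unitDeriv EH E ι X) = 0 := by
    rw [← hjE, ← hιE]
    exact hK
  have hann : ∀ ξ : EK, ψ' (unitDeriv EK F j ξ) ∘L unitDeriv EH E ι = 0 := fun ξ =>
    ContinuousLinearMap.ext ((hrange _).1 ⟨ξ, rfl⟩)
  have hideal : ∀ (ξ : EK) (η : F) (X : EH),
      ψ' (groupBracket Gs (unitDeriv EK F j ξ) η) (unitDeriv EH E ι X) = 0 := by
    intro ξ η X
    rw [← hψ.apply_rdiff_rightSharp ψ' rfl hG]
    exact rdiff_rightSharp_eq_zero_of_isPoissonMap hG hπH hιP (hann ξ) X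
  obtain ⟨V, hV, hjV, hdV⟩ := exists_dressing_cocycle (ψ := ψ') hGs hj.smooth hι.smooth hinj
    hrange (hψ.apply_rdiff_rightSharp_dual ψ' rfl hGs) hideal
  obtain ⟨A, hA, hjA⟩ := exists_coadjoint_rep (ψ := ψ') hι.smooth hinj hrange
  -- the linearization of `V` and the derivative of `A` have the same pairings with `Lie G`
  obtain ⟨φ, hφ1, hφmul, hφ, hφV⟩ := exists_action_of_cocycle hV hA fun X ξ =>
    (ψ'.injective.comp hinj) (ContinuousLinearMap.ext fun Y =>
      (rdiff_coadjoint_rep hι.smooth hA hjA X ξ Y).trans (hdV ξ X Y).symm)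
  let P : MatchedPair EH EK H K := MatchedPair.ofAction φ hφ1 hφmul hφ
  refine ⟨P, ⟨fun X γ => ?_, fun η h => ?_⟩, P.Double, inferInstance, inferInstance,
    inferInstance, inferInstance, P.inclLeft, P.inclRight, P.isDoubleLieGroup⟩
  · -- the generators of the action, compared in the right trivialization
    refine rightTriv_injective (F := F) (j γ) ?_
    have hsm : ContMDiff 𝓘(ℝ, EH) 𝓘(ℝ, F) ∞ (fun h : H => j (φ h γ)) :=
      hj.smooth.comp (hφ.comp (contMDiff_id.prodMk contMDiff_const))
    have h1 := DFunLike.congr_fun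
      (rightTriv_comp_mfderiv_one (F := F) hsm (g := j γ) (by rw [hφ1])) X
    have h2 : unitDeriv EH F (fun h : H => j (φ h γ) * (j γ)⁻¹) = unitDeriv EK F j ∘L V γ := by
      have h3 := ((hφV γ).map_hom j hj.smooth.contMDiffAt).mul_const (j γ)⁻¹
      refine HasUnitDeriv.unitDeriv_eq (f := fun h : H => j (φ h γ) * (j γ)⁻¹)
        (h3.hasUnitDeriv ?_)
      simp [hφ1]
    rw [h2] at h1
    refine h1.trans ((hjV γ X).trans ?_)
    rw [← hιE]
    rfl
  · -- the right action is trivial, and the right dressing fields vanish on `H`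
    have h1 : (mfderiv 𝓘(ℝ, EK) 𝓘(ℝ, E) (fun _ : K => ι h) 1 : EK →L[ℝ] E) = 0 :=
      mfderiv_const
    have h2 := sharp_comp_leftTriv_eq_zero hιP (hann η) h
    refine (DFunLike.congr_fun h1 η).trans ?_
    symm
    refine (congrArg Neg.neg (?_ : _ = (0 : E))).trans neg_zero
    refine Eq.trans ?_ h2
    rw [← hjE]
    rfl
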